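/- We work over the complex numbers; a variety is an integral separated scheme of finite type over $\mathbb{C}$. For a morphism $f : Z \to S$ of schemes, with $Z$ reduced, write $\Omega^p_{Z/S}$ for the sheaf of relative Kähler $p$-forms (and $\Omega^p_Z$ if $S = \operatorname{Spec}\mathbb{C}$), and let $\check\Omega^p_{Z/S} := \Omega^p_{Z/S}/\mathrm{tor}$ be its quotient by the torsion subsheaf (sections which, on every affine open set $V$, are annihilated by a non-zero-divisor of $\mathcal{O}_Z(V)$); write $\check\Omega^p_Z$ if $S = \operatorname{Spec}\mathbb{C}$. **Proposition 3.11.** Let $X$ be a variety and let $E = E_1 + \dots + E_k$ be a reduced divisor on $X$ with distinct irreducible components $E_i$, also regarded as a reduced closed subscheme of $X$. For $I \subseteq \{1,\dots,k\}$ let $E_I := \bigcap_{i \in I} E_i$ be the scheme-theoretic intersection, with $E_\emptyset := X$. Assume that $(X,E)$ is an snc pair, that is, every non-empty $E_I$ is smooth of dimension $\dim X - |I|$. Let $\phi : X \to Y$ be a morphism to a smooth variety such that $E$ is relatively snc over $Y$, that is, $\phi$ is surjective and for every $I$ with $E_I \neq \emptyset$ the restriction $\phi|_{E_I} : E_I \to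 Y$ is smooth of relative dimension $\dim X - \dim Y - |I|$. Then for every integer $p$ with $0 \le p \le \dim X - 1$ there exist a filtration by sheaves of $\mathcal{O}_E$-submodules $$\check\Omega^p_E = \check{\mathcal F}^0 \supseteq \check{\mathcal F}^1 \supseteq \dots \supseteq \check{\mathcal F}^p \supseteq \check{\mathcal F}^{p+1} = 0$$ and, for all $0 \le r \le p$, short exact sequences of sheaves of $\mathcal{O}_E$-modules $$0 \to \check{\mathcal F}^{r+1} \to \check{\mathcal F}^r \to (\phi|_E)^*\Omega^r_Y \otimes \check\Omega^{p-r}_{E/Y} \to 0,$$ in which the first map is the inclusion. -/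

import Mathlib

open CategoryTheory AlgebraicGeometry TopologicalSpace

noncomputable section

universe v u w

namespace TorsionFreeDiff

/-! ### Exterior powers of presheaves of modules -/

section ExteriorPower

variable {C : Type w} [Category.{v} C] {R : Cᵒᵖ ⥤ CommRingCat.{u}}

/-- The restriction map `⋀ᵖ M(U) → ⋀ᵖ M(V)`, sending `m₁ ∧ ⋯ ∧ mₚ` to the wedge product of the
restrictions of the `mᵢ`. -/
def exteriorPowerMap (M : PresheafOfModules.{u} (R ⋙ forget₂ CommRingCat RingCat)) (p : ℕ)
    {U V : Cᵒᵖ} (f : U ⟶ V) :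
    ModuleCat.exteriorPower (R := R.obj U) (M.obj U) p ⟶
      (ModuleCat.restrictScalars (R.map f).hom).obj
        (ModuleCat.exteriorPower (R := R.obj V) (M.obj V) p) :=
  ModuleCat.exteriorPower.desc (R := R.obj U)
    { toFun := fun m => ModuleCat.exteriorPower.mk (R := R.obj V) (fun i => M.map f (m i))
      map_update_add' := by
        intro _ m i x y
        have h : ∀ z, (fun j => M.map f (Function.update m i z j)) =
            Function.update (fun j => M.map f (m j)) i (M.map f z) := fun z => by
          ext j
          by_cases hj : j = i
          · subst hj; simp
          · simp [hj]
        rw [h, h, h, map_add]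
        exact (_root_.exteriorPower.ιMulti (R.obj V) p).map_update_add _ i _ _
      map_update_smul' := by
        intro _ m i c x
        have h : ∀ z, (fun j => M.map f (Function.update m i z j)) =
            Function.update (fun j => M.map f (m j)) i (M.map f z) := fun z => by
          ext j
          by_cases hj : j = i
          · subst hj; simp
          · simp [hj]
        rw [h, h]
        erw [M.map_smul]
        exact (_root_.exteriorPower.ιMulti (R.obj V) p).map_update_smul _ i _ _
      map_eq_zero_of_eq' := by
        intro m i j h hij
        exact (_root_.exteriorPower.ιMulti (R.obj V) p).map_eq_zero_of_eq _
          (congrArg (M.map f) h) hij }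

lemma exteriorPowerMap_mk (M : PresheafOfModules.{u} (R ⋙ forget₂ CommRingCat RingCat)) (p : ℕ)
    {U V : Cᵒᵖ} (f : U ⟶ V) (m : Fin p → M.obj U) :
    exteriorPowerMap M p f (ModuleCat.exteriorPower.mk (R := R.obj U) m) =
      ModuleCat.exteriorPower.mk (R := R.obj V) (fun i => M.map f (m i)) :=
  ModuleCat.exteriorPower.desc_mk (R := R.obj U) _ m

/-- The presheaf `U ↦ ⋀ᵖ M(U)`. -/
def exteriorPower (M : PresheafOfModules.{u} (R ⋙ forget₂ CommRingCat RingCat)) (p : ℕ) :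
    PresheafOfModules.{u} (R ⋙ forget₂ CommRingCat RingCat) where
  obj U := ModuleCat.exteriorPower (R := R.obj U) (M.obj U) p
  map f := exteriorPowerMap M p f
  map_id U := by
    refine ModuleCat.exteriorPower.hom_ext (R := R.obj U)
      (ModuleCat.AlternatingMap.ext (R := R.obj U) fun m => ?_)
    refine (exteriorPowerMap_mk M p (𝟙 U) m).trans ?_
    simp
    rfl
  map_comp {U V W} f g := by
    refine ModuleCat.exteriorPower.hom_ext (R := R.obj U)
      (ModuleCat.AlternatingMap.ext (R := R.obj U) fun m => ?_)
    refine (exteriorPowerMap_mk M p (f ≫ g) m).trans ?_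
    refine Eq.trans ?_ (congrArg (exteriorPowerMap M p g) (exteriorPowerMap_mk M p f m)).symm
    refine Eq.trans ?_ (exteriorPowerMap_mk M p g _).symm
    simp
    rfl

end ExteriorPower

/-! ### Sheaves of modules on a scheme -/

section Sheaves

variable {X S : Scheme.{u}}

/-- The sheaf of `𝒪_X`-modules associated to a presheaf of `𝒪_X`-modules. -/
def sheafify : X.PresheafOfModules ⥤ X.Modules :=
  PresheafOfModules.sheafification (𝟙 X.ringCatSheaf.obj)

/-- The tensor product `M ⊗ N` over `𝒪_X`: the sheaf associated to `U ↦ M(U) ⊗ N(U)`. -/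
def tensor (M N : X.Modules) : X.Modules :=
  sheafify.obj (PresheafOfModules.Monoidal.tensorObj (R := X.presheaf) M.val N.val)

/-- The torsion of a sheaf of `𝒪_X`-modules `M`: a section `s ∈ M(U)` is torsion if its restriction
to every affine open `V ⊆ U` is annihilated by a non-zero-divisor of `Γ(X, V)`. -/
def torsion (M : X.Modules) : PresheafOfModules.Submodule M.val where
  obj U := ⨅ (V : X.affineOpens) (h : V.1 ≤ U.unop),
    (show Submodule Γ(X, V.1) Γ(M, V.1) from Submodule.torsion Γ(X, V.1) Γ(M, V.1)).comap
      (M.val.restrictₛₗ (homOfLE h).op)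
  map {U W} f s hs := by
    simp only [Submodule.mem_iInf, Submodule.mem_comap] at hs ⊢
    intro V h
    have key : M.val.map (homOfLE (h.trans f.unop.le)).op s =
        M.val.map (homOfLE h).op (M.val.map f s) :=
      M.val.map_comp_apply f (homOfLE h).op s
    have hV : M.val.map (homOfLE (h.trans f.unop.le)).op s ∈
        Submodule.torsion Γ(X, V.1) Γ(M, V.1) := hs V (h.trans f.unop.le)
    rw [key] at hV
    exact hV

/-- The quotient sheaf `M / tor M`: the sheaf associated to `U ↦ M(U) / (tor M)(U)`. -/
def modTorsion (M : X.Modules) : X.Modules :=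
  sheafify.obj (Limits.cokernel (torsion M).ι)

/-- The morphism `f⁻¹ 𝒪_S ⟶ 𝒪_X` of presheaves of rings on `X` belonging to `f : X ⟶ S`, where
`f⁻¹` is the (unsheafified) inverse image `U ↦ colim_{V ⊇ f(U)} 𝒪_S(V)`. -/
def structureMap (f : X ⟶ S) :
    (TopCat.Presheaf.pullback CommRingCat f.base).obj S.presheaf ⟶ X.presheaf :=
  ((TopCat.Presheaf.pullbackPushforwardAdjunction CommRingCat f.base).homEquiv _ _).symm f.c

/-- The presheaf of relative Kähler differentials of `f : X ⟶ S`: on an open `U ⊆ X`, it is the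
module of Kähler differentials of the ring `𝒪_X(U)` over the ring `(f⁻¹ 𝒪_S)(U)`. -/
def kaehlerPresheaf (f : X ⟶ S) : X.PresheafOfModules :=
  PresheafOfModules.DifferentialsConstruction.relativeDifferentials' (structureMap f)

/-- The sheaf `Ω^p_{X/S}` of relative Kähler `p`-forms of `f : X ⟶ S`. -/
def Omega (f : X ⟶ S) (p : ℕ) : X.Modules :=
  sheafify.obj (exteriorPower (R := X.presheaf) (kaehlerPresheaf f) p)

/-- The sheaf of relative torsion-free `p`-forms of `f : X ⟶ S`, that is, `Ω^p_{X/S}` modulo its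
torsion as a sheaf of `𝒪_X`-modules. -/
def OmegaCheck (f : X ⟶ S) (p : ℕ) : X.Modules :=
  modTorsion (Omega f p)

end Sheaves

/-! ### Varieties, divisors, and the snc conditions -/

/-- A complex variety: an integral, separated scheme of finite type over `ℂ`. -/
structure IsVariety {X : Scheme.{0}} (s : X ⟶ Spec (.of ℂ)) : Prop where
  isIntegral : IsIntegral X
  isSeparated : IsSeparated s
  locallyOfFiniteType : LocallyOfFiniteType s
  quasiCompact : QuasiCompact s

section Divisors

variable {X : Scheme.{u}}

/-- A reduced divisor `D₁ + ⋯ + Dₙ`, with distinct prime divisors `Dᵢ`, is given by the finite set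
of generic points of the `Dᵢ`. So it is a finite set of points of codimension one, and the prime
divisor belonging to a point `x` is the closure of `{x}`. -/
def IsReducedDivisor (D : Finset X) : Prop :=
  ∀ x ∈ D, ringKrullDim (X.presheaf.stalk x) = 1

/-- The divisor `D`, as a reduced closed subscheme of `X`. -/
def divisorScheme (D : Finset X) : Scheme.{u} :=
  (Scheme.IdealSheafData.vanishingIdeal (D.sup fun x => Closeds.closure {x})).subscheme

/-- The inclusion of the reduced closed subscheme `D` in `X`. -/
def divisorι (D : Finset X) : divisorScheme D ⟶ X :=
  (Scheme.IdealSheafData.vanishingIdeal (D.sup fun x => Closeds.closure {x})).subschemeι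

/-- The ideal sheaf of the scheme-theoretic intersection `D_I` of the prime divisors in `I`, that
is, the sum of their ideal sheaves. It is zero if `I` is empty. -/
def stratumIdeal (I : Finset X) : X.IdealSheafData :=
  ⨆ x ∈ I, Scheme.IdealSheafData.vanishingIdeal (Closeds.closure {x})

/-- The scheme-theoretic intersection `D_I` of the prime divisors in `I`; it is `X` if `I` is
empty. -/
def stratum (I : Finset X) : Scheme.{u} := (stratumIdeal I).subscheme

/-- The inclusion of `D_I` in `X`. -/
def stratumι (I : Finset X) : stratum I ⟶ X := (stratumIdeal I).subschemeι

/-- `(X, D)` is an snc pair: every non-empty intersection `D_I` of components of `D` (including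
`X` itself, for `I` empty) is smooth over `ℂ`, of dimension `dim X - |I|`. -/
def IsSNCPair {X : Scheme.{0}} (s : X ⟶ Spec (.of ℂ)) (D : Finset X) : Prop :=
  ∀ I ⊆ D, Nonempty (stratum I) →
    ∃ k : ℕ, topologicalKrullDim X = ((I.card + k : ℕ) : WithBot ℕ∞) ∧
      SmoothOfRelativeDimension k (stratumι I ≫ s)

/-- `D` is relatively snc over `Y`, for `φ : X ⟶ Y`: the morphism `φ` is surjective, and for every
non-empty intersection `D_I` of components of `D` (including `X` itself, for `I` empty), the
restriction of `φ` to `D_I` is smooth, of relative dimension `dim X - dim Y - |I|`. -/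
structure IsRelativelySNC {Y : Scheme.{u}} (φ : X ⟶ Y) (D : Finset X) : Prop where
  surjective : Surjective φ
  smooth_stratum : ∀ I ⊆ D, Nonempty (stratum I) →
    ∃ k : ℕ, topologicalKrullDim X = topologicalKrullDim Y + ((I.card + k : ℕ) : WithBot ℕ∞) ∧
      SmoothOfRelativeDimension k (stratumι I ≫ φ)

end Divisors

end TorsionFreeDiff

end

/-!
Let `E` be the divisor, `f : E ⟶ Y` the restriction of `φ`, and write `Ω̌` for forms modulo torsion.
The comultiplication of the exterior algebra, followed by the projection of the second factor to
relative forms, induces maps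

  `c q : Ω̌ᵖ_E ⟶ (Ω^q_E ⊗ Ω̌^(p-q)_{E/Y}) / tor`,

and the `r`-th step of the filtration is the intersection of the kernels of `c 0`, …, `c (r - 1)`
(`kerFiltration`). The sheaf `f^* Ωʳ_Y ⊗ Ω̌^(p-r)_{E/Y}` maps to the target of `c r` by pulling back
forms (`pullbackFormCheck`). It is the `r`-th graded piece as soon as this map is injective and has
the same image as the restriction of `c r` to the `r`-th step. This definition needs no choices, so
it is global, and everything that remains can be checked on stalks (`GradedBy`,
`exists_filtration`). Formation of `Ω̌` commutes with taking stalks because `E` is locally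
noetherian.

Let `R → B` be the local homomorphism from a local ring of `Y` to a local ring of `E`, and let `y₁`,
…, `yₘ` be elements of `R` whose differentials form a basis of `Ω_R`. The key point is that `B` has
derivations `δ₁`, …, `δₘ` with `δᵢ yⱼ = δᵢⱼ` (`HasDualDerivations`). They split the sequence
`B ⊗ Ω_R → Ω_B → Ω_{B/R} → 0` on the left. With such a splitting `⋀ᵖ Ω_B` is the direct sum of the
modules `⋀ʳ (B ⊗ Ω_R) ⊗ ⋀^(p-r) Ω_{B/R}`, whose first factors are free, and this decomposition
passes to the quotients by torsion. Then `c r` restricted to the `r`-th step is the projection to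
the summand of index `r` (`comultModTor_mem_range`, `exists_comultModTor_eq`,
`eq_zero_of_comultModTor`), which gives `exists_filtration_of_dualDerivations`.

The derivations exist because `E` is relatively snc. Let `A` be the local ring of `X`. As the
components of `E` are smooth over `Y` of relative dimension one less than `X`, each is cut out in
`A` by one equation `xᵢ` (`exists_ker_eq_span_singleton`). As the intersection of the components
through the point has the expected relative dimension, the differentials of the `xᵢ` are part of a
basis of `Ω_{A/R}`, so there are `R`-derivations `∂ᵢ` of `A` dual to the `xᵢ`
(`exists_derivation_dual`). Since `A` is smooth over `R`, the derivation of `R` dual to `yⱼ` extends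
to a derivation `δ` of `A` (`exists_derivation_extension`). Subtracting `∑ᵢ δ(xᵢ) ∂ᵢ`, which kills
`R`, makes `δ` vanish on all `xᵢ`; it then preserves the ideals `(xᵢ)` and their intersection, which
is the ideal of `E`, and so descends to `B` (`hasDualDerivations_of_equations`).
-/

noncomputable section
namespace ExteriorShuffle

/-! ### Comultiplication and multiplication of exterior powers -/

section Comultiplication

open TensorProduct

variable {A A' : Type*} [CommRing A] [CommRing A'] {N N₁ N₂ N' N₁' : Type*}
  [AddCommGroup N] [Module A N] [AddCommGroup N₁] [Module A N₁] [AddCommGroup N₂] [Module A N₂]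
  [AddCommGroup N'] [Module A' N'] [AddCommGroup N₁'] [Module A' N₁']

/-- The semilinear map between exterior powers induced by a semilinear map. -/
def exteriorMapₛₗ {f : A →+* A'} (g : N →ₛₗ[f] N') (p : ℕ) : ⋀[A]^p N →ₛₗ[f] ⋀[A']^p N' :=
  letI : Module A (⋀[A']^p N') := Module.compHom _ f
  let φ : N [⋀^Fin p]→ₗ[A] ⋀[A']^p N' :=
    { toFun := fun m => exteriorPower.ιMulti A' p (g ∘ m)
      map_update_add' := by
        intro _ m i x y
        simp only [Function.comp_update, map_add, AlternatingMap.map_update_add]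
      map_update_smul' := by
        intro _ m i c x
        simp only [Function.comp_update, map_smulₛₗ, AlternatingMap.map_update_smul]
        rfl
      map_eq_zero_of_eq' := fun m i j h hij =>
        AlternatingMap.map_eq_zero_of_eq _ _ (congrArg g h) hij }
  let l := exteriorPower.alternatingMapLinearEquiv φ
  { toFun := l
    map_add' := l.map_add
    map_smul' := l.map_smul }

@[simp]
lemma exteriorMapₛₗ_ιMulti {f : A →+* A'} (g : N →ₛₗ[f] N') (p : ℕ) (m : Fin p → N) :
    exteriorMapₛₗ g p (exteriorPower.ιMulti A p m) =
      exteriorPower.ιMulti A' p (g ∘ m) := by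
  let : Module A (⋀[A']^p N') := Module.compHom _ f
  exact exteriorPower.alternatingMapLinearEquiv_apply_ιMulti _ m

/-- The index set `Fin p` as a disjoint union of `r` and `s` indices. -/
def splitFin {r s p : ℕ} (h : r + s = p) : Fin r ⊕ Fin s ≃ Fin p :=
  finSumFinEquiv.trans (finCongr h)

/-- The component `⋀ᵖ N → ⋀ʳ N ⊗ ⋀ˢ N₁` of the comultiplication of the exterior algebra of `N`,
followed by the map induced by `q : N → N₁` on the second factor. -/
def comult {r s p : ℕ} (h : r + s = p) (q : N →ₗ[A] N₁) :
    ⋀[A]^p N →ₗ[A] ⋀[A]^r N ⊗[A] ⋀[A]^s N₁ :=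
  exteriorPower.alternatingMapLinearEquiv (R := A) (M := N)
    (AlternatingMap.domDomCongr (splitFin h) (AlternatingMap.domCoprod (exteriorPower.ιMulti A r)
      ((exteriorPower.ιMulti A s).compLinearMap q)))

lemma comult_ιMulti {r s p : ℕ} (h : r + s = p) (q : N →ₗ[A] N₁) (m : Fin p → N) :
    comult h q (exteriorPower.ιMulti A p m) =
      ∑ σ : Equiv.Perm.ModSumCongr (Fin r) (Fin s),
        AlternatingMap.domCoprod.summand (exteriorPower.ιMulti A r)
          ((exteriorPower.ιMulti A s).compLinearMap q) σ (m ∘ splitFin h) := by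
  rw [comult, exteriorPower.alternatingMapLinearEquiv_apply_ιMulti]
  simp [AlternatingMap.domDomCongr_apply, Function.comp_def]

lemma summand_mk {r s : ℕ} (q : N →ₗ[A] N₁) (σ : Equiv.Perm (Fin r ⊕ Fin s))
    (m : Fin r ⊕ Fin s → N) :
    AlternatingMap.domCoprod.summand (exteriorPower.ιMulti A r)
        ((exteriorPower.ιMulti A s).compLinearMap q) (Quotient.mk'' σ) m =
      Equiv.Perm.sign σ •
        (exteriorPower.ιMulti A r (fun i => m (σ (Sum.inl i))) ⊗ₜ[A]
          exteriorPower.ιMulti A s (fun i => q (m (σ (Sum.inr i))))) := by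
  rw [AlternatingMap.domCoprod.summand_mk'']
  rfl

lemma map_comult {f : A →+* A'} {q : N →ₗ[A] N₁} {q' : N' →ₗ[A'] N₁'} (g : N →ₛₗ[f] N')
    (g₁ : N₁ →ₛₗ[f] N₁') (hg : ∀ x, g₁ (q x) = q' (g x)) {r s p : ℕ} (h : r + s = p)
    (x : ⋀[A]^p N) :
    TensorProduct.map (exteriorMapₛₗ g r) (exteriorMapₛₗ g₁ s) (comult h q x) =
      comult h q' (exteriorMapₛₗ g p x) := by
  have hx : x ∈ Submodule.span A (Set.range (exteriorPower.ιMulti A p (M := N))) := by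
    rw [exteriorPower.ιMulti_span]; trivial
  induction hx using Submodule.span_induction with
  | zero => simp
  | add x y _ _ hx hy => simp only [map_add, hx, hy]
  | smul a x _ hx => simp only [map_smulₛₗ, hx, RingHom.id_apply]
  | mem x hx =>
    obtain ⟨m, rfl⟩ := hx
    rw [exteriorMapₛₗ_ιMulti, comult_ιMulti, comult_ιMulti, map_sum]
    refine Finset.sum_congr rfl fun σ _ => ?_
    induction σ using Quotient.inductionOn' with | _ σ
    rw [summand_mk, summand_mk, Units.smul_def, Units.smul_def, map_zsmul, TensorProduct.map_tmul,
      exteriorMapₛₗ_ιMulti, exteriorMapₛₗ_ιMulti]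
    simp [Function.comp_def, hg]

/-- The multiplication `⋀ʳ N ⊗ ⋀ˢ N → ⋀ᵖ N` of the exterior algebra of `N`. -/
def wedge {r s p : ℕ} (h : r + s = p) : ⋀[A]^r N ⊗[A] ⋀[A]^s N →ₗ[A] ⋀[A]^p N :=
  TensorProduct.lift (LinearMap.mk₂ A
    (fun x y => ⟨x.1 * y.1, by
      subst h
      have := Submodule.mul_mem_mul x.2 y.2
      rwa [← pow_add] at this⟩)
    (fun x x' y => Subtype.ext (add_mul _ _ _)) (fun a x y => Subtype.ext (smul_mul_assoc _ _ _))
    (fun x y y' => Subtype.ext (mul_add _ _ _)) (fun a x y => Subtype.ext (mul_smul_comm _ _ _)))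

lemma wedge_ιMulti {r s p : ℕ} (h : r + s = p) (a : Fin r → N) (b : Fin s → N) :
    wedge h (exteriorPower.ιMulti A r a ⊗ₜ exteriorPower.ιMulti A s b) =
      exteriorPower.ιMulti A p (Sum.elim a b ∘ (splitFin h).symm) := by
  subst h
  refine Subtype.ext ((ExteriorAlgebra.ιMulti_mul_ιMulti a b).trans ?_)
  rw [exteriorPower.ιMulti_apply_coe]
  congr 1
  ext i
  induction i using Fin.addCases <;> simp [splitFin]

/-- The image of the first `r` indices under a permutation of `r + s` indices determines the class
of the permutation modulo the permutations of the first `r` and of the last `s` indices. -/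
def shuffleSet (r s : ℕ) (σ : Equiv.Perm.ModSumCongr (Fin r) (Fin s)) : Finset (Fin r ⊕ Fin s) :=
  Quotient.liftOn' σ (fun σ => Finset.univ.image fun i => σ (Sum.inl i)) (by
    intro σ τ hστ
    rw [QuotientGroup.leftRel_apply] at hστ
    obtain ⟨⟨a, b⟩, hab⟩ := hστ
    obtain rfl : τ = σ * Equiv.Perm.sumCongrHom _ _ (a, b) := by rw [hab]; group
    ext x
    simp only [Finset.mem_image, Finset.mem_univ, true_and, Equiv.Perm.coe_mul,
      Function.comp_apply, Equiv.Perm.sumCongrHom_apply, Equiv.Perm.sumCongr_apply, Sum.map_inl]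
    exact ⟨fun ⟨i, hi⟩ => ⟨a.symm i, by simpa using hi⟩, fun ⟨i, hi⟩ => ⟨a i, hi⟩⟩)

lemma shuffleSet_mk {r s : ℕ} (σ : Equiv.Perm (Fin r ⊕ Fin s)) :
    shuffleSet r s (Quotient.mk'' σ) = Finset.univ.image fun i => σ (Sum.inl i) := rfl

lemma card_shuffleSet {r s : ℕ} (σ : Equiv.Perm.ModSumCongr (Fin r) (Fin s)) :
    (shuffleSet r s σ).card = r := by
  induction σ using Quotient.inductionOn' with | _ σ
  rw [shuffleSet_mk, Finset.card_image_of_injective _ fun i j hij =>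
    Sum.inl_injective (σ.injective hij)]
  simp

lemma shuffleSet_injective (r s : ℕ) : Function.Injective (shuffleSet r s) := by
  intro σ τ h
  induction σ using Quotient.inductionOn' with | _ σ
  induction τ using Quotient.inductionOn' with | _ τ
  rw [shuffleSet_mk, shuffleSet_mk] at h
  refine Quotient.sound' ?_
  rw [QuotientGroup.leftRel_apply]
  refine Equiv.Perm.mem_sumCongrHom_range_of_perm_mapsTo_inl ?_
  rintro _ ⟨i, rfl⟩
  have hi : τ (Sum.inl i) ∈ Finset.univ.image fun i => σ (Sum.inl i) := by
    rw [h]; exact Finset.mem_image_of_mem _ (Finset.mem_univ i)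
  obtain ⟨j, -, hj⟩ := Finset.mem_image.1 hi
  exact ⟨j, by simp [← hj]⟩

lemma exists_shuffleSet_eq {r s : ℕ} {S : Finset (Fin r ⊕ Fin s)} (hS : S.card = r) :
    ∃ σ, shuffleSet r s σ = S := by
  have e : Set.range (Sum.inl : Fin r → Fin r ⊕ Fin s) ≃ S :=
    (Equiv.ofInjective _ Sum.inl_injective).symm.trans (Finset.equivFinOfCardEq hS).symm
  have he : ∀ i : Fin r, e.extendSubtype (Sum.inl i) = e ⟨Sum.inl i, i, rfl⟩ := fun i =>
    Equiv.extendSubtype_apply_of_mem e _ ⟨i, rfl⟩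
  refine ⟨Quotient.mk'' e.extendSubtype, ?_⟩
  rw [shuffleSet_mk]
  refine Finset.eq_of_subset_of_card_le ?_ ?_
  · intro x hx
    obtain ⟨i, -, rfl⟩ := Finset.mem_image.1 hx
    rw [he]
    exact (e _).2
  · rw [Finset.card_image_of_injective _ fun i j hij =>
      Sum.inl_injective (e.extendSubtype.injective hij), hS]
    simp

/-- On a decomposable element, multiplication after comultiplication distributes the factors in
all ways over the two sides. -/
lemma wedge_map_comult_ιMulti {r s p : ℕ} (h : r + s = p) (q : N →ₗ[A] N₁) (u : N →ₗ[A] N₂)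
    (v : N₁ →ₗ[A] N₂) (m : Fin p → N) :
    wedge h (TensorProduct.map (exteriorPower.map r u) (exteriorPower.map s v)
        (comult h q (exteriorPower.ιMulti A p m))) =
      ∑ S ∈ Finset.univ.powersetCard r, exteriorPower.ιMulti A p
        (S.piecewise (fun i => u (m i)) (fun i => v (q (m i)))) := by
  rw [comult_ιMulti, map_sum, map_sum]
  refine Finset.sum_bij (fun σ _ => (shuffleSet r s σ).map (splitFin h).toEmbedding) ?_ ?_ ?_ ?_
  · intro σ _
    simp [Finset.mem_powersetCard, card_shuffleSet]
  · intro σ _ τ _ hστ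
    exact shuffleSet_injective r s (Finset.map_injective _ hστ)
  · intro S hS
    obtain ⟨σ, hσ⟩ := exists_shuffleSet_eq (r := r) (s := s)
      (S := S.map (splitFin h).symm.toEmbedding)
      (by rw [Finset.card_map]; exact (Finset.mem_powersetCard.1 hS).2)
    refine ⟨σ, Finset.mem_univ _, ?_⟩
    rw [hσ, Finset.map_map]
    ext x
    simp
  · intro σ _
    induction σ using Quotient.inductionOn' with | _ σ
    rw [summand_mk, Units.smul_def, map_zsmul, map_zsmul, TensorProduct.map_tmul,
      exteriorPower.map_apply_ιMulti, exteriorPower.map_apply_ιMulti, wedge_ιMulti]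
    set w : Fin p → N₂ :=
      ((shuffleSet r s (Quotient.mk'' σ)).map (splitFin h).toEmbedding).piecewise
      (fun i => u (m i)) (fun i => v (q (m i))) with hw
    -- the factors on the left are a permutation of the factors on the right
    have key : (Sum.elim (u ∘ fun i => (m ∘ splitFin h) (σ (Sum.inl i)))
        (v ∘ fun i => q ((m ∘ splitFin h) (σ (Sum.inr i)))) ∘ (splitFin h).symm) =
        w ∘ (splitFin h).permCongr σ := by
      ext k
      obtain ⟨k, rfl⟩ := (splitFin h).surjective k
      simp only [Function.comp_apply, Equiv.permCongr_apply, hw]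
      rw [Equiv.symm_apply_apply]
      rcases k with i | i
      · rw [Finset.piecewise_eq_of_mem]
        · rfl
        · rw [Finset.mem_map_equiv, Equiv.symm_apply_apply, shuffleSet_mk]
          exact Finset.mem_image_of_mem _ (Finset.mem_univ i)
      · rw [Finset.piecewise_eq_of_notMem]
        · rfl
        · rw [Finset.mem_map_equiv, Equiv.symm_apply_apply, shuffleSet_mk]
          simp
    rw [key, AlternatingMap.map_perm, Equiv.Perm.sign_permCongr, Units.smul_def, smul_smul]
    rw [← Units.val_mul, Int.units_mul_self]
    simp

/-- If `u + v ∘ q` is the identity, then the exterior powers decompose accordingly. -/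
lemma sum_wedge_map_comult {q : N →ₗ[A] N₁} {u : N →ₗ[A] N} {v : N₁ →ₗ[A] N}
    (huv : ∀ x, u x + v (q x) = x) {p : ℕ} (x : ⋀[A]^p N) :
    ∑ r : Fin (p + 1), wedge (Nat.add_sub_cancel' (Nat.le_of_lt_succ r.2))
      (TensorProduct.map (exteriorPower.map r u) (exteriorPower.map (p - r) v)
        (comult (Nat.add_sub_cancel' (Nat.le_of_lt_succ r.2)) q x)) = x := by
  have hx : x ∈ Submodule.span A (Set.range (exteriorPower.ιMulti A p (M := N))) := by
    rw [exteriorPower.ιMulti_span]; trivial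
  induction hx using Submodule.span_induction with
  | zero => simp
  | add x y _ _ hx hy => simp only [map_add, Finset.sum_add_distrib, hx, hy]
  | smul a x _ hx => simp only [map_smul, ← Finset.smul_sum, hx]
  | mem x hx =>
    obtain ⟨m, rfl⟩ := hx
    simp only [wedge_map_comult_ιMulti]
    have := (exteriorPower.ιMulti A p (M := N)).toMultilinearMap.map_add_univ
      (fun i => u (m i)) (fun i => v (q (m i)))
    have h2 : (fun i => u (m i)) + (fun i => v (q (m i))) = m := funext fun i => huv (m i)
    rw [h2, ← Finset.powerset_univ, Finset.sum_powerset, Finset.card_univ, Fintype.card_fin,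
      Finset.sum_range] at this
    exact this.symm

/-- The only way to distribute `r` vectors of `ker q` and `s` further vectors such that no
vector of `ker q` is on the right is to have the vectors of `ker q` on the left. -/
lemma comult_wedge_ιMulti {r s p : ℕ} (h : r + s = p) {q : N →ₗ[A] N₁} {a : Fin r → N}
    (ha : ∀ i, q (a i) = 0) (b : Fin s → N) :
    comult h q (wedge h (exteriorPower.ιMulti A r a ⊗ₜ exteriorPower.ιMulti A s b)) =
      exteriorPower.ιMulti A r a ⊗ₜ exteriorPower.ιMulti A s (q ∘ b) := by
  rw [wedge_ιMulti, comult_ιMulti]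
  refine (Finset.sum_eq_single (Quotient.mk'' 1) ?_ ?_).trans ?_
  · intro σ _ hσ
    induction σ using Quotient.inductionOn' with | _ σ
    rw [summand_mk]
    have : ∃ i, ∃ j, σ (Sum.inr i) = Sum.inl j := by
      by_contra! hc
      apply hσ
      refine Quotient.sound' ?_
      rw [QuotientGroup.leftRel_apply, mul_one]
      refine inv_mem (Equiv.Perm.mem_sumCongrHom_range_of_perm_mapsTo_inl
        ((Equiv.Perm.perm_mapsTo_inl_iff_mapsTo_inr σ).2 ?_))
      rintro _ ⟨i, rfl⟩
      rcases hi : σ (Sum.inr i) with j | j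
      · exact absurd hi (hc i j)
      · exact ⟨j, rfl⟩
    obtain ⟨i, j, hij⟩ := this
    rw [(exteriorPower.ιMulti A s).map_coord_zero i (by simp [hij, ha])]
    simp
  · simp
  · rw [summand_mk]
    simp [Function.comp_def]

/-- If there are more than `r'` vectors of `ker q`, then one of them ends up on the right whenever
only `r'` vectors go to the left. -/
lemma comult_wedge_ιMulti_eq_zero {r s r' s' p : ℕ} (h : r + s = p) (h' : r' + s' = p)
    (hr : r' < r) {q : N →ₗ[A] N₁} {a : Fin r → N} (ha : ∀ i, q (a i) = 0) (b : Fin s → N) :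
    comult h' q (wedge h (exteriorPower.ιMulti A r a ⊗ₜ
      exteriorPower.ιMulti A s b)) = 0 := by
  rw [wedge_ιMulti, comult_ιMulti]
  refine Finset.sum_eq_zero fun σ _ => ?_
  induction σ using Quotient.inductionOn' with | _ σ
  rw [summand_mk]
  -- `s' > s` vectors go to the right, so one of them is in `ker q`
  have : ∃ i, ∃ j, (splitFin h).symm (splitFin h' (σ (Sum.inr i))) = Sum.inl j := by
    by_contra! hc
    have : ∀ i, ∃ j, (splitFin h).symm (splitFin h' (σ (Sum.inr i))) = Sum.inr j := fun i => by
      rcases hi : (splitFin h).symm (splitFin h' (σ (Sum.inr i))) with j | j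
      · exact absurd hi (hc i j)
      · exact ⟨j, rfl⟩
    choose f hf using this
    have hinj : Function.Injective f := by
      intro i j hij
      have := (hf i).trans ((congrArg Sum.inr hij).trans (hf j).symm)
      simpa using this
    have := Fintype.card_le_of_injective f hinj
    simp only [Fintype.card_fin] at this
    omega
  obtain ⟨i, j, hij⟩ := this
  rw [(exteriorPower.ιMulti A s').map_coord_zero i (by simp [hij, ha])]
  simp

end Comultiplication

end ExteriorShuffle

namespace ExteriorShuffle

/-! ### Exterior powers of a split extension, modulo torsion -/

section Torsion

open TensorProduct nonZeroDivisors

variable {B : Type*} [CommRing B] {M M₁ M₂ P Q : Type*}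
  [AddCommGroup M] [Module B M] [AddCommGroup M₁] [Module B M₁] [AddCommGroup M₂] [Module B M₂]
  [AddCommGroup P] [Module B P] [AddCommGroup Q] [Module B Q]

variable (B M) in
/-- The quotient of a module by its torsion submodule. -/
abbrev ModTor := M ⧸ Submodule.torsion B M

lemma map_mem_torsion (f : M →ₗ[B] M₁) {x : M} (hx : x ∈ Submodule.torsion B M) :
    f x ∈ Submodule.torsion B M₁ := by
  obtain ⟨a, ha⟩ := hx
  refine ⟨a, ?_⟩
  have : f (a.1 • x) = 0 := by rw [show a.1 • x = 0 from ha, map_zero]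
  rwa [map_smul] at this

lemma mem_torsion_of_smul_mem {x : M} (a : B⁰) (hx : a.1 • x ∈ Submodule.torsion B M) :
    x ∈ Submodule.torsion B M := by
  obtain ⟨b, hb⟩ := hx
  exact ⟨b * a, by rw [← hb]; exact mul_smul b.1 a.1 x⟩

lemma mk_map_eq_of_add_sum_eq {ι : Type*} (f : M →ₗ[B] M₁) (s : Finset ι) (π : ι → M) {x y : M}
    (h : y + ∑ i ∈ s, π i = x) (hπ : ∀ i ∈ s, f (π i) ∈ Submodule.torsion B M₁) :
    (Submodule.Quotient.mk (f y) : M₁ ⧸ Submodule.torsion B M₁) = Submodule.Quotient.mk (f x) := by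
  rw [← h, map_add, map_sum, Submodule.Quotient.mk_add, left_eq_add, Submodule.Quotient.mk_eq_zero]
  exact sum_mem hπ

/-- The map induced on quotients by the torsion submodules. -/
def modTorMap (f : M →ₗ[B] M₁) : ModTor B M →ₗ[B] ModTor B M₁ :=
  Submodule.mapQ _ _ f fun _ hx => map_mem_torsion f hx

@[simp]
lemma modTorMap_mk (f : M →ₗ[B] M₁) (x : M) :
    modTorMap f (Submodule.Quotient.mk x) = Submodule.Quotient.mk (f x) := rfl

/-- A flat module tensored with a torsion-free quotient has no torsion. -/
lemma eq_zero_of_mem_torsion_tensor [Module.Flat B P] {t : P ⊗[B] ModTor B M}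
    (ht : t ∈ Submodule.torsion B (P ⊗[B] ModTor B M)) : t = 0 := by
  obtain ⟨a, ha⟩ := ht
  have hinj : Function.Injective (LinearMap.lsmul B (ModTor B M) a.1) := by
    rw [injective_iff_map_eq_zero]
    intro x hx
    obtain ⟨x, rfl⟩ := Submodule.Quotient.mk_surjective _ x
    rw [LinearMap.lsmul_apply, ← Submodule.Quotient.mk_smul, Submodule.Quotient.mk_eq_zero] at hx
    rw [Submodule.Quotient.mk_eq_zero]
    exact mem_torsion_of_smul_mem a hx
  refine (Module.Flat.lTensor_preserves_injective_linearMap (M := P) _ hinj) ?_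
  rw [map_zero, ← show a.1 • t = 0 from ha]
  have : LinearMap.lTensor P (LinearMap.lsmul B (ModTor B M) a.1) =
      LinearMap.lsmul B (P ⊗[B] ModTor B M) a.1 := by
    ext; simp
  rw [this, LinearMap.lsmul_apply]

/-- If the image of `z` in `M₁ ⊗ (M / tor M)` is torsion, then every linear map takes `z` to a
torsion element. -/
lemma map_mem_torsion_of_lTensor (f : M₁ ⊗[B] M →ₗ[B] M₂) {z : M₁ ⊗[B] M}
    (hz : (Submodule.torsion B M).mkQ.lTensor M₁ z ∈ Submodule.torsion B (M₁ ⊗[B] ModTor B M)) :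
    f z ∈ Submodule.torsion B M₂ := by
  obtain ⟨a, ha⟩ := hz
  refine mem_torsion_of_smul_mem a ?_
  rw [← map_smul]
  have h0 : (Submodule.torsion B M).mkQ.lTensor M₁ (a.1 • z) = 0 := by rw [map_smul]; exact ha
  have hex := lTensor_exact M₁ (f := (Submodule.torsion B M).subtype)
    (g := (Submodule.torsion B M).mkQ)
    (LinearMap.exact_subtype_mkQ _) (Submodule.mkQ_surjective _)
  obtain ⟨w, hw⟩ := (hex _).1 h0
  rw [← hw]
  clear hw
  induction w with
  | zero => simp
  | add x y hx hy => simp only [map_add]; exact add_mem hx hy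
  | tmul x y =>
    rw [LinearMap.lTensor_tmul]
    exact map_mem_torsion (f ∘ₗ TensorProduct.mk B M₁ M x) y.2

variable {p : ℕ} (q : M →ₗ[B] Q)

/-- The comultiplication `⋀ᵖ M / tor → (⋀ʳ M ⊗ (⋀ˢ Q / tor)) / tor` induced by `q : M → Q`. -/
def comultModTor {r s : ℕ} (h : r + s = p) :
    ModTor B (⋀[B]^p M) →ₗ[B] ModTor B (⋀[B]^r M ⊗[B] ModTor B (⋀[B]^s Q)) :=
  modTorMap ((Submodule.torsion B (⋀[B]^s Q)).mkQ.lTensor _ ∘ₗ comult h q)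

/-- The map `P ⊗ (N / tor) → (M ⊗ (N / tor)) / tor` induced by `η : P → M`. -/
def tensorModTor {N : Type*} [AddCommGroup N] [Module B N] (η : P →ₗ[B] M) :
    P ⊗[B] ModTor B N →ₗ[B] ModTor B (M ⊗[B] ModTor B N) :=
  Submodule.mkQ _ ∘ₗ η.rTensor _

/-- Passing to the quotient by the torsion loses nothing, since a retraction of `η` maps torsion to
torsion, and `P ⊗ (N / tor)` has none. -/
lemma tensorModTor_injective {N : Type*} [AddCommGroup N] [Module B N] [Module.Flat B P]
    {η : P →ₗ[B] M} {θ : M →ₗ[B] P} (hθ : ∀ x, θ (η x) = x) :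
    Function.Injective (tensorModTor (N := N) η) := by
  rw [injective_iff_map_eq_zero]
  intro t ht
  rw [tensorModTor, LinearMap.comp_apply, Submodule.mkQ_apply, Submodule.Quotient.mk_eq_zero] at ht
  have := map_mem_torsion (θ.rTensor _) ht
  rw [← LinearMap.comp_apply, ← LinearMap.rTensor_comp,
    show θ ∘ₗ η = LinearMap.id from LinearMap.ext hθ, LinearMap.rTensor_id] at this
  exact eq_zero_of_mem_torsion_tensor this

variable {q} {u : M →ₗ[B] M} {v : Q →ₗ[B] M}

lemma tensor_exteriorPower_ext {r s : ℕ} {f g : ⋀[B]^r M ⊗[B] ⋀[B]^s Q →ₗ[B] M₁}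
    (h : ∀ a b, f (exteriorPower.ιMulti B r a ⊗ₜ exteriorPower.ιMulti B s b) =
      g (exteriorPower.ιMulti B r a ⊗ₜ exteriorPower.ιMulti B s b)) : f = g := by
  refine TensorProduct.ext' fun x y => ?_
  have hx : f ∘ₗ (TensorProduct.mk B _ _).flip y = g ∘ₗ (TensorProduct.mk B _ _).flip y := by
    refine exteriorPower.linearMap_ext (AlternatingMap.ext fun a => ?_)
    have hy : f ∘ₗ TensorProduct.mk B _ _ (exteriorPower.ιMulti B r a) =
        g ∘ₗ TensorProduct.mk B _ _ (exteriorPower.ιMulti B r a) :=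
      exteriorPower.linearMap_ext (AlternatingMap.ext fun b => h a b)
    exact LinearMap.congr_fun hy y
  exact LinearMap.congr_fun hx x

lemma comult_wedge_map {r s : ℕ} (h : r + s = p) (hu : ∀ x, q (u x) = 0) (hv : ∀ y, q (v y) = y)
    (z : ⋀[B]^r M ⊗[B] ⋀[B]^s Q) :
    comult h q (wedge h (TensorProduct.map (exteriorPower.map r u) (exteriorPower.map s v) z)) =
      (exteriorPower.map r u).rTensor _ z := by
  have : comult h q ∘ₗ wedge h ∘ₗ TensorProduct.map (exteriorPower.map r u)
      (exteriorPower.map s v) = (exteriorPower.map r u).rTensor _ := by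
    refine tensor_exteriorPower_ext (M₁ := ⋀[B]^r M ⊗[B] ⋀[B]^s Q) fun a b => ?_
    simp only [LinearMap.comp_apply, TensorProduct.map_tmul, exteriorPower.map_apply_ιMulti,
      LinearMap.rTensor_tmul]
    rw [comult_wedge_ιMulti h (a := u ∘ a) (fun i => hu (a i))]
    simp [Function.comp_def, hv]
  exact LinearMap.congr_fun this z

lemma comult_wedge_map_eq_zero {r s r' s' : ℕ} (h : r + s = p) (h' : r' + s' = p) (hr : r' < r)
    (hu : ∀ x, q (u x) = 0) (z : ⋀[B]^r M ⊗[B] ⋀[B]^s Q) :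
    comult h' q (wedge h (TensorProduct.map (exteriorPower.map r u) (exteriorPower.map s v) z)) =
      0 := by
  have : comult h' q ∘ₗ wedge h ∘ₗ TensorProduct.map (exteriorPower.map r u)
      (exteriorPower.map s v) = 0 := by
    refine tensor_exteriorPower_ext (M₁ := ⋀[B]^r' M ⊗[B] ⋀[B]^s' Q) fun a b => ?_
    simp only [LinearMap.comp_apply, TensorProduct.map_tmul, exteriorPower.map_apply_ιMulti]
    rw [comult_wedge_ιMulti_eq_zero h h' hr (a := u ∘ a) (fun i => hu (a i))]
    simp
  exact LinearMap.congr_fun this z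

lemma wedge_map_comult_mem_torsion {r s : ℕ} (h : r + s = p) {x : ⋀[B]^p M}
    (hx : comultModTor q h (Submodule.Quotient.mk x) = 0) :
    wedge h (TensorProduct.map (exteriorPower.map r u) (exteriorPower.map s v) (comult h q x)) ∈
      Submodule.torsion B (⋀[B]^p M) := by
  rw [comultModTor, modTorMap_mk, Submodule.Quotient.mk_eq_zero] at hx
  exact map_mem_torsion_of_lTensor
    (wedge h ∘ₗ TensorProduct.map (exteriorPower.map r u) (exteriorPower.map s v)) hx

/-- The comultiplications `⋀ᵖ M / tor → (⋀ʳ M ⊗ (⋀ᵖ⁻ʳ Q / tor)) / tor` are jointly injective. -/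
lemma eq_zero_of_comultModTor (huv : ∀ x, u x + v (q x) = x) {x : ModTor B (⋀[B]^p M)}
    (hx : ∀ r s (h : r + s = p), comultModTor q h x = 0) : x = 0 := by
  obtain ⟨x, rfl⟩ := Submodule.Quotient.mk_surjective _ x
  rw [Submodule.Quotient.mk_eq_zero, ← sum_wedge_map_comult huv x]
  exact sum_mem fun r _ => wedge_map_comult_mem_torsion _ (hx _ _ _)

/-- On the elements that all comultiplications of degree less than `r` kill, the comultiplication
of degree `r` only sees the component of degree `r` with respect to `M = im u ⊕ im v`, and hence
takes values in the image of `P`, a model of `⋀ʳ (im u)`. -/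
lemma comultModTor_mem_range {r s : ℕ} (h : r + s = p) (huv : ∀ x, u x + v (q x) = x)
    (hu : ∀ x, q (u x) = 0) (hv : ∀ y, q (v y) = y)
    {η : P →ₗ[B] ⋀[B]^r M} {θ : ⋀[B]^r M →ₗ[B] P} (hηθ : ∀ x, η (θ x) = exteriorPower.map r u x)
    {x : ModTor B (⋀[B]^p M)}
    (hx : ∀ r' s' (h' : r' + s' = p), r' < r → comultModTor q h' x = 0) :
    comultModTor q h x ∈ LinearMap.range (tensorModTor (N := ⋀[B]^s Q) η) := by
  obtain rfl : s = p - r := by omega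
  obtain ⟨x, rfl⟩ := Submodule.Quotient.mk_surjective _ x
  refine ⟨(Submodule.torsion B (⋀[B]^(p - r) Q)).mkQ.lTensor _ (θ.rTensor _ (comult h q x)), ?_⟩
  have hlin : ∀ z : ⋀[B]^r M ⊗[B] ⋀[B]^(p - r) Q,
      η.rTensor _ ((Submodule.torsion B (⋀[B]^(p - r) Q)).mkQ.lTensor _ (θ.rTensor _ z)) =
        (Submodule.torsion B (⋀[B]^(p - r) Q)).mkQ.lTensor _
          ((exteriorPower.map r u).rTensor _ z) := fun z => by
    induction z with
    | zero => simp
    | add x y hx hy => simp only [map_add, hx, hy]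
    | tmul x y => simp [hηθ]
  rw [tensorModTor, LinearMap.comp_apply, hlin, ← comult_wedge_map h hu hv, Submodule.mkQ_apply,
    comultModTor, modTorMap_mk]
  -- the sum of the components of `x` of degree at most `r` differs from `x` by terms
  -- that comultiplication kills
  set π : Fin (p + 1) → ⋀[B]^p M := fun r' =>
    wedge (Nat.add_sub_cancel' (Nat.le_of_lt_succ r'.2))
      (TensorProduct.map (exteriorPower.map r' u) (exteriorPower.map (p - r') v)
        (comult (Nat.add_sub_cancel' (Nat.le_of_lt_succ r'.2)) q x)) with hπ
  have hsum : ∑ r', π r' = x := sum_wedge_map_comult huv x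
  have hr : r < p + 1 := by omega
  refine mk_map_eq_of_add_sum_eq (M₁ := ⋀[B]^r M ⊗[B] ModTor B (⋀[B]^(p - r) Q))
    ((Submodule.torsion B (⋀[B]^(p - r) Q)).mkQ.lTensor (⋀[B]^r M) ∘ₗ comult h q)
    (Finset.univ.erase ⟨r, hr⟩) π ((Finset.add_sum_erase _ _ (Finset.mem_univ _)).trans hsum)
    fun r' hr' => ?_
  rcases lt_or_ge r'.1 r with hlt | hge
  · exact map_mem_torsion (M₁ := ⋀[B]^r M ⊗[B] ModTor B (⋀[B]^(p - r) Q))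
      ((Submodule.torsion B (⋀[B]^(p - r) Q)).mkQ.lTensor _ ∘ₗ comult h q)
      (wedge_map_comult_mem_torsion _ (hx _ _ _ hlt))
  · have hlt : r < r'.1 := lt_of_le_of_ne hge fun hrr =>
      (Finset.mem_erase.1 hr').1 (Fin.ext hrr.symm)
    rw [LinearMap.comp_apply, hπ]
    simp only
    rw [comult_wedge_map_eq_zero _ h hlt hu, map_zero]
    exact zero_mem _

/-- The image of `t` under multiplication lies in degree `r` with respect to `M = im u ⊕ im v`, so
comultiplication of degree `r` recovers `t`, and those of smaller degree kill it. -/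
lemma exists_comultModTor_eq {r s : ℕ} (h : r + s = p) (hu : ∀ x, q (u x) = 0)
    (hv : ∀ y, q (v y) = y) {η : P →ₗ[B] ⋀[B]^r M}
    (hη : ∀ x, exteriorPower.map r u (η x) = η x) (t : P ⊗[B] ModTor B (⋀[B]^s Q)) :
    ∃ x : ModTor B (⋀[B]^p M),
      (∀ r' s' (h' : r' + s' = p), r' < r → comultModTor q h' x = 0) ∧
      comultModTor q h x = tensorModTor η t := by
  obtain ⟨t, rfl⟩ := LinearMap.lTensor_surjective P
    (Submodule.mkQ_surjective (Submodule.torsion B (⋀[B]^s Q))) t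
  refine ⟨Submodule.Quotient.mk (wedge h (TensorProduct.map (exteriorPower.map r u)
    (exteriorPower.map s v) (η.rTensor _ t))), fun r' s' h' hr => ?_, ?_⟩
  · rw [comultModTor, modTorMap_mk, LinearMap.comp_apply, comult_wedge_map_eq_zero h h' hr hu,
      map_zero, Submodule.Quotient.mk_zero]
  · rw [comultModTor, modTorMap_mk, LinearMap.comp_apply, comult_wedge_map h hu hv, tensorModTor,
      LinearMap.comp_apply, Submodule.mkQ_apply]
    congr 1
    induction t with
    | zero => simp
    | add x y hx hy => simp only [map_add, hx, hy]
    | tmul x y => simp [hη]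

end Torsion

end ExteriorShuffle

namespace TorsionFreeDiff

/-! ### Stalks of presheaves of modules -/

section Stalks

open Opposite ExteriorShuffle TensorProduct

/-- Presheaves of `𝒪_X`-modules, over the presheaf of commutative rings `𝒪_X`. -/
abbrev PMod (X : Scheme.{u}) := PresheafOfModules.{u} (X.presheaf ⋙ forget₂ CommRingCat RingCat)

/-- The restriction maps of a presheaf of modules, as additive maps. -/
def res {X : Scheme.{u}} (P : PMod X) {V U : X.Opens} (i : V ⟶ U) :
    P.obj (op U) →+ P.obj (op V) :=
  AddMonoidHom.mk' (fun s => P.map i.op s) fun s t => (P.map i.op).hom.map_add s t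

lemma res_smul {X : Scheme.{u}} (P : PMod X) {V U : X.Opens} (i : V ⟶ U) (a : Γ(X, U))
    (s : P.obj (op U)) : res P i (a • s) = (X.presheaf.map i.op a : Γ(X, V)) • res P i s :=
  P.map_smul i.op a s

lemma res_res {X : Scheme.{u}} (P : PMod X) {U V W : X.Opens} (i : W ⟶ V) (j : V ⟶ U)
    (s : P.obj (op U)) : res P i (res P j s) = res P (i ≫ j) s :=
  (P.map_comp_apply j.op i.op s).symm

/-- The component of a morphism of presheaves of modules on an open set. -/
def app {X : Scheme.{u}} {P P' : PMod X} (φ : P ⟶ P') (U : X.Opens) :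
    P.obj (op U) →ₗ[Γ(X, U)] P'.obj (op U) := (φ.app (op U)).hom

lemma app_res {X : Scheme.{u}} {P P' : PMod X} (φ : P ⟶ P') {V U : X.Opens} (i : V ⟶ U)
    (s : P.obj (op U)) : app φ V (res P i s) = res P' i (app φ U s) :=
  PresheafOfModules.naturality_apply φ i.op s

lemma app_comp {X : Scheme.{u}} {P P' P'' : PMod X} (φ : P ⟶ P') (ψ : P' ⟶ P'') (U : X.Opens)
    (s : P.obj (op U)) : app (φ ≫ ψ) U s = app ψ U (app φ U s) := rfl

/-- The data exhibiting the `𝒪_{X,x}`-module `M` as the stalk at `x` of the presheaf of modules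
`P`: compatible semilinear maps `P(U) → M` that are jointly surjective, such that a section with
zero image in `M` is zero near `x`. -/
structure StalkData {X : Scheme.{u}} (P : PMod X) (x : X) (M : Type u)
    [AddCommGroup M] [Module (X.presheaf.stalk x) M] where
  /-- the germ of a section -/
  germ (U : X.Opens) (hx : x ∈ U) : P.obj (op U) →+ M
  germ_smul (U : X.Opens) (hx : x ∈ U) (a : Γ(X, U)) (s : P.obj (op U)) :
    germ U hx (a • s) = X.presheaf.germ U x hx a • germ U hx s
  germ_map {V U : X.Opens} (i : V ⟶ U) (hx : x ∈ V) (s : P.obj (op U)) :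
    germ V hx (res P i s) = germ U (i.le hx) s
  exists_germ (m : M) : ∃ U hx s, germ U hx s = m
  exists_map_eq_zero (U : X.Opens) (hx : x ∈ U) (s : P.obj (op U)) :
    germ U hx s = 0 → ∃ (V : X.Opens) (i : V ⟶ U), x ∈ V ∧ res P i s = 0

variable {X : Scheme.{u}}

/-- The stalk of the underlying presheaf of abelian groups. -/
abbrev presheafStalk (P : PMod X) (x : X) : Type u :=
  TopCat.Presheaf.stalk (C := Ab.{u}) (X := X.toTopCat) P.presheaf x

/-- The stalk of the underlying presheaf of abelian groups, as a stalk of the presheaf of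
modules. -/
def canonicalStalk (P : PMod X) (x : X) : StalkData P x (presheafStalk P x) where
  germ U hx := (TopCat.Presheaf.germ (X := X.toTopCat) P.presheaf U x hx).hom
  germ_smul U hx a s := PresheafOfModules.germ_smul (R := X.presheaf) P x U hx a s
  germ_map {V U} i hx s := TopCat.Presheaf.germ_res_apply (X := X.toTopCat) P.presheaf i x hx s
  exists_germ m := by
    obtain ⟨U, hx, s, h⟩ := TopCat.Presheaf.exists_germ_eq (X := X.toTopCat) P.presheaf m
    exact ⟨U, hx, s, h⟩
  exists_map_eq_zero U hx s h := by
    obtain ⟨V, hV, i, j, h⟩ := TopCat.Presheaf.germ_eq (X := X.toTopCat) P.presheaf x hx hx s 0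
      (by rw [map_zero]; exact h)
    exact ⟨V, i, hV, h.trans (map_zero _)⟩

namespace StalkData

variable {P P' : PMod X} {x : X} {M M' : Type u} [AddCommGroup M] [Module (X.presheaf.stalk x) M]
  [AddCommGroup M'] [Module (X.presheaf.stalk x) M'] (d : StalkData P x M) (d' : StalkData P' x M')

/-- The germ map as a semilinear map. -/
def germₛₗ (U : X.Opens) (hx : x ∈ U) :
    P.obj (op U) →ₛₗ[(X.presheaf.germ U x hx).hom] M :=
  { d.germ U hx with map_smul' := d.germ_smul U hx }

lemma exists_map_eq {U V : X.Opens} (hU : x ∈ U) (hV : x ∈ V) {s : P.obj (op U)}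
    {t : P.obj (op V)} (h : d.germ U hU s = d.germ V hV t) :
    ∃ (W : X.Opens) (i : W ⟶ U) (j : W ⟶ V), x ∈ W ∧ res P i s = res P j t := by
  have hx : x ∈ U ⊓ V := ⟨hU, hV⟩
  obtain ⟨W, i, hW, h0⟩ := d.exists_map_eq_zero (U ⊓ V) hx
    (res P (homOfLE (inf_le_left : U ⊓ V ≤ U)) s - res P (homOfLE (inf_le_right : U ⊓ V ≤ V)) t)
    (by rw [map_sub, d.germ_map, d.germ_map, h, sub_self])
  rw [map_sub, sub_eq_zero, res_res, res_res] at h0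
  exact ⟨W, _, _, hW, h0⟩

lemma exists_map_eq_family {ι : Type*} [Finite ι] {U V : X.Opens} (hU : x ∈ U) (hV : x ∈ V)
    {s : ι → P.obj (op U)} {t : ι → P.obj (op V)}
    (h : ∀ k, d.germ U hU (s k) = d.germ V hV (t k)) :
    ∃ (W : X.Opens) (i : W ⟶ U) (j : W ⟶ V), x ∈ W ∧
      ∀ k, res P i (s k) = res P j (t k) := by
  have := Fintype.ofFinite ι
  choose W i j hW hst using fun k => d.exists_map_eq hU hV (h k)
  refine ⟨U ⊓ V ⊓ Finset.univ.inf W, homOfLE (inf_le_left.trans inf_le_left),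
    homOfLE (inf_le_left.trans inf_le_right), ⟨⟨hU, hV⟩, ?_⟩, fun k => ?_⟩
  · rw [Opens.coe_finset_inf]
    simpa using hW
  · have l : U ⊓ V ⊓ Finset.univ.inf W ≤ W k :=
      inf_le_right.trans (Finset.inf_le (Finset.mem_univ k))
    have := congrArg (res P (homOfLE l)) (hst k)
    rw [res_res, res_res] at this
    exact this

lemma exists_germ_family {ι : Type*} [Finite ι] (m : ι → M) :
    ∃ (U : X.Opens) (hx : x ∈ U) (s : ι → P.obj (op U)), ∀ k, d.germ U hx (s k) = m k := by
  have := Fintype.ofFinite ι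
  choose U hx s hs using fun k => d.exists_germ (m k)
  refine ⟨Finset.univ.inf U, ?_, fun k => res P
    (homOfLE (Finset.inf_le (Finset.mem_univ k))) (s k), fun k => ?_⟩
  · rw [← SetLike.mem_coe, Opens.coe_finset_inf]
    simpa using hx
  · rw [d.germ_map, hs]

omit [Module (X.presheaf.stalk x) M] in
lemma exists_germ_add {germ : ∀ (U : X.Opens) (_ : x ∈ U), P.obj (op U) →+ M}
    (germ_map : ∀ {V U : X.Opens} (i : V ⟶ U) (hx : x ∈ V) (s : P.obj (op U)),
      germ V hx (res P i s) = germ U (i.le hx) s) {m n : M}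
    (hm : ∃ U hx s, germ U hx s = m) (hn : ∃ U hx s, germ U hx s = n) :
    ∃ U hx s, germ U hx s = m + n := by
  obtain ⟨U, hU, s, rfl⟩ := hm
  obtain ⟨V, hV, t, rfl⟩ := hn
  have hUV : x ∈ U ⊓ V := ⟨hU, hV⟩
  exact ⟨U ⊓ V, hUV, res P (homOfLE inf_le_left) s + res P (homOfLE inf_le_right) t, by
    rw [map_add, germ_map, germ_map]⟩

/-- Reduction of the injectivity condition to the existence of a comparison map to the stalk of
the underlying presheaf of abelian groups. -/
def ofLeftInverse (germ : ∀ (U : X.Opens) (_ : x ∈ U), P.obj (op U) →+ M)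
    (germ_smul : ∀ (U : X.Opens) (hx : x ∈ U) (a : Γ(X, U)) (s : P.obj (op U)),
      germ U hx (a • s) = X.presheaf.germ U x hx a • germ U hx s)
    (germ_map : ∀ {V U : X.Opens} (i : V ⟶ U) (hx : x ∈ V) (s : P.obj (op U)),
      germ V hx (res P i s) = germ U (i.le hx) s)
    (exists_germ : ∀ m : M, ∃ U hx s, germ U hx s = m)
    (l : M →+ presheafStalk P x)
    (hl : ∀ U hx s, l (germ U hx s) = (canonicalStalk P x).germ U hx s) : StalkData P x M where
  germ := germ
  germ_smul := germ_smul
  germ_map := germ_map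
  exists_germ := exists_germ
  exists_map_eq_zero U hx s h := (canonicalStalk P x).exists_map_eq_zero U hx s
    (by rw [← hl, h, map_zero])

/-- The germ of the image of a section only depends on the germ of the section. -/
lemma hom_aux (φ : P ⟶ P') : ∃ f : M → M', ∀ U hx s,
    f (d.germ U hx s) = d'.germ U hx (app φ U s) := by
  choose U hx s hs using d.exists_germ
  refine ⟨fun m => d'.germ _ (hx m) (app φ _ (s m)), fun V hV t => ?_⟩
  obtain ⟨W, i, j, hW, h⟩ := d.exists_map_eq _ hV (hs (d.germ V hV t))
  change d'.germ _ _ (app φ _ (s _)) = _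
  rw [← d'.germ_map i hW, ← d'.germ_map j hW, ← app_res,
    ← app_res, h]

/-- The map on stalks induced by a morphism of presheaves of modules. -/
def hom (φ : P ⟶ P') : M →ₗ[X.presheaf.stalk x] M' where
  toFun := (hom_aux d d' φ).choose
  map_add' m n := by
    have h := (hom_aux d d' φ).choose_spec
    obtain ⟨U, hx, s, hs⟩ := d.exists_germ_family ![m, n]
    have h0 : d.germ U hx (s 0) = m := hs 0
    have h1 : d.germ U hx (s 1) = n := hs 1
    rw [← h0, ← h1, ← map_add, h, h, h, map_add, map_add]
  map_smul' a m := by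
    have h := (hom_aux d d' φ).choose_spec
    obtain ⟨U, hx, s, rfl⟩ := d.exists_germ m
    obtain ⟨V, hV, a, rfl⟩ := X.presheaf.exists_germ_eq a
    have hW : x ∈ U ⊓ V := ⟨hx, hV⟩
    have e : X.presheaf.germ V x hV a • d.germ U hx s = d.germ (U ⊓ V) hW
        (X.presheaf.map (homOfLE (inf_le_right : U ⊓ V ≤ V)).op a •
          res P (homOfLE (inf_le_left : U ⊓ V ≤ U)) s) := by
      rw [d.germ_smul, d.germ_map, X.presheaf.germ_res_apply]
    have e' : d.germ U hx s = d.germ (U ⊓ V) hW (res P (homOfLE (inf_le_left : U ⊓ V ≤ U)) s) := by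
      rw [d.germ_map]
    rw [e, h, e', h]
    rw [map_smul, d'.germ_smul, X.presheaf.germ_res_apply]
    rfl

@[simp]
lemma hom_germ (φ : P ⟶ P') (U : X.Opens) (hx : x ∈ U) (s : P.obj (op U)) :
    hom d d' φ (d.germ U hx s) = d'.germ U hx (app φ U s) :=
  (hom_aux d d' φ).choose_spec U hx s

/-- Stalks can be replaced by isomorphic modules. -/
def ofEquiv (e : M ≃ₗ[X.presheaf.stalk x] M') : StalkData P x M' where
  germ U hx := e.toLinearMap.toAddMonoidHom.comp (d.germ U hx)
  germ_smul U hx a s := by simp [d.germ_smul]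
  germ_map i hx s := congrArg e (d.germ_map i hx s)
  exists_germ m := by
    obtain ⟨U, hx, s, h⟩ := d.exists_germ (e.symm m)
    exact ⟨U, hx, s, by simp [h]⟩
  exists_map_eq_zero U hx s h := d.exists_map_eq_zero U hx s (by simpa using h)

@[simp]
lemma ofEquiv_germ (e : M ≃ₗ[X.presheaf.stalk x] M') (U : X.Opens) (hx : x ∈ U)
    (s : P.obj (op U)) : (d.ofEquiv e).germ U hx s = e (d.germ U hx s) := rfl

end StalkData

/-! ### Stalks of the associated sheaf -/

/-- A sheaf of modules, as a presheaf of modules over the presheaf of commutative rings `𝒪_X`. -/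
def toP (M : X.Modules) : PMod X := M.val

/-- A morphism of sheaves of modules, as a morphism of presheaves. -/
def toPHom {M N : X.Modules} (f : M ⟶ N) : toP M ⟶ toP N := f.val

/-- The morphism from a presheaf of modules to the associated sheaf. -/
def toSheafify (P : PMod X) : P ⟶ toP (sheafify.obj P) :=
  (PresheafOfModules.sheafificationAdjunction (𝟙 X.ringCatSheaf.obj)).unit.app P

lemma exists_res_eq_zero_of_toSheafify (P : PMod X) {U : X.Opens} {s : P.obj (op U)}
    (h : app (toSheafify P) U s = 0) {x : X} (hx : x ∈ U) :
    ∃ (V : X.Opens) (i : V ⟶ U), x ∈ V ∧ res P i s = 0 := by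
  have := Presheaf.isLocallyInjective_toSheafify' (Opens.grothendieckTopology X) P.presheaf
  have h2 := Presheaf.equalizerSieve_mem (Opens.grothendieckTopology X)
    (CategoryTheory.toSheafify (Opens.grothendieckTopology X) P.presheaf) s 0
    (h.trans (map_zero _).symm)
  obtain ⟨V, i, h3, h4⟩ := h2 x hx
  exact ⟨V, i, h4, h3.trans (map_zero _)⟩

lemma exists_toSheafify_eq (P : PMod X) {U : X.Opens} (s : (toP (sheafify.obj P)).obj (op U))
    {x : X} (hx : x ∈ U) :
    ∃ (V : X.Opens) (i : V ⟶ U) (t : P.obj (op V)), x ∈ V ∧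
      app (toSheafify P) V t = res (toP (sheafify.obj P)) i s := by
  have := Presheaf.isLocallySurjective_toSheafify' (Opens.grothendieckTopology X) P.presheaf
  have h2 := Presheaf.imageSieve_mem (Opens.grothendieckTopology X)
    (CategoryTheory.toSheafify (Opens.grothendieckTopology X) P.presheaf) (U := op U) s
  obtain ⟨V, i, ⟨t, h3⟩, h4⟩ := h2 x hx
  exact ⟨V, i, t, h4, h3⟩

namespace StalkData

variable {P P' : PMod X} {x : X} {M M' : Type u} [AddCommGroup M] [Module (X.presheaf.stalk x) M]
  [AddCommGroup M'] [Module (X.presheaf.stalk x) M'] (d : StalkData P x M) (d' : StalkData P' x M')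

/-- The morphism to the associated sheaf is locally injective and locally surjective, hence an
isomorphism on stalks. -/
lemma hom_toSheafify_bijective (d₁ : StalkData (toP (sheafify.obj P)) x M') :
    Function.Bijective (hom d d₁ (toSheafify P)) := by
  constructor
  · rw [injective_iff_map_eq_zero]
    intro m hm
    obtain ⟨U, hx, s, rfl⟩ := d.exists_germ m
    rw [hom_germ] at hm
    obtain ⟨V, i, hV, h⟩ := d₁.exists_map_eq_zero U hx _ hm
    rw [← app_res] at h
    obtain ⟨W, j, hW, h⟩ := exists_res_eq_zero_of_toSheafify P h hV
    rw [← d.germ_map i hV, ← d.germ_map j hW, h, map_zero]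
  · intro m
    obtain ⟨U, hx, s, rfl⟩ := d₁.exists_germ m
    obtain ⟨V, i, t, hV, h⟩ := exists_toSheafify_eq P s hx
    exact ⟨d.germ V hV t, by rw [hom_germ, h]; exact d₁.germ_map i hV s⟩

/-- A presheaf and its associated sheaf have the same stalks. -/
def sheafification : StalkData (toP (sheafify.obj P)) x M :=
  (canonicalStalk (toP (sheafify.obj P)) x).ofEquiv
    (LinearEquiv.ofBijective _ (hom_toSheafify_bijective d (canonicalStalk _ x))).symm

@[simp]
lemma sheafification_germ_toSheafify (U : X.Opens) (hx : x ∈ U) (s : P.obj (op U)) :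
    d.sheafification.germ U hx (app (toSheafify P) U s) = d.germ U hx s := by
  rw [sheafification, ofEquiv_germ, LinearEquiv.symm_apply_eq, LinearEquiv.ofBijective_apply]
  exact (hom_germ d _ (toSheafify P) U hx s).symm

lemma sheafification_hom {φ : P ⟶ P'} (m : M) :
    hom d.sheafification d'.sheafification (toPHom (sheafify.map φ)) m = hom d d' φ m := by
  obtain ⟨U, hx, s, rfl⟩ := d.exists_germ m
  rw [hom_germ, ← d'.sheafification_germ_toSheafify, ← d.sheafification_germ_toSheafify, hom_germ]
  congr 1
  exact (DFunLike.congr_fun (congrArg (fun a => app a U)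
    ((PresheafOfModules.sheafificationAdjunction (𝟙 X.ringCatSheaf.obj)).unit.naturality φ)) s).symm

lemma hom_toSheafify (m : M) : hom d d.sheafification (toSheafify P) m = m := by
  obtain ⟨U, hx, s, rfl⟩ := d.exists_germ m
  rw [hom_germ, sheafification_germ_toSheafify]

lemma hom_comp {P'' : PMod X} {M'' : Type u} [AddCommGroup M''] [Module (X.presheaf.stalk x) M'']
    (d'' : StalkData P'' x M'') (φ : P ⟶ P') (ψ : P' ⟶ P'') (m : M) :
    hom d d'' (φ ≫ ψ) m = hom d' d'' ψ (hom d d' φ m) := by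
  obtain ⟨U, hx, s, rfl⟩ := d.exists_germ m
  rw [hom_germ, hom_germ, hom_germ, app_comp]

end StalkData

/-! ### Stalks of tensor products and exterior powers -/

/-- The tensor product presheaf `U ↦ P(U) ⊗ P'(U)`. -/
abbrev tensorPresheaf (P P' : PMod X) : PMod X :=
  PresheafOfModules.Monoidal.tensorObj (R := X.presheaf) P P'

/-- The sections of the tensor product presheaf. -/
def tensorSections (P P' : PMod X) (U : X.Opens) :
    TensorProduct Γ(X, U) (P.obj (op U)) (P'.obj (op U)) ≃ₗ[Γ(X, U)]
      (tensorPresheaf P P').obj (op U) := LinearEquiv.refl _ _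

lemma res_tensorSections {P P' : PMod X} {U V : X.Opens} (i : V ⟶ U) (s : P.obj (op U))
    (t : P'.obj (op U)) :
    res (tensorPresheaf P P') i (tensorSections P P' U (s ⊗ₜ t)) =
      tensorSections P P' V (res P i s ⊗ₜ res P' i t) := rfl

/-- The sections of the exterior power presheaf. -/
def exteriorSections (P : PMod X) (p : ℕ) (U : X.Opens) :
    ⋀[Γ(X, U)]^p (P.obj (op U)) ≃ₗ[Γ(X, U)]
      (exteriorPower (R := X.presheaf) P p).obj (op U) := LinearEquiv.refl _ _

lemma res_exteriorSections {P : PMod X} {p : ℕ} {U V : X.Opens} (i : V ⟶ U)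
    (m : Fin p → P.obj (op U)) :
    res (exteriorPower (R := X.presheaf) P p) i
        (exteriorSections P p U (_root_.exteriorPower.ιMulti _ p m)) =
      exteriorSections P p V (_root_.exteriorPower.ιMulti _ p fun k => res P i (m k)) :=
  exteriorPowerMap_mk P p i.op m

namespace StalkData

open TensorProduct

variable {P P' : PMod X} {x : X} {M M' : Type u} [AddCommGroup M] [Module (X.presheaf.stalk x) M]
  [AddCommGroup M'] [Module (X.presheaf.stalk x) M'] (d : StalkData P x M) (d' : StalkData P' x M')

/-- The germ of `s ⊗ s'` only depends on the germs of `s` and `s'`. -/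
lemma tensor_aux (m : M) (m' : M') : ∃ z : presheafStalk (tensorPresheaf P P') x,
    ∀ U hx s s', d.germ U hx s = m → d'.germ U hx s' = m' →
      (canonicalStalk (tensorPresheaf P P') x).germ U hx (tensorSections P P' U (s ⊗ₜ s')) = z := by
  obtain ⟨U, hU, s, hs⟩ := d.exists_germ m
  obtain ⟨V, hV, t, ht⟩ := d'.exists_germ m'
  have hUV : x ∈ U ⊓ V := ⟨hU, hV⟩
  refine ⟨(canonicalStalk (tensorPresheaf P P') x).germ (U ⊓ V) hUV
    (tensorSections P P' _ (res P (homOfLE inf_le_left) s ⊗ₜ res P' (homOfLE inf_le_right) t)),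
    fun W hW s' t' hs' ht' => ?_⟩
  obtain ⟨W₁, i₁, j₁, hW₁, e₁⟩ := d.exists_map_eq hUV hW
    (s := res P (homOfLE inf_le_left) s) (t := s') (by rw [d.germ_map, hs, hs'])
  obtain ⟨W₂, i₂, j₂, hW₂, e₂⟩ := d'.exists_map_eq hUV hW
    (s := res P' (homOfLE inf_le_right) t) (t := t') (by rw [d'.germ_map, ht, ht'])
  have hx : x ∈ W₁ ⊓ W₂ := ⟨hW₁, hW₂⟩
  let k₁ : W₁ ⊓ W₂ ⟶ W₁ := homOfLE inf_le_left
  let k₂ : W₁ ⊓ W₂ ⟶ W₂ := homOfLE inf_le_right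
  have e₁' : res P (k₁ ≫ i₁) (res P (homOfLE inf_le_left) s) = res P (k₁ ≫ j₁) s' := by
    rw [← res_res, e₁, res_res]
  have e₂' : res P' (k₂ ≫ i₂) (res P' (homOfLE inf_le_right) t) = res P' (k₂ ≫ j₂) t' := by
    rw [← res_res, e₂, res_res]
  rw [← (canonicalStalk (tensorPresheaf P P') x).germ_map (k₁ ≫ j₁) hx,
    ← (canonicalStalk (tensorPresheaf P P') x).germ_map (k₁ ≫ i₁) hx, res_tensorSections,
    res_tensorSections]
  exact congrArg₂ (fun a b => (canonicalStalk (tensorPresheaf P P') x).germ _ hx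
    (tensorSections P P' _ (a ⊗ₜ b))) e₁'.symm e₂'.symm

lemma exists_germ_family₂ {ι ι' : Type*} [Finite ι] [Finite ι'] (m : ι → M) (m' : ι' → M') :
    ∃ (U : X.Opens) (hx : x ∈ U) (s : ι → P.obj (op U)) (s' : ι' → P'.obj (op U)),
      (∀ k, d.germ U hx (s k) = m k) ∧ ∀ k, d'.germ U hx (s' k) = m' k := by
  obtain ⟨U, hU, s, hs⟩ := d.exists_germ_family m
  obtain ⟨V, hV, t, ht⟩ := d'.exists_germ_family m'
  exact ⟨U ⊓ V, ⟨hU, hV⟩, fun k => res P (homOfLE inf_le_left) (s k),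
    fun k => res P' (homOfLE inf_le_right) (t k), fun k => (d.germ_map _ _ _).trans (hs k),
    fun k => (d'.germ_map _ _ _).trans (ht k)⟩

lemma exists_germ_smul (a : X.presheaf.stalk x) {ι ι' : Type*} [Finite ι] [Finite ι'] (m : ι → M)
    (m' : ι' → M') :
    ∃ (U : X.Opens) (hx : x ∈ U) (a' : Γ(X, U)) (s : ι → P.obj (op U)) (s' : ι' → P'.obj (op U)),
      X.presheaf.germ U x hx a' = a ∧ (∀ k, d.germ U hx (s k) = m k) ∧
        ∀ k, d'.germ U hx (s' k) = m' k := by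
  obtain ⟨U, hU, s, s', hs, hs'⟩ := d.exists_germ_family₂ d' m m'
  obtain ⟨V, hV, a', ha⟩ := X.presheaf.exists_germ_eq a
  exact ⟨U ⊓ V, ⟨hU, hV⟩, X.presheaf.map (homOfLE inf_le_right).op a',
    fun k => res P (homOfLE inf_le_left) (s k),
    fun k => res P' (homOfLE inf_le_left) (s' k),
    (X.presheaf.germ_res_apply (homOfLE inf_le_right) x ⟨hU, hV⟩ a').trans ha,
    fun k => (d.germ_map _ _ _).trans (hs k), fun k => (d'.germ_map _ _ _).trans (hs' k)⟩

/-- The comparison map from the tensor product of the stalks to the stalk of the tensor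
product. -/
def tensorToStalk : M →ₗ[X.presheaf.stalk x] M' →ₗ[X.presheaf.stalk x]
    presheafStalk (tensorPresheaf P P') x :=
  LinearMap.mk₂ _ (fun m m' => (tensor_aux d d' m m').choose)
    (fun m n m' => by
      obtain ⟨U, hx, s, s', hs, hs'⟩ := d.exists_germ_family₂ d' ![m, n] ![m']
      have h0 : d.germ U hx (s 0) = m := hs 0
      have h1 : d.germ U hx (s 1) = n := hs 1
      have h2 : d'.germ U hx (s' 0) = m' := hs' 0
      rw [← (tensor_aux d d' m m').choose_spec U hx _ _ h0 h2,
        ← (tensor_aux d d' n m').choose_spec U hx _ _ h1 h2,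
        ← (tensor_aux d d' (m + n) m').choose_spec U hx (s 0 + s 1) (s' 0)
          (by rw [map_add, h0, h1]) h2,
        TensorProduct.add_tmul, map_add, map_add])
    (fun c m m' => by
      obtain ⟨U, hx, a, s, s', ha, hs, hs'⟩ := d.exists_germ_smul d' c ![m] ![m']
      have h0 : d.germ U hx (s 0) = m := hs 0
      have h2 : d'.germ U hx (s' 0) = m' := hs' 0
      rw [← (tensor_aux d d' m m').choose_spec U hx _ _ h0 h2,
        ← (tensor_aux d d' (c • m) m').choose_spec U hx (a • s 0) (s' 0)
          (by rw [d.germ_smul, h0, ha]) h2, ← ha, ← germ_smul, ← map_smul,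
        TensorProduct.smul_tmul'])
    (fun m m' n' => by
      obtain ⟨U, hx, s, s', hs, hs'⟩ := d.exists_germ_family₂ d' ![m] ![m', n']
      have h0 : d.germ U hx (s 0) = m := hs 0
      have h1 : d'.germ U hx (s' 1) = n' := hs' 1
      have h2 : d'.germ U hx (s' 0) = m' := hs' 0
      rw [← (tensor_aux d d' m m').choose_spec U hx _ _ h0 h2,
        ← (tensor_aux d d' m n').choose_spec U hx _ _ h0 h1,
        ← (tensor_aux d d' m (m' + n')).choose_spec U hx (s 0) (s' 0 + s' 1) h0
          (by rw [map_add, h2, h1]), TensorProduct.tmul_add, map_add, map_add])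
    (fun c m m' => by
      obtain ⟨U, hx, a, s, s', ha, hs, hs'⟩ := d.exists_germ_smul d' c ![m] ![m']
      have h0 : d.germ U hx (s 0) = m := hs 0
      have h2 : d'.germ U hx (s' 0) = m' := hs' 0
      rw [← (tensor_aux d d' m m').choose_spec U hx _ _ h0 h2,
        ← (tensor_aux d d' m (c • m')).choose_spec U hx (s 0) (a • s' 0) h0
          (by rw [d'.germ_smul, h2, ha]), ← ha, ← germ_smul, ← map_smul,
        TensorProduct.tmul_smul])

lemma tensorToStalk_germ (U : X.Opens) (hx : x ∈ U) (s : P.obj (op U)) (s' : P'.obj (op U)) :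
    tensorToStalk d d' (d.germ U hx s) (d'.germ U hx s') =
      (canonicalStalk (tensorPresheaf P P') x).germ U hx (tensorSections P P' U (s ⊗ₜ s')) :=
  ((tensor_aux d d' _ _).choose_spec U hx s s' rfl rfl).symm

/-- The germ map of a tensor product. -/
def tensorGerm (U : X.Opens) (hx : x ∈ U) :
    (tensorPresheaf P P').obj (op U) →+ M ⊗[X.presheaf.stalk x] M' :=
  (TensorProduct.map (d.germₛₗ U hx) (d'.germₛₗ U hx)).toAddMonoidHom.comp
    (tensorSections P P' U).symm.toAddMonoidHom

lemma tensorGerm_tmul (U : X.Opens) (hx : x ∈ U) (s : P.obj (op U)) (s' : P'.obj (op U)) :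
    tensorGerm d d' U hx (tensorSections P P' U (s ⊗ₜ s')) =
      d.germ U hx s ⊗ₜ d'.germ U hx s' := rfl

lemma tensor_induction {U : X.Opens} {C : (tensorPresheaf P P').obj (op U) → Prop}
    (z : (tensorPresheaf P P').obj (op U)) (zero : C 0)
    (tmul : ∀ s t, C (tensorSections P P' U (s ⊗ₜ t))) (add : ∀ a b, C a → C b → C (a + b)) :
    C z := by
  obtain ⟨z, rfl⟩ := (tensorSections P P' U).surjective z
  induction z with
  | zero => rw [map_zero]; exact zero
  | tmul s t => exact tmul s t
  | add a b ha hb => rw [map_add]; exact add _ _ ha hb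

lemma tensorGerm_map {V U : X.Opens} (i : V ⟶ U) (hx : x ∈ V)
    (z : (tensorPresheaf P P').obj (op U)) :
    tensorGerm d d' V hx (res (tensorPresheaf P P') i z) = tensorGerm d d' U (i.le hx) z := by
  induction z using tensor_induction with
  | zero => simp only [map_zero]
  | tmul s t => rw [res_tensorSections, tensorGerm_tmul, tensorGerm_tmul, d.germ_map, d'.germ_map]
  | add a b ha hb => simp only [map_add, ha, hb]

/-- The stalk of a tensor product is the tensor product of the stalks. -/
def tensor : StalkData (tensorPresheaf P P') x (M ⊗[X.presheaf.stalk x] M') :=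
  ofLeftInverse (tensorGerm d d')
    (fun U hx a z => (TensorProduct.map (d.germₛₗ U hx) (d'.germₛₗ U hx)).map_smulₛₗ a
      ((tensorSections P P' U).symm z))
    (tensorGerm_map d d')
    (fun m => by
      induction m with
      | zero => exact ⟨⊤, trivial, 0, map_zero _⟩
      | tmul m m' =>
        obtain ⟨U, hx, s, s', hs, hs'⟩ := d.exists_germ_family₂ d' ![m] ![m']
        exact ⟨U, hx, tensorSections P P' U (s 0 ⊗ₜ s' 0), by
          rw [tensorGerm_tmul, hs, hs']; rfl⟩
      | add a b ha hb => exact exists_germ_add (tensorGerm_map d d') ha hb)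
    (TensorProduct.lift (tensorToStalk d d')).toAddMonoidHom
    (fun U hx z => by
      induction z using tensor_induction with
      | zero => simp only [map_zero]
      | tmul s t => exact tensorToStalk_germ d d' U hx s t
      | add a b ha hb => simp only [map_add, ha, hb])

/-- The germ of a wedge product only depends on the germs of its factors. -/
lemma exterior_aux (p : ℕ) (m : Fin p → M) :
    ∃ z : presheafStalk (exteriorPower (R := X.presheaf) P p) x,
    ∀ U hx s, (∀ k, d.germ U hx (s k) = m k) →
      (canonicalStalk (exteriorPower (R := X.presheaf) P p) x).germ U hx
        (exteriorSections P p U (_root_.exteriorPower.ιMulti _ p s)) = z := by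
  obtain ⟨U, hU, s, hs⟩ := d.exists_germ_family m
  refine ⟨(canonicalStalk (exteriorPower (R := X.presheaf) P p) x).germ U hU
    (exteriorSections P p U (_root_.exteriorPower.ιMulti _ p s)), fun V hV t ht => ?_⟩
  obtain ⟨W, i, j, hW, e⟩ := d.exists_map_eq_family hU hV (s := s) (t := t)
    (fun k => (hs k).trans (ht k).symm)
  rw [← (canonicalStalk (exteriorPower (R := X.presheaf) P p) x).germ_map i hW,
    ← (canonicalStalk (exteriorPower (R := X.presheaf) P p) x).germ_map j hW,
    res_exteriorSections, res_exteriorSections, funext e]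

/-- The germ of the wedge product of local sections with given germs. -/
def exteriorStalkFun (p : ℕ) (m : Fin p → M) :
    presheafStalk (exteriorPower (R := X.presheaf) P p) x := (exterior_aux d p m).choose

lemma germ_exteriorStalkFun (p : ℕ) {m : Fin p → M} {U : X.Opens} {hx : x ∈ U}
    {s : Fin p → P.obj (op U)} (h : ∀ k, d.germ U hx (s k) = m k) :
    (canonicalStalk (exteriorPower (R := X.presheaf) P p) x).germ U hx
      (exteriorSections P p U (_root_.exteriorPower.ιMulti _ p s)) = exteriorStalkFun d p m :=
  (exterior_aux d p m).choose_spec U hx s h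

lemma exteriorStalkFun_update_smul (p : ℕ) [DecidableEq (Fin p)] (m : Fin p → M) (i : Fin p)
    (c : X.presheaf.stalk x) (y : M) :
    exteriorStalkFun d p (Function.update m i (c • y)) =
      c • exteriorStalkFun d p (Function.update m i y) := by
  obtain ⟨U, hx, a, s, s', ha, hs, hs'⟩ := d.exists_germ_smul d c m ![y]
  have h0 : d.germ U hx (s' 0) = y := hs' 0
  have key : ∀ (a : P.obj (op U)) (b : M), d.germ U hx a = b →
      ∀ k, d.germ U hx (Function.update s i a k) = Function.update m i b k := by
    rintro a b rfl k
    rw [Function.update_apply, Function.update_apply]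
    split_ifs
    · rfl
    · exact hs k
  have e0 := germ_exteriorStalkFun d p (key _ _ h0)
  have e2 := germ_exteriorStalkFun d p (key (a • s' 0) (c • y) (by rw [d.germ_smul, ha, h0]))
  refine e2.symm.trans ?_
  have e3 := (canonicalStalk (exteriorPower (R := X.presheaf) P p) x).germ_smul U hx a
    (exteriorSections P p U (_root_.exteriorPower.ιMulti _ p (Function.update s i (s' 0))))
  rw [e0, ha] at e3
  rw [AlternatingMap.map_update_smul, map_smul]
  exact e3

/-- The comparison map from the exterior power of the stalk to the stalk of the exterior power. -/
def exteriorToStalk (p : ℕ) :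
    M [⋀^Fin p]→ₗ[X.presheaf.stalk x] presheafStalk (exteriorPower (R := X.presheaf) P p) x where
  toFun := exteriorStalkFun d p
  map_update_add' := by
    intro inst m i y z
    obtain ⟨U, hx, s, s', hs, hs'⟩ := d.exists_germ_family₂ d m ![y, z]
    have h0 : d.germ U hx (s' 0) = y := hs' 0
    have h1 : d.germ U hx (s' 1) = z := hs' 1
    have key : ∀ (a : P.obj (op U)) (b : M), d.germ U hx a = b →
        ∀ k, d.germ U hx (Function.update s i a k) = Function.update m i b k := by
      rintro a b rfl k
      rw [Function.update_apply, Function.update_apply]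
      split_ifs
      · rfl
      · exact hs k
    have e0 := germ_exteriorStalkFun d p (key _ _ h0)
    have e1 := germ_exteriorStalkFun d p (key _ _ h1)
    have e2 := germ_exteriorStalkFun d p (key (s' 0 + s' 1) (y + z) (by rw [map_add, h0, h1]))
    rw [← e0, ← e1, ← e2, AlternatingMap.map_update_add, map_add, map_add]
  map_update_smul' m i c y := exteriorStalkFun_update_smul d p m i c y
  map_eq_zero_of_eq' := by
    intro m i j h hij
    obtain ⟨U, hx, s, s', hs, hs'⟩ := d.exists_germ_family₂ d m ![m i]
    have h0 : d.germ U hx (s' 0) = m i := hs' 0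
    have hk : ∀ k, d.germ U hx (Function.update (Function.update s i (s' 0)) j (s' 0) k) = m k := by
      intro k
      rw [Function.update_apply, Function.update_apply]
      split_ifs with h1 h2
      · rw [h0, h, h1]
      · rw [h0, h2]
      · exact hs k
    rw [← germ_exteriorStalkFun d p hk]
    rw [AlternatingMap.map_eq_zero_of_eq _ _ _ hij, map_zero, map_zero]
    rw [Function.update_of_ne hij, Function.update_self, Function.update_self]

/-- The germ map of an exterior power. -/
def exteriorGerm (p : ℕ) (U : X.Opens) (hx : x ∈ U) :
    (exteriorPower (R := X.presheaf) P p).obj (op U) →+ ⋀[X.presheaf.stalk x]^p M :=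
  (exteriorMapₛₗ (d.germₛₗ U hx) p).toAddMonoidHom.comp
    (exteriorSections P p U).symm.toAddMonoidHom

lemma exteriorGerm_ιMulti (p : ℕ) (U : X.Opens) (hx : x ∈ U) (s : Fin p → P.obj (op U)) :
    exteriorGerm d p U hx (exteriorSections P p U (_root_.exteriorPower.ιMulti _ p s)) =
      _root_.exteriorPower.ιMulti _ p fun k => d.germ U hx (s k) :=
  exteriorMapₛₗ_ιMulti _ _ _

lemma exterior_induction {p : ℕ} {U : X.Opens}
    {C : (exteriorPower (R := X.presheaf) P p).obj (op U) → Prop}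
    (z : (exteriorPower (R := X.presheaf) P p).obj (op U)) (zero : C 0)
    (smul : ∀ (a : Γ(X, U)) s, C (exteriorSections P p U (a • _root_.exteriorPower.ιMulti _ p s)))
    (add : ∀ a b, C a → C b → C (a + b)) : C z := by
  obtain ⟨z, rfl⟩ := (exteriorSections P p U).surjective z
  have hz : z ∈ Submodule.span Γ(X, U) (Set.range (_root_.exteriorPower.ιMulti Γ(X, U) p)) := by
    rw [_root_.exteriorPower.ιMulti_span]; trivial
  induction hz using Submodule.closure_induction with
  | zero => rw [map_zero]; exact zero
  | smul_mem a m hm => obtain ⟨s, rfl⟩ := hm; exact smul a s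
  | add a b _ _ ha hb => rw [map_add]; exact add _ _ ha hb

lemma exteriorGerm_smul (p : ℕ) (U : X.Opens) (hx : x ∈ U) (a : Γ(X, U))
    (z : (exteriorPower (R := X.presheaf) P p).obj (op U)) :
    exteriorGerm d p U hx (a • z) = X.presheaf.germ U x hx a • exteriorGerm d p U hx z :=
  (exteriorMapₛₗ (d.germₛₗ U hx) p).map_smulₛₗ a ((exteriorSections P p U).symm z)

lemma exteriorGerm_map {p : ℕ} {V U : X.Opens} (i : V ⟶ U) (hx : x ∈ V)
    (z : (exteriorPower (R := X.presheaf) P p).obj (op U)) :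
    exteriorGerm d p V hx (res (exteriorPower (R := X.presheaf) P p) i z) =
      exteriorGerm d p U (i.le hx) z := by
  induction z using exterior_induction with
  | zero => simp only [map_zero]
  | smul a s =>
    rw [map_smul, res_smul, res_exteriorSections, exteriorGerm_smul, exteriorGerm_smul,
      exteriorGerm_ιMulti, exteriorGerm_ιMulti, X.presheaf.germ_res_apply]
    simp only [d.germ_map]
  | add a b ha hb => simp only [map_add, ha, hb]

/-- The stalk of an exterior power is the exterior power of the stalk. -/
def exterior (p : ℕ) : StalkData (exteriorPower (R := X.presheaf) P p) x
    (⋀[X.presheaf.stalk x]^p M) :=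
  ofLeftInverse (exteriorGerm d p) (exteriorGerm_smul d p) (exteriorGerm_map d)
    (fun m => by
      have hm : m ∈ Submodule.span (X.presheaf.stalk x)
          (Set.range (_root_.exteriorPower.ιMulti (X.presheaf.stalk x) p (M := M))) := by
        rw [_root_.exteriorPower.ιMulti_span]; trivial
      induction hm using Submodule.closure_induction with
      | zero => exact ⟨⊤, trivial, 0, map_zero _⟩
      | smul_mem a m hm =>
        obtain ⟨s, rfl⟩ := hm
        obtain ⟨U, hx, a', s, s', ha, hs, hs'⟩ := d.exists_germ_smul d a s (![] : Fin 0 → M)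
        refine ⟨U, hx, a' • exteriorSections P p U (_root_.exteriorPower.ιMulti _ p s), ?_⟩
        rw [exteriorGerm_smul, exteriorGerm_ιMulti, ha, funext hs]
      | add a b _ _ ha hb => exact exists_germ_add (exteriorGerm_map d) ha hb)
    (_root_.exteriorPower.alternatingMapLinearEquiv (exteriorToStalk d p)).toAddMonoidHom
    (fun U hx z => by
      induction z using exterior_induction with
      | zero => simp only [map_zero]
      | smul a s =>
        rw [map_smul, exteriorGerm_smul, exteriorGerm_ιMulti, germ_smul,
          germ_exteriorStalkFun d p (fun _ => rfl)]
        refine (map_smul (_root_.exteriorPower.alternatingMapLinearEquiv (exteriorToStalk d p))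
          _ _).trans ?_
        rw [_root_.exteriorPower.alternatingMapLinearEquiv_apply_ιMulti]
        rfl
      | add a b ha hb => simp only [map_add, ha, hb])

end StalkData
end Stalks
end TorsionFreeDiff

namespace TorsionFreeDiff
section Stalks
open Opposite ExteriorShuffle TensorProduct
variable {X : Scheme.{u}}
namespace StalkData

variable {P P' Q Q' : PMod X} {x : X}
  {M M' N N' : Type u} [AddCommGroup M] [Module (X.presheaf.stalk x) M]
  [AddCommGroup M'] [Module (X.presheaf.stalk x) M']
  [AddCommGroup N] [Module (X.presheaf.stalk x) N]
  [AddCommGroup N'] [Module (X.presheaf.stalk x) N']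
  (d : StalkData P x M) (d' : StalkData P' x M') (e : StalkData Q x N) (e' : StalkData Q' x N')

lemma tensor_germ_tmul (U : X.Opens) (hx : x ∈ U) (s : P.obj (op U)) (s' : P'.obj (op U)) :
    (d.tensor d').germ U hx (tensorSections P P' U (s ⊗ₜ s')) =
      d.germ U hx s ⊗ₜ d'.germ U hx s' := rfl

lemma exterior_germ_ιMulti (p : ℕ) (U : X.Opens) (hx : x ∈ U) (s : Fin p → P.obj (op U)) :
    (d.exterior p).germ U hx (exteriorSections P p U (_root_.exteriorPower.ιMulti _ p s)) =
      _root_.exteriorPower.ιMulti _ p fun k => d.germ U hx (s k) :=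
  exteriorMapₛₗ_ιMulti _ _ _

/-- The tensor product of two morphisms of presheaves of modules. -/
abbrev tensorPresheafMap (φ : P ⟶ Q) (ψ : P' ⟶ Q') : tensorPresheaf P P' ⟶ tensorPresheaf Q Q' :=
  PresheafOfModules.Monoidal.tensorHom (R := X.presheaf) φ ψ

lemma app_tensorPresheafMap (φ : P ⟶ Q) (ψ : P' ⟶ Q') (U : X.Opens) (s : P.obj (op U))
    (s' : P'.obj (op U)) : app (tensorPresheafMap φ ψ) U (tensorSections P P' U (s ⊗ₜ s')) =
      tensorSections Q Q' U (app φ U s ⊗ₜ app ψ U s') := rfl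

lemma hom_tensor (φ : P ⟶ Q) (ψ : P' ⟶ Q') :
    hom (d.tensor d') (e.tensor e') (tensorPresheafMap φ ψ) =
      TensorProduct.map (hom d e φ) (hom d' e' ψ) := by
  refine TensorProduct.ext' fun m m' => ?_
  obtain ⟨U, hx, s, s', hs, hs'⟩ := d.exists_germ_family₂ d' ![m] ![m']
  obtain rfl : d.germ U hx (s 0) = m := hs 0
  obtain rfl : d'.germ U hx (s' 0) = m' := hs' 0
  rw [TensorProduct.map_tmul, hom_germ, hom_germ, ← tensor_germ_tmul, ← tensor_germ_tmul, hom_germ,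
    app_tensorPresheafMap]

/-- The stalk of a quotient by a subpresheaf is the quotient of the stalk. -/
lemma exists_hom_cokernel_π (N₀ : PresheafOfModules.Submodule P)
    (K : Submodule (X.presheaf.stalk x) M)
    (h₁ : ∀ U hx, ∀ s ∈ N₀.obj (op U), d.germ U hx s ∈ K)
    (h₂ : ∀ U hx (s : P.obj (op U)), d.germ U hx s ∈ K →
      ∃ (V : X.Opens) (i : V ⟶ U), x ∈ V ∧ res P i s ∈ N₀.obj (op V)) :
    Function.Surjective (hom d (canonicalStalk (Limits.cokernel N₀.ι) x)
        (Limits.cokernel.π N₀.ι)) ∧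
      LinearMap.ker (hom d (canonicalStalk (Limits.cokernel N₀.ι) x)
        (Limits.cokernel.π N₀.ι)) = K := by
  have ex (U : X.Opens) : Function.Exact (app N₀.ι U) (app (Limits.cokernel.π N₀.ι) U) := by
    have h := (ShortComplex.exact_cokernel N₀.ι).map (PresheafOfModules.evaluation _ (op U))
    exact (ShortComplex.ShortExact.moduleCat_exact_iff_function_exact _).mp h
  have hs (U : X.Opens) : Function.Surjective (app (Limits.cokernel.π N₀.ι) U) :=
    PresheafOfModules.surjective_of_epi (Limits.cokernel.π N₀.ι) (op U)
  constructor
  · intro m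
    obtain ⟨U, hx, s, rfl⟩ := (canonicalStalk (Limits.cokernel N₀.ι) x).exists_germ m
    obtain ⟨t, rfl⟩ := hs U s
    exact ⟨d.germ U hx t, hom_germ _ _ _ _ _ _⟩
  · ext m
    obtain ⟨U, hx, s, rfl⟩ := d.exists_germ m
    rw [LinearMap.mem_ker, hom_germ]
    constructor
    · intro h
      obtain ⟨V, i, hV, h⟩ := (canonicalStalk (Limits.cokernel N₀.ι) x).exists_map_eq_zero U hx _ h
      rw [← app_res] at h
      obtain ⟨t, ht⟩ := (ex V _).mp h
      rw [← d.germ_map i hV, ← ht]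
      exact h₁ V hV _ t.2
    · intro h
      obtain ⟨V, i, hV, h⟩ := h₂ U hx s h
      have h0 : app (Limits.cokernel.π N₀.ι) V (res P i s) = 0 := (ex V _).mpr ⟨⟨_, h⟩, rfl⟩
      rw [← (canonicalStalk (Limits.cokernel N₀.ι) x).germ_map i hV, ← app_res, h0, map_zero]

end StalkData

/-! ### The stalks of the torsion subsheaf -/

open nonZeroDivisors

/-- Non-zero-divisors restrict to non-zero-divisors, because restriction between affine open sets is
flat. -/
lemma map_mem_nonZeroDivisors_of_affine {V W : X.Opens} (hV : IsAffineOpen V) (hW : IsAffineOpen W)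
    (i : W ⟶ V) {a : Γ(X, V)} (ha : a ∈ Γ(X, V)⁰) : X.presheaf.map i.op a ∈ Γ(X, W)⁰ := by
  have h : (X.presheaf.map i.op).hom.Flat := by
    have := Scheme.Hom.flat_appLE (𝟙 X) hV hW i.le
    have e : (𝟙 X : X ⟶ X).appLE V W i.le = X.presheaf.map i.op := by
      simp only [Scheme.Hom.appLE, Scheme.Hom.id_app]
      exact Category.id_comp _
    rwa [e] at this
  algebraize [(X.presheaf.map i.op).hom]
  have := Module.Flat.isSMulRegular_of_nonZeroDivisors (M := Γ(X, W)) ha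
  rw [mem_nonZeroDivisors_iff_right]
  intro b hb
  refine this ?_
  change a • b = a • 0
  rw [smul_zero, Algebra.smul_def, mul_comm]
  exact hb

lemma germ_mem_nonZeroDivisors {V : X.Opens} (hV : IsAffineOpen V) {x : X} (hx : x ∈ V)
    {a : Γ(X, V)} (ha : a ∈ Γ(X, V)⁰) : X.presheaf.germ V x hx a ∈ (X.presheaf.stalk x)⁰ := by
  have := hV.isLocalization_stalk ⟨x, hx⟩
  let := X.presheaf.algebra_section_stalk (⟨x, hx⟩ : V)
  exact IsLocalization.map_nonZeroDivisors_le (hV.primeIdealOf ⟨x, hx⟩).asIdeal.primeCompl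
    (X.presheaf.stalk x) (Submonoid.mem_map_of_mem _ ha)

/-- Being a non-zero-divisor in the local ring spreads to a neighbourhood: the annihilator of `a` is
finitely generated, and generators of it with zero germ vanish on a common basic open set. -/
lemma exists_map_mem_nonZeroDivisors [IsLocallyNoetherian X] {V : X.Opens} (hV : IsAffineOpen V)
    {x : X} (hx : x ∈ V) {a : Γ(X, V)} (ha : X.presheaf.germ V x hx a ∈ (X.presheaf.stalk x)⁰) :
    ∃ (W : X.Opens) (i : W ⟶ V), x ∈ W ∧ IsAffineOpen W ∧ X.presheaf.map i.op a ∈ Γ(X, W)⁰ := by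
  have : IsNoetherianRing Γ(X, V) := IsLocallyNoetherian.component_noetherian ⟨V, hV⟩
  obtain ⟨T, hT⟩ := (isNoetherianRing_iff_ideal_fg Γ(X, V)).mp this
    (LinearMap.ker (LinearMap.mulLeft Γ(X, V) a))
  have h (b : T) : ∃ (W : X.Opens) (_ : x ∈ W) (i : W ⟶ V), X.presheaf.map i.op b.1 = 0 := by
    have hb : b.1 ∈ LinearMap.ker (LinearMap.mulLeft Γ(X, V) a) := by
      rw [← hT]; exact Ideal.subset_span b.2
    have h0 : X.presheaf.germ V x hx b.1 = 0 := by
      refine (mem_nonZeroDivisors_iff_right.mp ha) _ ?_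
      rw [mul_comm, ← map_mul]
      exact (congrArg _ hb).trans (map_zero _)
    obtain ⟨W, hW, i, j, e⟩ := X.presheaf.germ_eq x hx hx b.1 0 (by rw [h0, map_zero])
    exact ⟨W, hW, i, by rw [e, map_zero]⟩
  choose W hW i hi using h
  have hx' : x ∈ V ⊓ Finset.univ.inf W := by
    refine ⟨hx, ?_⟩
    rw [Opens.coe_finset_inf]
    simpa using hW
  obtain ⟨r, hr, hxr⟩ := hV.exists_basicOpen_le ⟨x, hx'⟩ hx
  let D := X.basicOpen r
  have hDV : D ≤ V := X.basicOpen_le r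
  let := (X.presheaf.map (homOfLE hDV).op).hom.toAlgebra
  have : IsLocalization.Away r Γ(X, D) := hV.isLocalization_basicOpen r
  refine ⟨D, homOfLE hDV, hxr, hV.basicOpen r, ?_⟩
  have key (c : Γ(X, V)) (hc : c ∈ LinearMap.ker (LinearMap.mulLeft Γ(X, V) a)) :
      algebraMap Γ(X, V) Γ(X, D) c = 0 := by
    rw [← hT] at hc
    have hle : Ideal.span (T : Set Γ(X, V)) ≤ RingHom.ker (algebraMap Γ(X, V) Γ(X, D)) := by
      rw [Ideal.span_le]
      intro b hb
      have l : D ≤ W ⟨b, hb⟩ := hr.trans (inf_le_right.trans (Finset.inf_le (Finset.mem_univ _)))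
      have := congrArg (X.presheaf.map (homOfLE l).op) (hi ⟨b, hb⟩)
      rw [map_zero, ← CommRingCat.comp_apply, ← X.presheaf.map_comp] at this
      exact this
    exact hle hc
  rw [mem_nonZeroDivisors_iff_right]
  intro c hc
  obtain ⟨c', s, rfl⟩ := IsLocalization.exists_mk'_eq (Submonoid.powers r) c
  have e : IsLocalization.mk' Γ(X, D) (a * c') s = 0 := by
    rw [← IsLocalization.mul_mk'_eq_mk'_of_mul, mul_comm]
    exact hc
  obtain ⟨m, hm⟩ := (IsLocalization.mk'_eq_zero_iff _ _).mp e
  have h0 := key (m * c') (show a * (m * c') = 0 by rw [← hm]; ring)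
  rw [map_mul, (IsLocalization.map_units Γ(X, D) m).mul_right_eq_zero] at h0
  rw [IsLocalization.mk'_eq_mul_mk'_one, h0, zero_mul]

/-- The torsion subsheaf, as a subpresheaf of the presheaf underlying `M`. -/
def torsionSub (M : X.Modules) : PresheafOfModules.Submodule (toP M) := torsion M

lemma mem_torsionSub_iff {M : X.Modules} {U : X.Opens} {s : (toP M).obj (op U)} :
    s ∈ (torsionSub M).obj (op U) ↔ ∀ (V : X.Opens) (_ : IsAffineOpen V) (h : V ≤ U),
      ∃ a ∈ Γ(X, V)⁰, a • res (toP M) (homOfLE h) s = 0 := by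
  constructor
  · intro H V hV h
    have H₁ := (Submodule.mem_iInf (R := Γ(X, U)) (M := Γ(M, U)) _).mp
      ((Submodule.mem_iInf (R := Γ(X, U)) (M := Γ(M, U)) _).mp H ⟨V, hV⟩) h
    obtain ⟨a, ha⟩ := (Submodule.mem_torsion_iff _).mp H₁
    exact ⟨a.1, a.2, ha⟩
  · intro H
    refine (Submodule.mem_iInf (R := Γ(X, U)) (M := Γ(M, U)) _).mpr fun V =>
      (Submodule.mem_iInf (R := Γ(X, U)) (M := Γ(M, U)) _).mpr fun h => ?_
    obtain ⟨a, ha, h0⟩ := H V.1 V.2 h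
    exact (Submodule.mem_torsion_iff _).mpr ⟨⟨a, ha⟩, h0⟩

/-- The presheaf `U ↦ M(U) / (tor M)(U)`. -/
def quotTorsion (M : X.Modules) : PMod X := Limits.cokernel (torsionSub M).ι

/-- The quotient map to `U ↦ M(U) / (tor M)(U)`. -/
def quotTorsionπ (M : X.Modules) : toP M ⟶ quotTorsion M := Limits.cokernel.π (torsionSub M).ι

/-- The quotient map `M ⟶ M / tor M`. -/
def toModTorsion (M : X.Modules) : toP M ⟶ toP (modTorsion M) :=
  quotTorsionπ M ≫ toSheafify (quotTorsion M)

namespace StalkData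

variable {x : X} {M₀ N₀ : X.Modules} {M N : Type u}
  [AddCommGroup M] [Module (X.presheaf.stalk x) M] [AddCommGroup N] [Module (X.presheaf.stalk x) N]
  (d : StalkData (toP M₀) x M) (e : StalkData (toP N₀) x N)

lemma germ_mem_torsion (U : X.Opens) (hx : x ∈ U) (s : (toP M₀).obj (op U))
    (hs : s ∈ (torsionSub M₀).obj (op U)) :
    d.germ U hx s ∈ Submodule.torsion (X.presheaf.stalk x) M := by
  obtain ⟨_, ⟨V, hV, rfl⟩, hxV, hVU⟩ :=
    X.isBasis_affineOpens.exists_subset_of_mem_open hx U.isOpen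
  obtain ⟨a, ha, ha'⟩ := mem_torsionSub_iff.mp hs V hV hVU
  rw [Submodule.mem_torsion_iff]
  refine ⟨⟨X.presheaf.germ V x hxV a, germ_mem_nonZeroDivisors hV hxV ha⟩, ?_⟩
  rw [Submonoid.smul_def, ← d.germ_map (homOfLE hVU) hxV, ← d.germ_smul, ha', map_zero]

variable [IsLocallyNoetherian X]

lemma exists_res_mem_torsion (U : X.Opens) (hx : x ∈ U)
    (s : (toP M₀).obj (op U)) (hs : d.germ U hx s ∈ Submodule.torsion (X.presheaf.stalk x) M) :
    ∃ (V : X.Opens) (i : V ⟶ U), x ∈ V ∧ res (toP M₀) i s ∈ (torsionSub M₀).obj (op V) := by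
  obtain ⟨⟨a, ha⟩, has⟩ := (Submodule.mem_torsion_iff _).mp hs
  obtain ⟨V, hxV, a, rfl⟩ := X.presheaf.exists_germ_eq a
  have hUV : x ∈ U ⊓ V := ⟨hx, hxV⟩
  rw [Submonoid.smul_def] at has
  obtain ⟨W, i, hW, h⟩ := d.exists_map_eq_zero (U ⊓ V) hUV
    (X.presheaf.map (homOfLE (inf_le_right : U ⊓ V ≤ V)).op a •
      res (toP M₀) (homOfLE (inf_le_left : U ⊓ V ≤ U)) s)
    (by rw [d.germ_smul, d.germ_map, X.presheaf.germ_res_apply]; exact has)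
  obtain ⟨_, ⟨A, hA, rfl⟩, hxA, hAW⟩ :=
    X.isBasis_affineOpens.exists_subset_of_mem_open hW W.isOpen
  have hAW' : A ≤ W := hAW
  let j : A ⟶ V := homOfLE (hAW'.trans (i.le.trans inf_le_right))
  obtain ⟨B, k, hxB, hB, hak⟩ := exists_map_mem_nonZeroDivisors hA hxA
    (a := X.presheaf.map j.op a) (by rw [X.presheaf.germ_res_apply]; exact ha)
  let l : B ⟶ U := homOfLE (k.le.trans (hAW'.trans (i.le.trans inf_le_left)))
  refine ⟨B, l, hxB, mem_torsionSub_iff.mpr fun C hCa hC => ?_⟩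
  refine ⟨_, map_mem_nonZeroDivisors_of_affine hB hCa (homOfLE hC) hak, ?_⟩
  have h' := congrArg (res (toP M₀) (homOfLE (hC.trans (k.le.trans hAW)))) h
  rw [map_zero, res_smul, res_smul, res_res, res_res] at h'
  rw [← CommRingCat.comp_apply, ← CommRingCat.comp_apply, ← X.presheaf.map_comp,
    ← X.presheaf.map_comp] at h'
  rw [res_res, ← CommRingCat.comp_apply, ← CommRingCat.comp_apply, ← X.presheaf.map_comp,
    ← X.presheaf.map_comp]
  exact h'

/-- The stalk of the presheaf `U ↦ M(U) / (tor M)(U)`. -/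
def quotTorsion : StalkData (quotTorsion M₀) x (ModTor (X.presheaf.stalk x) M) :=
  have h := d.exists_hom_cokernel_π (torsionSub M₀) _ d.germ_mem_torsion d.exists_res_mem_torsion
  (canonicalStalk (TorsionFreeDiff.quotTorsion M₀) x).ofEquiv
    ((Submodule.quotEquivOfEq _ _ h.2).symm.trans
      ((hom d (canonicalStalk _ x) (quotTorsionπ M₀)).quotKerEquivOfSurjective h.1)).symm

lemma quotTorsion_germ (U : X.Opens) (hx : x ∈ U) (s : (toP M₀).obj (op U)) :
    d.quotTorsion.germ U hx (app (quotTorsionπ M₀) U s) =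
      Submodule.Quotient.mk (d.germ U hx s) := by
  rw [quotTorsion, ofEquiv_germ, LinearEquiv.symm_apply_eq, ← hom_germ d]
  rfl

/-- On a locally Noetherian scheme, the stalk of `M / tor M` is the stalk of `M` modulo its
torsion. -/
def modTor : StalkData (toP (modTorsion M₀)) x (ModTor (X.presheaf.stalk x) M) :=
  d.quotTorsion.sheafification

lemma modTor_germ (U : X.Opens) (hx : x ∈ U) (s : (toP M₀).obj (op U)) :
    d.modTor.germ U hx (app (toModTorsion M₀) U s) = Submodule.Quotient.mk (d.germ U hx s) :=
  (d.quotTorsion.sheafification_germ_toSheafify U hx _).trans (d.quotTorsion_germ U hx s)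

lemma hom_toModTorsion (m : M) : hom d d.modTor (toModTorsion M₀) m = Submodule.Quotient.mk m := by
  obtain ⟨U, hx, s, rfl⟩ := d.exists_germ m
  rw [hom_germ, modTor_germ]

end StalkData

lemma app_mem_torsionSub {M N : X.Modules} (f : M ⟶ N) (U : X.Opens) {s : (toP M).obj (op U)}
    (hs : s ∈ (torsionSub M).obj (op U)) : app (toPHom f) U s ∈ (torsionSub N).obj (op U) := by
  rw [mem_torsionSub_iff] at hs ⊢
  intro V hV h
  obtain ⟨a, ha, h0⟩ := hs V hV h
  exact ⟨a, ha, by rw [← app_res, ← map_smul, h0, map_zero]⟩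

/-- The morphism `M(U) / (tor M)(U) ⟶ N(U) / (tor N)(U)` induced by `M ⟶ N`. -/
def quotTorsionMap {M N : X.Modules} (f : M ⟶ N) : quotTorsion M ⟶ quotTorsion N :=
  Limits.cokernel.desc (torsionSub M).ι (toPHom f ≫ quotTorsionπ N) (by
    ext U s
    have h := app_mem_torsionSub f U.unop s.2
    have h0 : (torsionSub N).ι ≫ quotTorsionπ N = 0 := Limits.cokernel.condition _
    exact DFunLike.congr_fun (congrArg (fun a => app a U.unop) h0) ⟨_, h⟩)

lemma quotTorsionπ_map {M N : X.Modules} (f : M ⟶ N) :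
    quotTorsionπ M ≫ quotTorsionMap f = toPHom f ≫ quotTorsionπ N :=
  Limits.cokernel.π_desc _ _ _

/-- The morphism `M / tor M ⟶ N / tor N` induced by `M ⟶ N`. -/
def modTorsionMap {M N : X.Modules} (f : M ⟶ N) : modTorsion M ⟶ modTorsion N :=
  sheafify.map (quotTorsionMap f)

/-- The quotient map `M ⟶ M / tor M` as a morphism of sheaves. -/
def modTorsionMk (M : X.Modules) : M ⟶ modTorsion M := ⟨toModTorsion M⟩

namespace StalkData

variable {x : X} {M₀ N₀ : X.Modules} {M N : Type u}
  [AddCommGroup M] [Module (X.presheaf.stalk x) M] [AddCommGroup N] [Module (X.presheaf.stalk x) N]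
  (d : StalkData (toP M₀) x M) (e : StalkData (toP N₀) x N) [IsLocallyNoetherian X]

lemma hom_modTorsionMap (f : M₀ ⟶ N₀) :
    hom d.modTor e.modTor (toPHom (modTorsionMap f)) = modTorMap (hom d e (toPHom f)) := by
  ext m
  change hom _ _ _ (Submodule.Quotient.mk m) = modTorMap _ (Submodule.Quotient.mk m)
  obtain ⟨U, hx, s, rfl⟩ := d.exists_germ m
  rw [modTorMap_mk, hom_germ]
  refine (sheafification_hom d.quotTorsion e.quotTorsion _).trans ?_
  rw [← quotTorsion_germ, ← quotTorsion_germ, hom_germ, ← app_comp, quotTorsionπ_map, app_comp]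

end StalkData

end Stalks
end TorsionFreeDiff


/-! ### Stalks of differentials -/

namespace TorsionFreeDiff
section Kaehler
open Opposite ExteriorShuffle TensorProduct
variable {X S : Scheme.{u}}

lemma structureMap_unit (f : X ⟶ S) (V : S.Opens) (r : Γ(S, V)) :
    (structureMap f).app (op (f ⁻¹ᵁ V))
      (((TopCat.Presheaf.pullbackPushforwardAdjunction CommRingCat f.base).unit.app
        S.presheaf).app (op V) r) = f.app V r := by
  have h := ((TopCat.Presheaf.pullbackPushforwardAdjunction CommRingCat f.base).homEquiv
    S.presheaf X.presheaf).apply_symm_apply f.c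
  rw [Adjunction.homEquiv_unit] at h
  exact congrArg (fun a => (a.app (op V)).hom r) h

/-- The image of `f⁻¹ 𝒪_S` in `𝒪_X` consists of the restrictions of pulled back functions. -/
lemma exists_structureMap_eq (f : X ⟶ S) (U : X.Opens)
    (c : ((TopCat.Presheaf.pullback CommRingCat f.base).obj S.presheaf).obj (op U)) :
    ∃ (V : S.Opens) (h : U ≤ f ⁻¹ᵁ V) (r : Γ(S, V)),
      (structureMap f).app (op U) c = X.presheaf.map (homOfLE h).op (f.app V r) := by
  have hc := (Opens.map f.base).op.isPointwiseLeftKanExtensionLeftKanExtensionUnit S.presheaf (op U)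
  have : IsFiltered (CostructuredArrow (Opens.map f.base).op (op U)) :=
    RepresentablyCoflat.filtered (F := (Opens.map f.base).op) (op U)
  obtain ⟨j, r, hr⟩ := CategoryTheory.Limits.Concrete.isColimit_exists_rep _ hc c
  obtain ⟨V, ⟨⟩, i⟩ := j
  have hV : U ≤ f ⁻¹ᵁ V.unop := i.unop.le
  refine ⟨V.unop, hV, r, ?_⟩
  have e : c = ((TopCat.Presheaf.pullback CommRingCat f.base).obj S.presheaf).map (homOfLE hV).op
      (((TopCat.Presheaf.pullbackPushforwardAdjunction CommRingCat f.base).unit.app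
        S.presheaf).app V r) := by
    rw [← hr]
    simp [TopCat.Presheaf.pullbackPushforwardAdjunction, Functor.lanAdjunction_unit]
    rfl
  rw [e]
  have n := congrArg (fun a => a.hom
      (((TopCat.Presheaf.pullbackPushforwardAdjunction CommRingCat f.base).unit.app
        S.presheaf).app V r)) ((structureMap f).naturality (homOfLE hV).op)
  exact n.trans (congrArg (X.presheaf.map (homOfLE hV).op) (structureMap_unit f V.unop r))

/-- The presheaf of relative differentials, as a presheaf of modules over the presheaf of
commutative rings `𝒪_X`. -/
def kaehlerP (f : X ⟶ S) : PMod X := kaehlerPresheaf f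

/-- The universal derivation on the sections over an open set. -/
def dSec (f : X ⟶ S) (U : X.Opens) : Derivation ℤ Γ(X, U) ((kaehlerP f).obj (op U)) :=
  Derivation.mk' (AddMonoidHom.toIntLinearMap (AddMonoidHom.mk'
    (CommRingCat.KaehlerDifferential.d (f := (structureMap f).app (op U)))
      (fun a b => ModuleCat.Derivation.d_add _ a b)))
    (fun a b => (ModuleCat.Derivation.d_mul
      (CommRingCat.KaehlerDifferential.D ((structureMap f).app (op U))) a b :))

lemma dSec_apply (f : X ⟶ S) (U : X.Opens) (a : Γ(X, U)) :
    dSec f U a = CommRingCat.KaehlerDifferential.d (f := (structureMap f).app (op U)) a := rfl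

lemma res_dSec (f : X ⟶ S) {U V : X.Opens} (i : V ⟶ U) (a : Γ(X, U)) :
    res (kaehlerP f) i (dSec f U a) = dSec f V (X.presheaf.map i.op a) :=
  PresheafOfModules.DifferentialsConstruction.relativeDifferentials'_map_d (structureMap f) i.op a

lemma dSec_app (f : X ⟶ S) (V : S.Opens) (r : Γ(S, V)) : dSec f (f ⁻¹ᵁ V) (f.app V r) = 0 := by
  rw [← structureMap_unit, dSec_apply]
  exact ModuleCat.Derivation.d_map _ _

lemma span_range_d {A B : CommRingCat.{u}} (f : A ⟶ B) :
    Submodule.span B (Set.range (CommRingCat.KaehlerDifferential.d (f := f))) = ⊤ := by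
  have h := CommRingCat.KaehlerDifferential.ext (f := f)
    (α := ModuleCat.ofHom (Submodule.mkQ
      (Submodule.span B (Set.range (CommRingCat.KaehlerDifferential.d (f := f))))))
    (β := 0) (fun b => (Submodule.Quotient.mk_eq_zero _).mpr (Submodule.subset_span ⟨b, rfl⟩))
  rw [← Submodule.ker_mkQ (Submodule.span B _), LinearMap.ker_eq_top]
  exact congrArg ModuleCat.Hom.hom h

lemma span_range_dSec (f : X ⟶ S) (U : X.Opens) :
    Submodule.span Γ(X, U) (Set.range (dSec f U)) = ⊤ := by
  exact span_range_d ((structureMap f).app (op U))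

/-- The linear map on sections of the presheaf of differentials induced by a derivation that
kills functions pulled back from `S`. -/
def kaehlerLift (f : X ⟶ S) (U : X.Opens) {N : Type u} [AddCommGroup N] [Module Γ(X, U) N]
    (D : Derivation ℤ Γ(X, U) N)
    (hD : ∀ (V : S.Opens) (h : U ≤ f ⁻¹ᵁ V) (r : Γ(S, V)),
      D (X.presheaf.map (homOfLE h).op (f.app V r)) = 0) :
    (kaehlerP f).obj (op U) →ₗ[Γ(X, U)] N :=
  (ModuleCat.Derivation.desc (M := ModuleCat.of Γ(X, U) N) (f := (structureMap f).app (op U))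
    (ModuleCat.Derivation.mk D (fun a b => map_add D a b) (fun a b => D.leibniz a b)
      (fun c => by
        obtain ⟨V, h, r, e⟩ := exists_structureMap_eq f U c
        rw [e]
        exact hD V h r))).hom

lemma kaehlerLift_dSec (f : X ⟶ S) (U : X.Opens) {N : Type u} [AddCommGroup N] [Module Γ(X, U) N]
    (D : Derivation ℤ Γ(X, U) N)
    (hD : ∀ (V : S.Opens) (h : U ≤ f ⁻¹ᵁ V) (r : Γ(S, V)),
      D (X.presheaf.map (homOfLE h).op (f.app V r)) = 0) (a : Γ(X, U)) :
    kaehlerLift f U D hD (dSec f U a) = D a :=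
  ModuleCat.Derivation.desc_d _ a

lemma kaehler_induction (f : X ⟶ S) {U : X.Opens} {C : (kaehlerP f).obj (op U) → Prop}
    (z : (kaehlerP f).obj (op U)) (zero : C 0) (smul : ∀ (a b : Γ(X, U)), C (a • dSec f U b))
    (add : ∀ a b, C a → C b → C (a + b)) : C z := by
  have hz : z ∈ Submodule.span Γ(X, U) (Set.range (dSec f U)) := by
    rw [span_range_dSec]; trivial
  induction hz using Submodule.closure_induction with
  | zero => exact zero
  | smul_mem a m hm => obtain ⟨s, rfl⟩ := hm; exact smul a s
  | add a b _ _ ha hb => exact add _ _ ha hb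

namespace StalkData

variable (f : X ⟶ S) (x : X) (k : Type u) [CommRing k] [Algebra k (X.presheaf.stalk x)]

lemma algebraMap_germ_app
    (hk : (f.stalkMap x).hom.range ≤ (algebraMap k (X.presheaf.stalk x)).range)
    (U : X.Opens) (hx : x ∈ U) (V : S.Opens) (h : U ≤ f ⁻¹ᵁ V) (r : Γ(S, V)) :
    ∃ c, algebraMap k _ c =
      X.presheaf.germ U x hx (X.presheaf.map (homOfLE h).op (f.app V r)) := by
  refine hk ⟨S.presheaf.germ V (f x) (h hx) r, ?_⟩
  rw [X.presheaf.germ_res_apply]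
  exact Scheme.Hom.germ_stalkMap_apply f V x (h hx) r

/-- The derivation `a ↦ d aₓ` on the functions over an open set. -/
def germDerivation (U : X.Opens) (hx : x ∈ U) :
    letI : Module Γ(X, U) Ω[X.presheaf.stalk x⁄k] := Module.compHom _ (X.presheaf.germ U x hx).hom
    Derivation ℤ Γ(X, U) Ω[X.presheaf.stalk x⁄k] :=
  letI : Module Γ(X, U) Ω[X.presheaf.stalk x⁄k] := Module.compHom _ (X.presheaf.germ U x hx).hom
  Derivation.mk' (AddMonoidHom.toIntLinearMap (AddMonoidHom.mk'
    (fun a => KaehlerDifferential.D k (X.presheaf.stalk x) (X.presheaf.germ U x hx a))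
    (fun a b => by rw [map_add, map_add])))
    (fun a b => by
      change KaehlerDifferential.D k _ (X.presheaf.germ U x hx (a * b)) =
        X.presheaf.germ U x hx a • KaehlerDifferential.D k _ (X.presheaf.germ U x hx b) +
        X.presheaf.germ U x hx b • KaehlerDifferential.D k _ (X.presheaf.germ U x hx a)
      rw [map_mul, Derivation.leibniz])

/-- The germ map of the presheaf of differentials. -/
def kaehlerGerm (hk : (f.stalkMap x).hom.range ≤ (algebraMap k (X.presheaf.stalk x)).range)
    (U : X.Opens) (hx : x ∈ U) :
    (kaehlerP f).obj (op U) →ₛₗ[(X.presheaf.germ U x hx).hom] Ω[X.presheaf.stalk x⁄k] :=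
  letI : Module Γ(X, U) Ω[X.presheaf.stalk x⁄k] := Module.compHom _ (X.presheaf.germ U x hx).hom
  letI l := kaehlerLift f U (N := Ω[X.presheaf.stalk x⁄k]) (germDerivation x k U hx)
    (fun V h r => by
      obtain ⟨c, hc⟩ := algebraMap_germ_app f x k hk U hx V h r
      change KaehlerDifferential.D k _ (X.presheaf.germ U x hx _) = 0
      rw [← hc, Derivation.map_algebraMap])
  { toFun := l
    map_add' := map_add l
    map_smul' := fun a m => map_smul l a m }

lemma kaehlerGerm_dSec (hk : (f.stalkMap x).hom.range ≤ (algebraMap k (X.presheaf.stalk x)).range)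
    (U : X.Opens) (hx : x ∈ U) (a : Γ(X, U)) :
    kaehlerGerm f x k hk U hx (dSec f U a) =
      KaehlerDifferential.D k (X.presheaf.stalk x) (X.presheaf.germ U x hx a) :=
  letI : Module Γ(X, U) Ω[X.presheaf.stalk x⁄k] := Module.compHom _ (X.presheaf.germ U x hx).hom
  kaehlerLift_dSec f U (N := Ω[X.presheaf.stalk x⁄k]) (germDerivation x k U hx) (fun V h r => by
    obtain ⟨c, hc⟩ := algebraMap_germ_app f x k hk U hx V h r
    change KaehlerDifferential.D k _ (X.presheaf.germ U x hx _) = 0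
    rw [← hc, Derivation.map_algebraMap]) a

lemma kaehlerGerm_map
    (hk : (f.stalkMap x).hom.range ≤ (algebraMap k (X.presheaf.stalk x)).range)
    {V U : X.Opens} (i : V ⟶ U) (hx : x ∈ V) (s : (kaehlerP f).obj (op U)) :
    kaehlerGerm f x k hk V hx (res (kaehlerP f) i s) = kaehlerGerm f x k hk U (i.le hx) s := by
  induction s using kaehler_induction with
  | zero => simp only [map_zero]
  | smul a b =>
    rw [res_smul, res_dSec, LinearMap.map_smulₛₗ, LinearMap.map_smulₛₗ, kaehlerGerm_dSec,
      kaehlerGerm_dSec, X.presheaf.germ_res_apply]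
    congr 1
    exact congrArg _ (X.presheaf.germ_res_apply i x hx b)
  | add a b ha hb => simp only [map_add, ha, hb]

lemma dStalk_aux (y : X.presheaf.stalk x) : ∃ z : presheafStalk (kaehlerP f) x,
    ∀ U hx (a : Γ(X, U)), X.presheaf.germ U x hx a = y →
      (canonicalStalk (kaehlerP f) x).germ U hx (dSec f U a) = z := by
  obtain ⟨U, hx, a, rfl⟩ := X.presheaf.exists_germ_eq y
  refine ⟨(canonicalStalk (kaehlerP f) x).germ U hx (dSec f U a), fun V hV b hb => ?_⟩
  obtain ⟨W, hW, i, j, h⟩ := X.presheaf.germ_eq x hV hx b a hb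
  rw [← (canonicalStalk (kaehlerP f) x).germ_map i hW, ←
    (canonicalStalk (kaehlerP f) x).germ_map j hW, res_dSec, res_dSec, h]

/-- The derivation from the local ring to the stalk of the presheaf of differentials. -/
def dStalk (y : X.presheaf.stalk x) : presheafStalk (kaehlerP f) x := (dStalk_aux f x y).choose

lemma dStalk_germ (U : X.Opens) (hx : x ∈ U) (a : Γ(X, U)) :
    dStalk f x (X.presheaf.germ U x hx a) =
      (canonicalStalk (kaehlerP f) x).germ U hx (dSec f U a) :=
  ((dStalk_aux f x _).choose_spec U hx a rfl).symm

lemma exists_germ_germ (y z : X.presheaf.stalk x) : ∃ (U : X.Opens) (hx : x ∈ U) (a b : Γ(X, U)),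
    X.presheaf.germ U x hx a = y ∧ X.presheaf.germ U x hx b = z := by
  obtain ⟨U, hU, a, rfl⟩ := X.presheaf.exists_germ_eq y
  obtain ⟨V, hV, b, rfl⟩ := X.presheaf.exists_germ_eq z
  exact ⟨U ⊓ V, ⟨hU, hV⟩, X.presheaf.map (homOfLE inf_le_left).op a,
    X.presheaf.map (homOfLE inf_le_right).op b, X.presheaf.germ_res_apply _ _ _ _,
    X.presheaf.germ_res_apply _ _ _ _⟩

lemma dStalk_add (y z : X.presheaf.stalk x) :
    dStalk f x (y + z) = dStalk f x y + dStalk f x z := by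
  obtain ⟨U, hx, a, b, rfl, rfl⟩ := exists_germ_germ x y z
  rw [← map_add, dStalk_germ, dStalk_germ, dStalk_germ, map_add, map_add]

lemma dStalk_mul (y z : X.presheaf.stalk x) :
    dStalk f x (y * z) = y • dStalk f x z + z • dStalk f x y := by
  obtain ⟨U, hx, a, b, rfl, rfl⟩ := exists_germ_germ x y z
  rw [← map_mul, dStalk_germ, dStalk_germ, dStalk_germ, Derivation.leibniz, map_add, germ_smul,
    germ_smul]

lemma dStalk_algebraMap
    (hk : (algebraMap k (X.presheaf.stalk x)).range ≤ (f.stalkMap x).hom.range) (c : k) :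
    dStalk f x (algebraMap k _ c) = 0 := by
  obtain ⟨r, hr⟩ := hk ⟨c, rfl⟩
  obtain ⟨V, hV, r, rfl⟩ := S.presheaf.exists_germ_eq r
  have e : (f.stalkMap x).hom (S.presheaf.germ V (f x) hV r) =
      X.presheaf.germ (f ⁻¹ᵁ V) x hV (f.app V r) := Scheme.Hom.germ_stalkMap_apply f V x hV r
  rw [← hr, e]
  refine (dStalk_germ f x (f ⁻¹ᵁ V) hV _).trans ?_
  rw [dSec_app, map_zero]

/-- The stalk of the presheaf of differentials of `f` at `x` is the module of differentials of the
local ring at `x` over (any ring having the same image as) the local ring at `f x`. -/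
def kaehler (hk : (algebraMap k (X.presheaf.stalk x)).range = (f.stalkMap x).hom.range) :
    StalkData (kaehlerP f) x Ω[X.presheaf.stalk x⁄k] :=
  letI : Module k (presheafStalk (kaehlerP f) x) :=
    Module.compHom _ (algebraMap k (X.presheaf.stalk x))
  haveI : IsScalarTower k (X.presheaf.stalk x) (presheafStalk (kaehlerP f) x) :=
    IsScalarTower.of_algebraMap_smul fun _ _ => rfl
  letI D : Derivation k (X.presheaf.stalk x) (presheafStalk (kaehlerP f) x) :=
    Derivation.mk'
      { toFun := dStalk f x
        map_add' := dStalk_add f x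
        map_smul' := fun c y => by
          rw [Algebra.smul_def, dStalk_mul, dStalk_algebraMap f x k hk.le, smul_zero, add_zero]
          rfl }
      (dStalk_mul f x)
  ofLeftInverse (fun U hx => (kaehlerGerm f x k hk.ge U hx).toAddMonoidHom)
    (fun U hx a s => (kaehlerGerm f x k hk.ge U hx).map_smulₛₗ a s)
    (germ_map := kaehlerGerm_map f x k hk.ge)
    (fun m => by
      have hm : m ∈ Submodule.span (X.presheaf.stalk x)
          (Set.range (KaehlerDifferential.D k (X.presheaf.stalk x))) := by
        rw [KaehlerDifferential.span_range_derivation]; trivial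
      induction hm using Submodule.closure_induction with
      | zero => exact ⟨⊤, trivial, 0, map_zero _⟩
      | smul_mem y m hm =>
        obtain ⟨z, rfl⟩ := hm
        obtain ⟨U, hx, a, b, rfl, rfl⟩ := exists_germ_germ x y z
        exact ⟨U, hx, a • dSec f U b, ((kaehlerGerm f x k hk.ge U hx).map_smulₛₗ _ _).trans
          (congrArg _ (kaehlerGerm_dSec f x k hk.ge U hx b))⟩
      | add a b _ _ ha hb =>
        exact exists_germ_add
          (germ := fun U hx => (kaehlerGerm f x k hk.ge U hx).toAddMonoidHom)
          (kaehlerGerm_map f x k hk.ge) ha hb)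
    D.liftKaehlerDifferential.toAddMonoidHom
    (fun U hx s => by
      change D.liftKaehlerDifferential (kaehlerGerm f x k hk.ge U hx s) = _
      induction s using kaehler_induction with
      | zero => simp only [map_zero]
      | smul a b =>
        rw [LinearMap.map_smulₛₗ, kaehlerGerm_dSec, map_smul, germ_smul,
          Derivation.liftKaehlerDifferential_comp_D]
        exact congrArg _ (dStalk_germ f x U hx b)
      | add a b ha hb => simp only [map_add, ha, hb])

lemma kaehler_germ_dSec (hk : (algebraMap k (X.presheaf.stalk x)).range = (f.stalkMap x).hom.range)
    (U : X.Opens) (hx : x ∈ U) (a : Γ(X, U)) :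
    (kaehler f x k hk).germ U hx (dSec f U a) =
      KaehlerDifferential.D k (X.presheaf.stalk x) (X.presheaf.germ U x hx a) :=
  kaehlerGerm_dSec f x k hk.ge U hx a

end StalkData

end Kaehler
end TorsionFreeDiff


/-! ### Comultiplication of differential forms -/

namespace TorsionFreeDiff
section Maps
open Opposite ExteriorShuffle TensorProduct StalkData
variable {X Y S : Scheme.{u}}

/-- A morphism of presheaves of modules, given by linear maps compatible with restrictions. -/
def homMk {P P' : PMod X} (φ : ∀ U : X.Opens, P.obj (op U) →ₗ[Γ(X, U)] P'.obj (op U))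
    (h : ∀ {V U : X.Opens} (i : V ⟶ U) (s : P.obj (op U)), φ V (res P i s) = res P' i (φ U s)) :
    P ⟶ P' where
  app U := ModuleCat.ofHom (φ U.unop)
  naturality {U V} i := by
    refine ModuleCat.hom_ext (LinearMap.ext fun s => ?_)
    exact h i.unop s

/-- The restriction map as a semilinear map. -/
def resₛₗ (P : PMod X) {V U : X.Opens} (i : V ⟶ U) :
    P.obj (op U) →ₛₗ[(X.presheaf.map i.op).hom] P.obj (op V) :=
  { res P i with map_smul' := res_smul P i }

lemma res_exteriorSections_apply (P : PMod X) (p : ℕ) {V U : X.Opens} (i : V ⟶ U)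
    (z : ⋀[Γ(X, U)]^p (P.obj (op U))) :
    res (exteriorPower (R := X.presheaf) P p) i (exteriorSections P p U z) =
      exteriorSections P p V (exteriorMapₛₗ (resₛₗ P i) p z) := by
  have hz : z ∈ Submodule.span Γ(X, U) (Set.range (_root_.exteriorPower.ιMulti Γ(X, U) p)) := by
    rw [_root_.exteriorPower.ιMulti_span]; trivial
  induction hz using Submodule.closure_induction with
  | zero => simp only [map_zero]
  | smul_mem a m hm =>
    obtain ⟨s, rfl⟩ := hm
    have e := congrArg (exteriorSections P p V) ((exteriorMapₛₗ (resₛₗ P i) p).map_smulₛₗ a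
      (_root_.exteriorPower.ιMulti Γ(X, U) p s))
    rw [exteriorMapₛₗ_ιMulti] at e
    refine Eq.trans ?_ e.symm
    refine (res_smul (exteriorPower (R := X.presheaf) P p) i a
      (exteriorSections P p U (_root_.exteriorPower.ιMulti Γ(X, U) p s))).trans ?_
    rw [res_exteriorSections]
    rfl
  | add a b _ _ ha hb => simp only [map_add, ha, hb]

lemma comp_app_res (f : X ⟶ Y) (s : Y ⟶ S) {U : X.Opens} {V : S.Opens} (h : U ≤ (f ≫ s) ⁻¹ᵁ V)
    (r : Γ(S, V)) : X.presheaf.map (homOfLE h).op ((f ≫ s).app V r) =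
      X.presheaf.map (homOfLE (show U ≤ f ⁻¹ᵁ (s ⁻¹ᵁ V) from h)).op (f.app _ (s.app V r)) := by
  rw [Scheme.Hom.comp_app]; rfl

lemma dSec_res_app (f : X ⟶ S) {U : X.Opens} {V : S.Opens} (h : U ≤ f ⁻¹ᵁ V) (r : Γ(S, V)) :
    dSec f U (X.presheaf.map (homOfLE h).op (f.app V r)) = 0 := by
  rw [← res_dSec, dSec_app, map_zero]

/-- The map from the differentials over `S` to the differentials over `Y`, on sections. -/
def kaehlerToRelSec (f : X ⟶ Y) (s : Y ⟶ S) (U : X.Opens) :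
    (kaehlerP (f ≫ s)).obj (op U) →ₗ[Γ(X, U)] (kaehlerP f).obj (op U) :=
  kaehlerLift (f ≫ s) U (dSec f U) fun V h r => by
    rw [comp_app_res]; exact dSec_res_app f _ _

lemma kaehlerToRelSec_dSec (f : X ⟶ Y) (s : Y ⟶ S) (U : X.Opens) (a : Γ(X, U)) :
    kaehlerToRelSec f s U (dSec (f ≫ s) U a) = dSec f U a :=
  kaehlerLift_dSec _ _ _ _ _

lemma kaehlerToRelSec_res (f : X ⟶ Y) (s : Y ⟶ S) {V U : X.Opens} (i : V ⟶ U)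
    (z : (kaehlerP (f ≫ s)).obj (op U)) :
    kaehlerToRelSec f s V (res _ i z) = res _ i (kaehlerToRelSec f s U z) := by
  induction z using kaehler_induction with
  | zero => simp only [map_zero]
  | smul a b =>
    rw [res_smul, map_smul, map_smul, res_smul, kaehlerToRelSec_dSec, res_dSec, res_dSec,
      kaehlerToRelSec_dSec]
  | add a b ha hb => simp only [map_add, ha, hb]

/-- The map from the differentials over `S` to the differentials over `Y`. -/
def kaehlerToRel (f : X ⟶ Y) (s : Y ⟶ S) : kaehlerP (f ≫ s) ⟶ kaehlerP f :=
  homMk (kaehlerToRelSec f s) (kaehlerToRelSec_res f s)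

/-- The sections of a tensor product of exterior power presheaves. -/
def tensorExteriorSections (P P' : PMod X) (r t : ℕ) (U : X.Opens) :
    (⋀[Γ(X, U)]^r (P.obj (op U))) ⊗[Γ(X, U)] (⋀[Γ(X, U)]^t (P'.obj (op U))) ≃ₗ[Γ(X, U)]
      (tensorPresheaf (exteriorPower (R := X.presheaf) P r)
        (exteriorPower (R := X.presheaf) P' t)).obj (op U) := LinearEquiv.refl _ _

lemma res_tensorExteriorSections (P P' : PMod X) (r t : ℕ) {V U : X.Opens} (i : V ⟶ U)
    (z : (⋀[Γ(X, U)]^r (P.obj (op U))) ⊗[Γ(X, U)] (⋀[Γ(X, U)]^t (P'.obj (op U)))) :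
    res (tensorPresheaf (exteriorPower (R := X.presheaf) P r)
        (exteriorPower (R := X.presheaf) P' t)) i (tensorExteriorSections P P' r t U z) =
      tensorExteriorSections P P' r t V (TensorProduct.map (exteriorMapₛₗ (resₛₗ P i) r)
        (exteriorMapₛₗ (resₛₗ P' i) t) z) := by
  induction z with
  | zero => simp only [map_zero]
  | add a b ha hb => simp only [map_add, ha, hb]
  | tmul a b =>
    rw [TensorProduct.map_tmul]
    exact congrArg₂ (fun (a : (exteriorPower (R := X.presheaf) P r).obj (op V))
      (b : (exteriorPower (R := X.presheaf) P' t).obj (op V)) => tensorSections _ _ V (a ⊗ₜ b))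
      (res_exteriorSections_apply P r i a) (res_exteriorSections_apply P' t i b)

/-- The comultiplication `⋀ᵖ Ω_{X/S} ⟶ ⋀ʳ Ω_{X/S} ⊗ ⋀ᵗ Ω_{X/Y}` of presheaves. -/
def comultPresheaf (f : X ⟶ Y) (s : Y ⟶ S) {r t p : ℕ} (h : r + t = p) :
    exteriorPower (R := X.presheaf) (kaehlerP (f ≫ s)) p ⟶
      tensorPresheaf (exteriorPower (R := X.presheaf) (kaehlerP (f ≫ s)) r)
        (exteriorPower (R := X.presheaf) (kaehlerP f) t) :=
  homMk (fun U => (tensorExteriorSections _ _ r t U).toLinearMap ∘ₗ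
      (comult h (kaehlerToRelSec f s U)) ∘ₗ (exteriorSections _ p U).symm.toLinearMap)
    (fun {V U} i z => by
      obtain ⟨z, rfl⟩ := (exteriorSections _ p U).surjective z
      have key := map_comult (resₛₗ (kaehlerP (f ≫ s)) i) (resₛₗ (kaehlerP f) i)
        (fun z => (kaehlerToRelSec_res f s i z).symm) h z
      rw [res_exteriorSections_apply]
      exact (congrArg (tensorExteriorSections _ _ r t V) key.symm).trans
        (res_tensorExteriorSections _ _ r t i _).symm)

lemma app_comultPresheaf (f : X ⟶ Y) (s : Y ⟶ S) {r t p : ℕ} (h : r + t = p) (U : X.Opens)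
    (z : ⋀[Γ(X, U)]^p ((kaehlerP (f ≫ s)).obj (op U))) :
    app (comultPresheaf f s h) U (exteriorSections _ p U z) =
      tensorExteriorSections _ _ r t U (comult h (kaehlerToRelSec f s U) z) := rfl

/-- The morphism from the presheaf `⋀ᵖ Ω_{X/Y}` to the sheaf `Ωᵖ_{X/Y}`. -/
def toOmega (f : X ⟶ Y) (p : ℕ) :
    exteriorPower (R := X.presheaf) (kaehlerP f) p ⟶ toP (Omega f p) := toSheafify _

/-- The morphism from the presheaf `⋀ᵖ Ω_{X/Y}` to the sheaf `Ωᵖ_{X/Y} / tor`. -/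
def toOmegaCheck (f : X ⟶ Y) (p : ℕ) :
    exteriorPower (R := X.presheaf) (kaehlerP f) p ⟶ toP (OmegaCheck f p) :=
  toOmega f p ≫ toModTorsion (Omega f p)

/-- The comultiplication as a morphism from the presheaf `⋀ᵖ Ω_{X/S}`. -/
def comultOmegaPresheaf (f : X ⟶ Y) (s : Y ⟶ S) {r t p : ℕ} (h : r + t = p) :
    exteriorPower (R := X.presheaf) (kaehlerP (f ≫ s)) p ⟶
      tensorPresheaf (toP (Omega (f ≫ s) r)) (toP (OmegaCheck f t)) :=
  comultPresheaf f s h ≫ tensorPresheafMap (toOmega (f ≫ s) r) (toOmegaCheck f t)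

/-- The comultiplication `Ωᵖ_{X/S} ⟶ Ωʳ_{X/S} ⊗ (Ωᵗ_{X/Y} / tor)`. -/
def comultOmega (f : X ⟶ Y) (s : Y ⟶ S) {r t p : ℕ} (h : r + t = p) :
    Omega (f ≫ s) p ⟶ tensor (Omega (f ≫ s) r) (OmegaCheck f t) :=
  sheafify.map (comultOmegaPresheaf f s h)

/-- The comultiplication `Ωᵖ_{X/S} / tor ⟶ (Ωʳ_{X/S} ⊗ (Ωᵗ_{X/Y} / tor)) / tor`. -/
def comultCheck (f : X ⟶ Y) (s : Y ⟶ S) {r t p : ℕ} (h : r + t = p) :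
    OmegaCheck (f ≫ s) p ⟶ modTorsion (tensor (Omega (f ≫ s) r) (OmegaCheck f t)) :=
  modTorsionMap (comultOmega f s h)

section Stalk

variable (f : X ⟶ Y) (s : Y ⟶ S) (x : X) (R k : Type u) [CommRing R] [CommRing k]
  [Algebra k R] [Algebra R (X.presheaf.stalk x)] [Algebra k (X.presheaf.stalk x)]
  [IsScalarTower k R (X.presheaf.stalk x)]
  (hk : (algebraMap k (X.presheaf.stalk x)).range = ((f ≫ s).stalkMap x).hom.range)
  (hR : (algebraMap R (X.presheaf.stalk x)).range = (f.stalkMap x).hom.range)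

/-- The stalk of `Ωᵖ`. -/
def omegaStalk (p : ℕ) :
    StalkData (toP (Omega f p)) x (⋀[X.presheaf.stalk x]^p Ω[X.presheaf.stalk x⁄R]) :=
  ((kaehler f x R hR).exterior p).sheafification

/-- The stalk of `Ωᵖ / tor`. -/
def omegaCheckStalk [IsLocallyNoetherian X] (p : ℕ) : StalkData (toP (OmegaCheck f p)) x
    (ModTor (X.presheaf.stalk x) (⋀[X.presheaf.stalk x]^p Ω[X.presheaf.stalk x⁄R])) :=
  (omegaStalk f x R hR p).modTor

/-- The stalk of a tensor product of sheaves. -/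
def tensorStalk {F G : X.Modules} {M N : Type u} [AddCommGroup M] [Module (X.presheaf.stalk x) M]
    [AddCommGroup N] [Module (X.presheaf.stalk x) N] (d : StalkData (toP F) x M)
    (e : StalkData (toP G) x N) :
    StalkData (toP (TorsionFreeDiff.tensor F G)) x (M ⊗[X.presheaf.stalk x] N) :=
  (d.tensor e).sheafification

lemma hom_toOmega (p : ℕ) (m) :
    hom ((kaehler f x R hR).exterior p) (omegaStalk f x R hR p) (toOmega f p) m = m :=
  hom_toSheafify ((kaehler f x R hR).exterior p) m

lemma germ_tensorExteriorSections {P P' : PMod X} {M M' : Type u} [AddCommGroup M]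
    [Module (X.presheaf.stalk x) M] [AddCommGroup M'] [Module (X.presheaf.stalk x) M']
    (d : StalkData P x M) (d' : StalkData P' x M') (r t : ℕ) (U : X.Opens) (hx : x ∈ U)
    (z : (⋀[Γ(X, U)]^r (P.obj (op U))) ⊗[Γ(X, U)] (⋀[Γ(X, U)]^t (P'.obj (op U)))) :
    ((d.exterior r).tensor (d'.exterior t)).germ U hx (tensorExteriorSections P P' r t U z) =
      TensorProduct.map (exteriorMapₛₗ (d.germₛₗ U hx) r) (exteriorMapₛₗ (d'.germₛₗ U hx) t) z := by
  induction z with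
  | zero => simp only [map_zero]
  | add a b ha hb => simp only [map_add, ha, hb]
  | tmul a b => rfl

lemma hom_kaehlerToRel :
    hom (kaehler (f ≫ s) x k hk) (kaehler f x R hR) (kaehlerToRel f s) =
      KaehlerDifferential.map k R (X.presheaf.stalk x) (X.presheaf.stalk x) := by
  refine LinearMap.ext fun m => ?_
  obtain ⟨U, hx, z, rfl⟩ := (kaehler (f ≫ s) x k hk).exists_germ m
  rw [hom_germ]
  induction z using kaehler_induction with
  | zero => simp only [map_zero]
  | add a b ha hb => simp only [map_add, ha, hb]
  | smul a b =>
    rw [map_smul, germ_smul, germ_smul, map_smul, kaehler_germ_dSec]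
    have e : app (kaehlerToRel f s) U (dSec (f ≫ s) U b) = dSec f U b :=
      kaehlerToRelSec_dSec f s U b
    rw [e, kaehler_germ_dSec, KaehlerDifferential.map_D]
    rfl

lemma kaehler_germ_kaehlerToRelSec (U : X.Opens) (hx : x ∈ U)
    (z : (kaehlerP (f ≫ s)).obj (op U)) :
    (kaehler f x R hR).germ U hx (kaehlerToRelSec f s U z) =
      KaehlerDifferential.map k R (X.presheaf.stalk x) (X.presheaf.stalk x)
        ((kaehler (f ≫ s) x k hk).germ U hx z) := by
  have := LinearMap.congr_fun (hom_kaehlerToRel f s x R k hk hR)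
    ((kaehler (f ≫ s) x k hk).germ U hx z)
  rw [hom_germ] at this
  exact this

lemma hom_comultPresheaf {r t p : ℕ} (h : r + t = p) (m) :
    hom ((kaehler (f ≫ s) x k hk).exterior p)
      (((kaehler (f ≫ s) x k hk).exterior r).tensor ((kaehler f x R hR).exterior t))
      (comultPresheaf f s h) m =
    comult h (KaehlerDifferential.map k R (X.presheaf.stalk x) (X.presheaf.stalk x)) m := by
  obtain ⟨U, hx, z, rfl⟩ := ((kaehler (f ≫ s) x k hk).exterior p).exists_germ m
  obtain ⟨z, rfl⟩ := (exteriorSections _ p U).surjective z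
  rw [hom_germ, app_comultPresheaf, germ_tensorExteriorSections]
  exact map_comult ((kaehler (f ≫ s) x k hk).germₛₗ U hx) ((kaehler f x R hR).germₛₗ U hx)
    (fun z => (kaehler_germ_kaehlerToRelSec f s x R k hk hR U hx z)) h z

lemma hom_toOmegaCheck [IsLocallyNoetherian X] (t : ℕ) :
    hom ((kaehler f x R hR).exterior t) (omegaCheckStalk f x R hR t)
      (toOmegaCheck f t) = Submodule.mkQ _ := by
  refine LinearMap.ext fun m => ?_
  refine (StalkData.hom_comp ((kaehler f x R hR).exterior t) (omegaStalk f x R hR t)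
    (omegaStalk f x R hR t).modTor (toOmega f t) (toModTorsion (Omega f t)) m).trans ?_
  rw [hom_toOmega]
  exact hom_toModTorsion (omegaStalk f x R hR t) m

lemma hom_comultOmegaPresheaf [IsLocallyNoetherian X] {r t p : ℕ} (h : r + t = p) (m) :
    hom ((kaehler (f ≫ s) x k hk).exterior p)
      ((omegaStalk (f ≫ s) x k hk r).tensor (omegaCheckStalk f x R hR t))
      (comultOmegaPresheaf f s h) m =
    (Submodule.torsion (X.presheaf.stalk x)
      (⋀[X.presheaf.stalk x]^t Ω[X.presheaf.stalk x⁄R])).mkQ.lTensor _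
      (comult h (KaehlerDifferential.map k R (X.presheaf.stalk x) (X.presheaf.stalk x)) m) := by
  have e := hom_tensor ((kaehler (f ≫ s) x k hk).exterior r) ((kaehler f x R hR).exterior t)
    (omegaStalk (f ≫ s) x k hk r) (omegaCheckStalk f x R hR t) (toOmega (f ≫ s) r)
    (toOmegaCheck f t)
  have e₁ : hom ((kaehler (f ≫ s) x k hk).exterior r) (omegaStalk (f ≫ s) x k hk r)
      (toOmega (f ≫ s) r) = LinearMap.id := LinearMap.ext fun m => hom_toOmega (f ≫ s) x k hk r m
  rw [e₁, hom_toOmegaCheck f x R hR] at e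
  refine (StalkData.hom_comp ((kaehler (f ≫ s) x k hk).exterior p)
    (((kaehler (f ≫ s) x k hk).exterior r).tensor ((kaehler f x R hR).exterior t))
    ((omegaStalk (f ≫ s) x k hk r).tensor (omegaCheckStalk f x R hR t)) (comultPresheaf f s h)
    (tensorPresheafMap (toOmega (f ≫ s) r) (toOmegaCheck f t)) m).trans ?_
  rw [hom_comultPresheaf f s x R k hk hR]
  exact LinearMap.congr_fun e _

lemma hom_comultOmega [IsLocallyNoetherian X] {r t p : ℕ} (h : r + t = p) (m) :
    hom (omegaStalk (f ≫ s) x k hk p)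
      (tensorStalk x (omegaStalk (f ≫ s) x k hk r) (omegaCheckStalk f x R hR t))
      (toPHom (comultOmega f s h)) m =
    (Submodule.torsion (X.presheaf.stalk x)
      (⋀[X.presheaf.stalk x]^t Ω[X.presheaf.stalk x⁄R])).mkQ.lTensor _
      (comult h (KaehlerDifferential.map k R (X.presheaf.stalk x) (X.presheaf.stalk x)) m) :=
  (sheafification_hom _ _ m).trans (hom_comultOmegaPresheaf f s x R k hk hR h m)

lemma hom_comultCheck [IsLocallyNoetherian X] {r t p : ℕ} (h : r + t = p) :
    hom (omegaCheckStalk (f ≫ s) x k hk p)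
      (tensorStalk x (omegaStalk (f ≫ s) x k hk r) (omegaCheckStalk f x R hR t)).modTor
      (toPHom (comultCheck f s h)) =
    comultModTor (KaehlerDifferential.map k R (X.presheaf.stalk x) (X.presheaf.stalk x)) h := by
  refine (hom_modTorsionMap _ _ _).trans ?_
  rw [comultModTor]
  congr 1
  exact LinearMap.ext fun m => hom_comultOmega f s x R k hk hR h m

end Stalk

end Maps
end TorsionFreeDiff


/-! ### Stalks of direct images and pullbacks -/

namespace TorsionFreeDiff
section Pullback
open Opposite ExteriorShuffle TensorProduct StalkData
variable {X Y S : Scheme.{u}}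

/-- Sections of a direct image. -/
def pushSec (f : X ⟶ Y) (F : X.Modules) (V : Y.Opens) :
    (toP F).obj (op (f ⁻¹ᵁ V)) ≃+ (toP ((Scheme.Modules.pushforward f).obj F)).obj (op V) :=
  AddEquiv.refl _

lemma pushSec_smul (f : X ⟶ Y) (F : X.Modules) (V : Y.Opens) (a : Γ(Y, V))
    (s : (toP F).obj (op (f ⁻¹ᵁ V))) :
    pushSec f F V ((f.app V a : Γ(X, f ⁻¹ᵁ V)) • s) = a • pushSec f F V s := rfl

/-- The preimage of an inclusion of open sets. -/
def preimageHom (f : X ⟶ Y) {V U : Y.Opens} (i : V ⟶ U) : f ⁻¹ᵁ V ⟶ f ⁻¹ᵁ U :=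
  (Opens.map f.base).map i

lemma pushSec_res (f : X ⟶ Y) (F : X.Modules) {V U : Y.Opens} (i : V ⟶ U)
    (s : (toP F).obj (op (f ⁻¹ᵁ U))) :
    res _ i (pushSec f F U s) = pushSec f F V (res _ (preimageHom f i) s) := rfl

/-- Morphisms from a presheaf to a sheaf factor through the associated sheaf. -/
def sheafifyDesc {P : PMod X} {F : X.Modules} (φ : P ⟶ toP F) : sheafify.obj P ⟶ F :=
  ((PresheafOfModules.sheafificationAdjunction (𝟙 X.ringCatSheaf.obj)).homEquiv P F).symm φ

lemma toSheafify_sheafifyDesc {P : PMod X} {F : X.Modules} (φ : P ⟶ toP F) :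
    toSheafify P ≫ toPHom (sheafifyDesc φ) = φ := by
  have h := ((PresheafOfModules.sheafificationAdjunction (𝟙 X.ringCatSheaf.obj)).homEquiv
    P F).apply_symm_apply φ
  exact ((PresheafOfModules.sheafificationAdjunction
    (𝟙 X.ringCatSheaf.obj)).homEquiv_unit P F _).symm.trans h

namespace StalkData

variable (f : X ⟶ Y) (x : X) {G : Y.Modules} {F : X.Modules} {N M : Type u}
  [AddCommGroup N] [Module (Y.presheaf.stalk (f x)) N] [AddCommGroup M]
  [Module (X.presheaf.stalk x) M] (dG : StalkData (toP G) (f x) N) (dF : StalkData (toP F) x M)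
  (φ : G ⟶ (Scheme.Modules.pushforward f).obj F)

/-- The germ at `x` of the image of a section on `Y`. -/
def pushGerm (V : Y.Opens) (hx : f x ∈ V) (s : (toP G).obj (op V)) : M :=
  dF.germ (f ⁻¹ᵁ V) hx ((pushSec f F V).symm (app (toPHom φ) V s))

lemma pushGerm_res {V U : Y.Opens} (i : V ⟶ U) (hx : f x ∈ V) (s : (toP G).obj (op U)) :
    pushGerm f x dF φ V hx (res _ i s) = pushGerm f x dF φ U (i.le hx) s := by
  rw [pushGerm, app_res, pushGerm, ← dF.germ_map (preimageHom f i) hx]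
  rfl

lemma homPush_aux : ∃ w : N → M, ∀ V hx s, w (dG.germ V hx s) = pushGerm f x dF φ V hx s := by
  choose U hx s hs using dG.exists_germ
  refine ⟨fun m => pushGerm f x dF φ _ (hx m) (s m), fun V hV t => ?_⟩
  obtain ⟨W, i, j, hW, h⟩ := dG.exists_map_eq _ hV (hs (dG.germ V hV t))
  change pushGerm f x dF φ _ _ _ = _
  rw [← pushGerm_res f x dF φ i hW, ← pushGerm_res f x dF φ j hW, h]

/-- The map on stalks induced by a morphism from a sheaf on `Y` to a direct image. -/
def homPush : N →ₛₗ[(f.stalkMap x).hom] M where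
  toFun := (homPush_aux f x dG dF φ).choose
  map_add' m n := by
    have h := (homPush_aux f x dG dF φ).choose_spec
    obtain ⟨U, hx, s, hs⟩ := dG.exists_germ_family ![m, n]
    have h0 : dG.germ U hx (s 0) = m := hs 0
    have h1 : dG.germ U hx (s 1) = n := hs 1
    rw [← h0, ← h1, ← map_add, h, h, h, pushGerm, map_add, map_add, map_add]
    rfl
  map_smul' a m := by
    have h := (homPush_aux f x dG dF φ).choose_spec
    obtain ⟨U, hx, a, s, -, rfl, hs, -⟩ := dG.exists_germ_smul dG a ![m] ![m]
    obtain rfl : dG.germ U hx (s 0) = m := hs 0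
    rw [← dG.germ_smul, h, h, pushGerm, map_smul]
    refine (dF.germ_smul (f ⁻¹ᵁ U) hx (f.app U a) _).trans ?_
    congr 1
    exact (Scheme.Hom.germ_stalkMap_apply f U x hx a).symm

lemma homPush_germ (V : Y.Opens) (hx : f x ∈ V) (s : (toP G).obj (op V)) :
    homPush f x dG dF φ (dG.germ V hx s) =
      dF.germ (f ⁻¹ᵁ V) hx ((pushSec f F V).symm (app (toPHom φ) V s)) :=
  (homPush_aux f x dG dF φ).choose_spec V hx s

lemma hom_homPush {F' : X.Modules} {M' : Type u} [AddCommGroup M'] [Module (X.presheaf.stalk x) M']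
    (dF' : StalkData (toP F') x M') (ψ : F ⟶ F') (n : N) :
    hom dF dF' (toPHom ψ) (homPush f x dG dF φ n) =
      homPush f x dG dF' (φ ≫ (Scheme.Modules.pushforward f).map ψ) n := by
  obtain ⟨V, hx, s, rfl⟩ := dG.exists_germ n
  rw [homPush_germ, homPush_germ]
  exact hom_germ dF dF' (toPHom ψ) (f ⁻¹ᵁ V) hx _

end StalkData

/-- The pullback functor and its unit: sections of `G` as sections of the direct image of the
pullback. -/
def pullbackUnit (f : X ⟶ Y) (G : Y.Modules) :
    G ⟶ (Scheme.Modules.pushforward f).obj ((Scheme.Modules.pullback f).obj G) :=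
  (Scheme.Modules.pullbackPushforwardAdjunction f).unit.app G

/-- A morphism from the pullback that kills all pulled back sections is zero. -/
lemma eq_zero_of_pullbackUnit (f : X ⟶ Y) {G : Y.Modules} {F : X.Modules}
    {ψ : (Scheme.Modules.pullback f).obj G ⟶ F}
    (h : pullbackUnit f G ≫ (Scheme.Modules.pushforward f).map ψ = 0) : ψ = 0 := by
  apply ((Scheme.Modules.pullbackPushforwardAdjunction f).homEquiv G F).injective
  rw [Adjunction.homEquiv_unit, Adjunction.homEquiv_unit, Functor.map_zero, Limits.comp_zero]
  exact h

lemma hom_ext_app {F G : X.Modules} {φ ψ : F ⟶ G} (h : ∀ U s, app (toPHom φ) U s =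
    app (toPHom ψ) U s) : φ = ψ := by
  refine Scheme.Modules.fullyFaithfulToPresheafOfModules.map_injective ?_
  refine PresheafOfModules.Hom.ext (funext fun U => ?_)
  refine ModuleCat.hom_ext (LinearMap.ext fun s => ?_)
  exact h U.unop s

/-- The subpresheaf of the pullback of `G` consisting of the sections whose germs lie in the
submodules generated by pulled back germs. -/
def pulledBackSub (f : X ⟶ Y) (G : Y.Modules) :
    PresheafOfModules.Submodule (toP ((Scheme.Modules.pullback f).obj G)) where
  obj U := (show Submodule Γ(X, U.unop) ((toP ((Scheme.Modules.pullback f).obj G)).obj (op U.unop))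
    from
    { carrier := {s | ∀ x (hx : x ∈ U.unop), (canonicalStalk _ x).germ U.unop hx s ∈
        Submodule.span (X.presheaf.stalk x) (Set.range
          (homPush f x (canonicalStalk _ _) (canonicalStalk _ x) (pullbackUnit f G)))}
      zero_mem' := fun x hx => by rw [map_zero]; exact zero_mem _
      add_mem' := fun ha hb x hx => by rw [map_add]; exact add_mem (ha x hx) (hb x hx)
      smul_mem' := fun a s hs x hx => by
        rw [germ_smul]; exact Submodule.smul_mem _ _ (hs x hx) })
  map {U V} i s hs x hx := by
    have := hs x (i.unop.le hx)
    rw [← (canonicalStalk (toP ((Scheme.Modules.pullback f).obj G)) x).germ_map i.unop hx] at this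
    exact this

lemma mem_pulledBackSub {f : X ⟶ Y} {G : Y.Modules} {U : X.Opens}
    {s : (toP ((Scheme.Modules.pullback f).obj G)).obj (op U)} :
    s ∈ (pulledBackSub f G).obj (op U) ↔ ∀ x (hx : x ∈ U), (canonicalStalk _ x).germ U hx s ∈
        Submodule.span (X.presheaf.stalk x) (Set.range
          (homPush f x (canonicalStalk _ _) (canonicalStalk _ x) (pullbackUnit f G))) := Iff.rfl

lemma exists_mem_pulledBackSub {f : X ⟶ Y} {G : Y.Modules} {x : X} {m}
    (hm : m ∈ Submodule.span (X.presheaf.stalk x) (Set.range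
          (homPush f x (canonicalStalk _ _) (canonicalStalk _ x) (pullbackUnit f G)))) :
    ∃ (U : X.Opens) (hx : x ∈ U) (s : (toP ((Scheme.Modules.pullback f).obj G)).obj (op U)),
      (canonicalStalk _ x).germ U hx s = m ∧ s ∈ (pulledBackSub f G).obj (op U) := by
  induction hm using Submodule.closure_induction with
  | zero => exact ⟨⊤, trivial, 0, map_zero _, zero_mem _⟩
  | smul_mem a m hm =>
    obtain ⟨n, rfl⟩ := hm
    obtain ⟨V, hV, t, rfl⟩ := (canonicalStalk (toP G) (f x)).exists_germ n
    obtain ⟨U, hU, a, rfl⟩ := X.presheaf.exists_germ_eq a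
    let F := (Scheme.Modules.pullback f).obj G
    let t' := (pushSec f F V).symm (app (toPHom (pullbackUnit f G)) V t)
    let i : U ⊓ f ⁻¹ᵁ V ⟶ f ⁻¹ᵁ V := homOfLE inf_le_right
    let j : U ⊓ f ⁻¹ᵁ V ⟶ U := homOfLE inf_le_left
    have hx : x ∈ U ⊓ f ⁻¹ᵁ V := ⟨hU, hV⟩
    refine ⟨U ⊓ f ⁻¹ᵁ V, hx, (X.presheaf.map j.op a : Γ(X, _)) • res (toP F) i t', ?_, ?_⟩
    · rw [germ_smul, germ_map, X.presheaf.germ_res_apply]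
      exact congrArg _ (homPush_germ f x _ _ _ V hV t).symm
    · rw [mem_pulledBackSub]
      intro y hy
      rw [germ_smul, germ_map]
      exact Submodule.smul_mem _ _ (Submodule.subset_span
        ⟨(canonicalStalk (toP G) (f y)).germ V hy.2 t, homPush_germ f y _ _ _ V hy.2 t⟩)
  | add a b _ _ ha hb =>
    obtain ⟨U, hU, s, rfl, hs⟩ := ha
    obtain ⟨V, hV, t, rfl, ht⟩ := hb
    have hx : x ∈ U ⊓ V := ⟨hU, hV⟩
    refine ⟨U ⊓ V, hx, res _ (homOfLE inf_le_left) s + res _ (homOfLE inf_le_right) t, ?_, ?_⟩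
    · rw [map_add, germ_map, germ_map]
    · rw [mem_pulledBackSub]
      intro y hy
      rw [map_add, germ_map, germ_map]
      exact add_mem (hs y hy.1) (ht y hy.2)

/-- The stalk of a pullback is generated by pulled back germs. -/
lemma span_range_homPush (f : X ⟶ Y) (G : Y.Modules) (x : X) :
    Submodule.span (X.presheaf.stalk x) (Set.range
      (homPush f x (canonicalStalk _ _) (canonicalStalk _ x) (pullbackUnit f G))) = ⊤ := by
  let F := (Scheme.Modules.pullback f).obj G
  let d := canonicalStalk (toP F) x
  let C : PMod X := Limits.cokernel (pulledBackSub f G).ι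
  have h := d.exists_hom_cokernel_π (pulledBackSub f G) _ (fun U hx s hs => hs x hx)
    (fun U hx s hs => by
      obtain ⟨V, hV, t, ht, htm⟩ := exists_mem_pulledBackSub hs
      obtain ⟨W, i, j, hW, e⟩ := d.exists_map_eq hx hV ht.symm
      refine ⟨W, i, hW, ?_⟩
      rw [e]
      exact (pulledBackSub f G).map_mem j.op htm)
  -- the quotient by the generated submodules is zero, as it kills all pulled back sections
  let π : F ⟶ sheafify.obj C := ⟨Limits.cokernel.π (pulledBackSub f G).ι ≫ toSheafify C⟩
  have hπ : π = 0 := by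
    refine eq_zero_of_pullbackUnit f (hom_ext_app fun V s => ?_)
    have hs : (pushSec f F V).symm (app (toPHom (pullbackUnit f G)) V s) ∈
        (pulledBackSub f G).obj (op (f ⁻¹ᵁ V)) := by
      rw [mem_pulledBackSub]
      intro y hy
      exact Submodule.subset_span ⟨(canonicalStalk (toP G) (f y)).germ V hy s,
        homPush_germ f y _ _ _ V hy s⟩
    have h0 : app (Limits.cokernel.π (pulledBackSub f G).ι) (f ⁻¹ᵁ V)
        ((pushSec f F V).symm (app (toPHom (pullbackUnit f G)) V s)) = 0 :=
      DFunLike.congr_fun (congrArg (fun a => app a (f ⁻¹ᵁ V))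
        (Limits.cokernel.condition (pulledBackSub f G).ι)) ⟨_, hs⟩
    exact (congrArg (app (toSheafify C) (f ⁻¹ᵁ V)) h0).trans (map_zero _)
  rw [← h.2, eq_top_iff]
  intro m _
  obtain ⟨U, hx, s, rfl⟩ := d.exists_germ m
  have h1 : app (toSheafify C) U (app (Limits.cokernel.π (pulledBackSub f G).ι) U s) = 0 :=
    DFunLike.congr_fun (congrArg (fun a => app (toPHom a) U) hπ) s
  obtain ⟨V, i, hV, h2⟩ := exists_res_eq_zero_of_toSheafify C h1 hx
  rw [LinearMap.mem_ker, hom_germ]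
  exact ((canonicalStalk C x).germ_map i hV _).symm.trans ((congrArg _ h2).trans (map_zero _))

end Pullback
end TorsionFreeDiff

namespace ExteriorShuffle

/-! ### Splitting differentials along derivations dual to coordinates -/

section Adapted

open TensorProduct KaehlerDifferential

/-- There are elements `y₁, …, yₘ` of `R` whose differentials generate `Ω[R⁄k]`, and `k`-derivations
of `B` that are dual to them. -/
def HasDualDerivations (k R B : Type*) [CommRing k] [CommRing R] [CommRing B] [Algebra k R]
    [Algebra R B] [Algebra k B] : Prop :=
  ∃ (m : ℕ) (y : Fin m → R) (δ : Fin m → Derivation k B B),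
    (∀ i j, δ i (algebraMap R B (y j)) = if i = j then 1 else 0) ∧
    Submodule.span R (Set.range fun i => D k R (y i)) = ⊤

variable {k R B : Type u} [CommRing k] [CommRing R] [CommRing B] [Algebra k R]
  [Algebra R B] [Algebra k B] [IsScalarTower k R B] {m : ℕ} (y : Fin m → R)
  (δ : Fin m → Derivation k B B)

/-- The map `Bᵐ → Ω[B⁄k]` given by the differentials of the coordinates. -/
def coordMap : (Fin m → B) →ₗ[B] Ω[B⁄k] :=
  Fintype.linearCombination B fun j => D k B (algebraMap R B (y j))

/-- The map `Ω[B⁄k] → Bᵐ` given by a family of derivations. -/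
def dualMap : Ω[B⁄k] →ₗ[B] (Fin m → B) :=
  LinearMap.pi fun i => (δ i).liftKaehlerDifferential

omit [Algebra k R] [IsScalarTower k R B] in
lemma coordMap_single (j : Fin m) : coordMap (k := k) (B := B) y (Pi.single j 1) =
    D k B (algebraMap R B (y j)) := by
  rw [coordMap, Fintype.linearCombination_apply_single, one_smul]

variable {y δ} (hδ : ∀ i j, δ i (algebraMap R B (y j)) = if i = j then 1 else 0)
  (hy : Submodule.span R (Set.range fun i => D k R (y i)) = ⊤)
include hδ

omit [Algebra k R] [IsScalarTower k R B] in
lemma dualMap_comp_coordMap : dualMap δ ∘ₗ coordMap y = LinearMap.id := by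
  refine LinearMap.pi_ext' fun j => LinearMap.ext_ring ?_
  ext i
  simp only [LinearMap.comp_apply, LinearMap.single_apply, coordMap_single, dualMap,
    LinearMap.pi_apply, Derivation.liftKaehlerDifferential_comp_D, hδ, LinearMap.id_apply,
    Pi.single_apply]

omit hδ in
lemma map_coordMap (x : Fin m → B) : KaehlerDifferential.map k R B B (coordMap y x) = 0 := by
  rw [coordMap, Fintype.linearCombination_apply, map_sum]
  refine Finset.sum_eq_zero fun i _ => ?_
  rw [map_smul, KaehlerDifferential.map_D, Algebra.algebraMap_self, RingHom.id_apply,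
    Derivation.map_algebraMap, smul_zero]

include hy in
lemma coordMap_dualMap_D (r : R) : coordMap y (dualMap δ (D k B (algebraMap R B r))) =
    D k B (algebraMap R B r) := by
  have hmem : D k B (algebraMap R B r) ∈ LinearMap.range (coordMap (k := k) (B := B) y) := by
    have h : D k R r ∈ Submodule.span R (Set.range fun i => D k R (y i)) := by rw [hy]; trivial
    rw [← KaehlerDifferential.map_D k k R B]
    generalize D k R r = z at h
    induction h using Submodule.span_induction with
    | mem z hz =>
      obtain ⟨i, rfl⟩ := hz
      exact ⟨Pi.single i 1, by rw [coordMap_single, KaehlerDifferential.map_D]⟩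
    | zero => rw [map_zero]; exact zero_mem _
    | add a b _ _ ha hb => rw [map_add]; exact add_mem ha hb
    | smul a b _ hb =>
      rw [map_smul, ← algebraMap_smul B a]
      exact Submodule.smul_mem _ _ hb
  obtain ⟨l, hl⟩ := hmem
  rw [← hl]
  exact congrArg _ (LinearMap.congr_fun (dualMap_comp_coordMap hδ) l)

/-- The splitting `Ω[B⁄R] → Ω[B⁄k]` whose image is killed by the derivations `δ i`. -/
def relSplitting : Ω[B⁄R] →ₗ[B] Ω[B⁄k] :=
  Derivation.liftKaehlerDifferential (Derivation.mk'
    { toFun := fun b => D k B b - coordMap y (dualMap δ (D k B b))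
      map_add' := fun a b => by simp only [map_add]; abel
      map_smul' := fun r b => by
        rw [Algebra.smul_def, Derivation.leibniz, RingHom.id_apply]
        simp only [map_add, map_smul]
        rw [coordMap_dualMap_D hδ hy, algebraMap_smul, algebraMap_smul, smul_sub]
        abel }
    fun a b => by
      simp only [LinearMap.coe_mk, AddHom.coe_mk, Derivation.leibniz, map_add, map_smul, smul_sub]
      abel)

lemma relSplitting_D (b : B) : relSplitting hδ hy (D R B b) =
    D k B b - coordMap y (dualMap δ (D k B b)) :=
  Derivation.liftKaehlerDifferential_comp_D _ _

lemma map_relSplitting (x : Ω[B⁄R]) :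
    KaehlerDifferential.map k R B B (relSplitting hδ hy x) = x := by
  have : (KaehlerDifferential.map k R B B).restrictScalars B ∘ₗ relSplitting hδ hy =
      LinearMap.id := by
    refine Derivation.liftKaehlerDifferential_unique _ _ (Derivation.ext fun b => ?_)
    change KaehlerDifferential.map k R B B (relSplitting hδ hy (D R B b)) = D R B b
    rw [relSplitting_D, map_sub, map_coordMap, sub_zero, KaehlerDifferential.map_D]
    rfl
  exact LinearMap.congr_fun this x

lemma coordMap_add_relSplitting (x : Ω[B⁄k]) :
    coordMap y (dualMap δ x) + relSplitting hδ hy (KaehlerDifferential.map k R B B x) = x := by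
  have : coordMap y ∘ₗ dualMap δ + relSplitting hδ hy ∘ₗ
      (KaehlerDifferential.map k R B B).restrictScalars B = LinearMap.id := by
    refine Derivation.liftKaehlerDifferential_unique _ _ (Derivation.ext fun b => ?_)
    change coordMap y (dualMap δ (D k B b)) + relSplitting hδ hy
      (KaehlerDifferential.map k R B B (D k B b)) = D k B b
    rw [KaehlerDifferential.map_D, Algebra.algebraMap_self, RingHom.id_apply, relSplitting_D]
    abel
  exact LinearMap.congr_fun this x

section Generated

variable {P : Type u} [AddCommGroup P] [Module B P] {r : ℕ}
  {w : ⋀[R]^r Ω[R⁄k] →ₛₗ[algebraMap R B] P}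
  (hw : Submodule.span B (Set.range w) = ⊤) {η : P →ₗ[B] ⋀[B]^r Ω[B⁄k]}
  (hη : ∀ a : Fin r → R, η (w (exteriorPower.ιMulti R r fun i => D k R (a i))) =
    exteriorPower.ιMulti B r fun i => D k B (algebraMap R B (a i)))

variable (y w) in
/-- The map to `P` from the free module on the wedge products of the coordinates. -/
def freeCover : ⋀[B]^r (Fin m → B) →ₗ[B] P :=
  ((Pi.basisFun B (Fin m)).exteriorPower r).constr B fun s =>
    w (exteriorPower.ιMulti_family R r (fun i => D k R (y i)) s)

omit hδ [Algebra k B] [IsScalarTower k R B] in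
include hy hw in
lemma freeCover_surjective : Function.Surjective (freeCover y w) := by
  rw [← LinearMap.range_eq_top, eq_top_iff, ← hw, Submodule.span_le]
  rintro _ ⟨z, rfl⟩
  have hz : z ∈ Submodule.span R (Set.range
      (exteriorPower.ιMulti_family R r (fun i => D k R (y i)))) := by
    rw [exteriorPower.ιMulti_family_span_of_span R hy]; trivial
  induction hz using Submodule.span_induction with
  | mem z hz =>
    obtain ⟨s, rfl⟩ := hz
    exact ⟨(Pi.basisFun B (Fin m)).exteriorPower r s, Module.Basis.constr_basis _ _ _ _⟩
  | zero => rw [map_zero]; exact zero_mem _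
  | add a b _ _ ha hb => rw [map_add]; exact add_mem ha hb
  | smul a b _ hb =>
    rw [LinearMap.map_smulₛₗ]
    exact Submodule.smul_mem _ _ hb

omit hδ [IsScalarTower k R B] in
include hη in
lemma comp_freeCover : η ∘ₗ freeCover y w = exteriorPower.map r (coordMap y) := by
  refine ((Pi.basisFun B (Fin m)).exteriorPower r).ext fun s => ?_
  rw [LinearMap.comp_apply, freeCover, Module.Basis.constr_basis, exteriorPower.basis_apply,
    exteriorPower.map_apply_ιMulti_family]
  refine (hη _).trans ?_
  congr 1
  ext i
  simp only [Function.comp_apply, Pi.basisFun_apply]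
  exact (coordMap_single y _).symm

omit [Algebra k R] [IsScalarTower k R B] in
lemma map_dualMap_map_coordMap (z : ⋀[B]^r (Fin m → B)) :
    exteriorPower.map r (dualMap δ) (exteriorPower.map r (coordMap y) z) = z := by
  rw [← LinearMap.comp_apply, ← exteriorPower.map_comp, dualMap_comp_coordMap hδ,
    exteriorPower.map_id, LinearMap.id_apply]

omit [IsScalarTower k R B] in
include hy hw hη in
/-- If `P` is generated by `⋀ʳ Ω[R⁄k]` and maps to `⋀ʳ Ω[B⁄k]`, then it is flat, and is a direct
summand of `⋀ʳ Ω[B⁄k]`. -/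
lemma exists_retraction : Module.Flat B P ∧ ∃ θ : ⋀[B]^r Ω[B⁄k] →ₗ[B] P,
    (∀ x, θ (η x) = x) ∧ ∀ x, η (θ x) = exteriorPower.map r (coordMap y ∘ₗ dualMap δ) x := by
  have hcomp : ∀ z, η (freeCover y w z) = exteriorPower.map r (coordMap y) z :=
    LinearMap.congr_fun (comp_freeCover hη)
  have hinj : Function.Injective (freeCover y w) := fun a b hab => by
    have h := congrArg (exteriorPower.map r (dualMap δ)) (congrArg η hab)
    rwa [hcomp, hcomp, map_dualMap_map_coordMap hδ, map_dualMap_map_coordMap hδ] at h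
  have hsurj := freeCover_surjective (B := B) hy hw
  have : Module.Free B (⋀[B]^r (Fin m → B)) :=
    Module.Free.of_basis ((Pi.basisFun B (Fin m)).exteriorPower r)
  refine ⟨Module.Flat.of_linearEquiv (LinearEquiv.ofBijective _ ⟨hinj, hsurj⟩).symm,
    freeCover y w ∘ₗ exteriorPower.map r (dualMap δ), fun x => ?_, fun x => ?_⟩
  · obtain ⟨z, rfl⟩ := hsurj x
    rw [hcomp, LinearMap.comp_apply, map_dualMap_map_coordMap hδ]
  · rw [LinearMap.comp_apply, hcomp, ← LinearMap.comp_apply, ← exteriorPower.map_comp]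

end Generated

end Adapted

end ExteriorShuffle

namespace TorsionFreeDiff

/-! ### Pulling back differential forms -/

section PullbackForms
open Opposite ExteriorShuffle TensorProduct StalkData
variable {X Y S : Scheme.{u}} (f : X ⟶ Y) (s : Y ⟶ S)

lemma dSec_app_res {V : Y.Opens} {W : S.Opens} (h : V ≤ s ⁻¹ᵁ W) (r : Γ(S, W)) :
    dSec (f ≫ s) (f ⁻¹ᵁ V) (f.app V (Y.presheaf.map (homOfLE h).op (s.app W r))) = 0 := by
  have e : f.app V (Y.presheaf.map (homOfLE h).op (s.app W r)) =
      X.presheaf.map (homOfLE (show f ⁻¹ᵁ V ≤ (f ≫ s) ⁻¹ᵁ W from fun x hx => h hx)).op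
        ((f ≫ s).app W r) := by
    rw [Scheme.Hom.comp_app]
    exact ConcreteCategory.congr_hom (f.naturality (homOfLE h).op) (s.app W r)
  rw [e]
  exact dSec_res_app (f ≫ s) _ r

/-- The derivation `a ↦ d(f^* a)`. -/
def pullDerivation (V : Y.Opens) :
    letI : Module Γ(Y, V) ((kaehlerP (f ≫ s)).obj (op (f ⁻¹ᵁ V))) :=
      Module.compHom (R := Γ(X, f ⁻¹ᵁ V)) _ (f.app V).hom
    Derivation ℤ Γ(Y, V) ((kaehlerP (f ≫ s)).obj (op (f ⁻¹ᵁ V))) :=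
  letI : Module Γ(Y, V) ((kaehlerP (f ≫ s)).obj (op (f ⁻¹ᵁ V))) :=
    Module.compHom (R := Γ(X, f ⁻¹ᵁ V)) _ (f.app V).hom
  Derivation.mk' (AddMonoidHom.toIntLinearMap (AddMonoidHom.mk'
    (fun a => dSec (f ≫ s) (f ⁻¹ᵁ V) (f.app V a))
    (fun a b => by rw [map_add, map_add])))
    (fun a b => by
      change dSec (f ≫ s) (f ⁻¹ᵁ V) (f.app V (a * b)) =
        (f.app V a : Γ(X, f ⁻¹ᵁ V)) • dSec (f ≫ s) (f ⁻¹ᵁ V) (f.app V b) +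
        (f.app V b : Γ(X, f ⁻¹ᵁ V)) • dSec (f ≫ s) (f ⁻¹ᵁ V) (f.app V a)
      rw [map_mul, Derivation.leibniz])

/-- The pull-back of differentials, on sections. -/
def pullKaehlerSec (V : Y.Opens) :
    (kaehlerP s).obj (op V) →ₛₗ[(f.app V).hom] (kaehlerP (f ≫ s)).obj (op (f ⁻¹ᵁ V)) :=
  letI : Module Γ(Y, V) ((kaehlerP (f ≫ s)).obj (op (f ⁻¹ᵁ V))) :=
    Module.compHom (R := Γ(X, f ⁻¹ᵁ V)) _ (f.app V).hom
  letI l := kaehlerLift s V (N := (kaehlerP (f ≫ s)).obj (op (f ⁻¹ᵁ V))) (pullDerivation f s V)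
    (fun _ h r => dSec_app_res f s h r)
  { toFun := l
    map_add' := map_add l
    map_smul' := fun a m => map_smul l a m }

lemma pullKaehlerSec_dSec (V : Y.Opens) (a : Γ(Y, V)) :
    pullKaehlerSec f s V (dSec s V a) = dSec (f ≫ s) (f ⁻¹ᵁ V) (f.app V a) :=
  letI : Module Γ(Y, V) ((kaehlerP (f ≫ s)).obj (op (f ⁻¹ᵁ V))) :=
    Module.compHom (R := Γ(X, f ⁻¹ᵁ V)) _ (f.app V).hom
  kaehlerLift_dSec s V (N := (kaehlerP (f ≫ s)).obj (op (f ⁻¹ᵁ V))) (pullDerivation f s V)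
    (fun _ h r => dSec_app_res f s h r) a

lemma pullKaehlerSec_res {V U : Y.Opens} (i : V ⟶ U) (z : (kaehlerP s).obj (op U)) :
    pullKaehlerSec f s V (res _ i z) = res _ (preimageHom f i) (pullKaehlerSec f s U z) := by
  induction z using kaehler_induction with
  | zero => simp only [map_zero]
  | smul a b =>
    have e (a : Γ(Y, U)) : f.app V (Y.presheaf.map i.op a) =
        X.presheaf.map (preimageHom f i).op (f.app U a) :=
      ConcreteCategory.congr_hom (f.naturality i.op) a
    rw [res_smul, LinearMap.map_smulₛₗ, LinearMap.map_smulₛₗ, res_smul, res_dSec,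
      pullKaehlerSec_dSec, pullKaehlerSec_dSec, res_dSec]
    exact congrArg₂ (fun (a b : Γ(X, f ⁻¹ᵁ V)) => a • dSec (f ≫ s) (f ⁻¹ᵁ V) b) (e a) (e b)
  | add a b ha hb => simp only [map_add, ha, hb]

/-- The pull-back of wedge products of differentials, on sections. -/
def pullWedgeSec (r : ℕ) (V : Y.Opens) :
    (exteriorPower (R := Y.presheaf) (kaehlerP s) r).obj (op V) →ₛₗ[(f.app V).hom]
      (exteriorPower (R := X.presheaf) (kaehlerP (f ≫ s)) r).obj (op (f ⁻¹ᵁ V)) where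
  toFun z := exteriorSections _ r (f ⁻¹ᵁ V)
    (exteriorMapₛₗ (pullKaehlerSec f s V) r ((exteriorSections _ r V).symm z))
  map_add' a b := by simp only [map_add]
  map_smul' a z := (exteriorMapₛₗ (pullKaehlerSec f s V) r).map_smulₛₗ a
    ((exteriorSections _ r V).symm z)

lemma pullWedgeSec_ιMulti (r : ℕ) (V : Y.Opens) (a : Fin r → (kaehlerP s).obj (op V)) :
    pullWedgeSec f s r V (exteriorSections _ r V (_root_.exteriorPower.ιMulti Γ(Y, V) r a)) =
      exteriorSections _ r (f ⁻¹ᵁ V)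
        (_root_.exteriorPower.ιMulti Γ(X, f ⁻¹ᵁ V) r fun i => pullKaehlerSec f s V (a i)) :=
  exteriorMapₛₗ_ιMulti (pullKaehlerSec f s V) r a

lemma pullWedgeSec_res (r : ℕ) {V U : Y.Opens} (i : V ⟶ U)
    (z : (exteriorPower (R := Y.presheaf) (kaehlerP s) r).obj (op U)) :
    pullWedgeSec f s r V (res _ i z) = res _ (preimageHom f i) (pullWedgeSec f s r U z) := by
  induction z using exterior_induction with
  | zero => simp only [map_zero]
  | smul a m =>
    have e : f.app V (Y.presheaf.map i.op a) =
        X.presheaf.map (preimageHom f i).op (f.app U a) :=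
      ConcreteCategory.congr_hom (f.naturality i.op) a
    have h : pullWedgeSec f s r V (res _ i
        (exteriorSections _ r U (_root_.exteriorPower.ιMulti Γ(Y, U) r m))) =
        res _ (preimageHom f i) (pullWedgeSec f s r U
          (exteriorSections _ r U (_root_.exteriorPower.ιMulti Γ(Y, U) r m))) := by
      rw [res_exteriorSections, pullWedgeSec_ιMulti, pullWedgeSec_ιMulti, res_exteriorSections]
      simp only [pullKaehlerSec_res]
    rw [map_smul, res_smul, LinearMap.map_smulₛₗ, LinearMap.map_smulₛₗ, res_smul, h]
    exact congrArg (fun a : Γ(X, f ⁻¹ᵁ V) => a • res _ (preimageHom f i) (pullWedgeSec f s r U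
          (exteriorSections _ r U (_root_.exteriorPower.ιMulti Γ(Y, U) r m)))) e
  | add a b ha hb => simp only [map_add, ha, hb]

/-- The pull-back of differential forms, on sections. -/
def pullFormSec (r : ℕ) (V : Y.Opens) :
    (exteriorPower (R := Y.presheaf) (kaehlerP s) r).obj (op V) →ₗ[Γ(Y, V)]
      (toP ((Scheme.Modules.pushforward f).obj (Omega (f ≫ s) r))).obj (op V) where
  toFun z := pushSec f (Omega (f ≫ s) r) V
    (app (toOmega (f ≫ s) r) (f ⁻¹ᵁ V) (pullWedgeSec f s r V z))
  map_add' a b := by simp only [map_add]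
  map_smul' a z := by
    rw [LinearMap.map_smulₛₗ]
    exact (congrArg (pushSec f (Omega (f ≫ s) r) V)
      ((app (toOmega (f ≫ s) r) (f ⁻¹ᵁ V)).map_smul (f.app V a) (pullWedgeSec f s r V z))).trans
      (pushSec_smul f _ V a _)

lemma pullFormSec_apply (r : ℕ) (V : Y.Opens)
    (z : (exteriorPower (R := Y.presheaf) (kaehlerP s) r).obj (op V)) :
    pullFormSec f s r V z = pushSec f (Omega (f ≫ s) r) V
      (app (toOmega (f ≫ s) r) (f ⁻¹ᵁ V) (pullWedgeSec f s r V z)) := rfl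

lemma pullFormSec_res (r : ℕ) {V U : Y.Opens} (i : V ⟶ U)
    (z : (exteriorPower (R := Y.presheaf) (kaehlerP s) r).obj (op U)) :
    pullFormSec f s r V (res _ i z) = res _ i (pullFormSec f s r U z) := by
  rw [pullFormSec_apply, pullFormSec_apply, pushSec_res, pullWedgeSec_res, app_res]

/-- The pull-back of differential forms, on presheaves. -/
def pullFormPresheaf (r : ℕ) : exteriorPower (R := Y.presheaf) (kaehlerP s) r ⟶
    toP ((Scheme.Modules.pushforward f).obj (Omega (f ≫ s) r)) :=
  homMk (pullFormSec f s r) (pullFormSec_res f s r)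

/-- The pull-back of differential forms. -/
def pullForm (r : ℕ) : Omega s r ⟶ (Scheme.Modules.pushforward f).obj (Omega (f ≫ s) r) :=
  sheafifyDesc (pullFormPresheaf f s r)

lemma app_pullForm (r : ℕ) (V : Y.Opens)
    (z : (exteriorPower (R := Y.presheaf) (kaehlerP s) r).obj (op V)) :
    app (toPHom (pullForm f s r)) V (app (toOmega s r) V z) = pullFormSec f s r V z :=
  DFunLike.congr_fun
    (congrArg (fun φ => app φ V) (toSheafify_sheafifyDesc (pullFormPresheaf f s r))) z

/-- The morphism `f^* Ωʳ_{Y/S} ⟶ Ωʳ_{X/S}`. -/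
def pullbackForm (r : ℕ) : (Scheme.Modules.pullback f).obj (Omega s r) ⟶ Omega (f ≫ s) r :=
  ((Scheme.Modules.pullbackPushforwardAdjunction f).homEquiv _ _).symm (pullForm f s r)

lemma pullbackUnit_pullbackForm (r : ℕ) : pullbackUnit f (Omega s r) ≫
    (Scheme.Modules.pushforward f).map (pullbackForm f s r) = pullForm f s r :=
  (((Scheme.Modules.pullbackPushforwardAdjunction f).homEquiv_unit _ _ _).symm).trans
    (Equiv.apply_symm_apply _ _)

section Stalk

variable (x : X) (k : Type u) [CommRing k] [Algebra k (X.presheaf.stalk x)]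
  [Algebra k (Y.presheaf.stalk (f x))]
  (hk : (algebraMap k (X.presheaf.stalk x)).range = ((f ≫ s).stalkMap x).hom.range)
  (hk' : (algebraMap k (Y.presheaf.stalk (f x))).range = (s.stalkMap (f x)).hom.range)

/-- On stalks, pulling back differential forms takes `da₁ ∧ ⋯ ∧ daᵣ` to the wedge product of the
differentials of the pulled back germs. -/
lemma homPush_pullForm (r : ℕ) (a : Fin r → Y.presheaf.stalk (f x)) :
    homPush f x (omegaStalk s (f x) k hk' r) (omegaStalk (f ≫ s) x k hk r) (pullForm f s r)
      (_root_.exteriorPower.ιMulti (Y.presheaf.stalk (f x)) r fun i =>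
        KaehlerDifferential.D k _ (a i)) =
    _root_.exteriorPower.ιMulti (X.presheaf.stalk x) r fun i =>
      KaehlerDifferential.D k (X.presheaf.stalk x) ((f.stalkMap x).hom (a i)) := by
  obtain ⟨V, hV, a, rfl⟩ : ∃ (V : Y.Opens) (hV : f x ∈ V) (a' : Fin r → Γ(Y, V)),
      a = fun i => Y.presheaf.germ V (f x) hV (a' i) := by
    choose W hW b hb using fun i => Y.presheaf.exists_germ_eq (a i)
    refine ⟨Finset.univ.inf W, ?_, fun i => Y.presheaf.map
      (homOfLE (Finset.inf_le (Finset.mem_univ i))).op (b i), funext fun i => ?_⟩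
    · rw [← SetLike.mem_coe, Opens.coe_finset_inf]
      simpa using hW
    · rw [Y.presheaf.germ_res_apply, hb]
  have h₁ : (omegaStalk s (f x) k hk' r).germ V hV (app (toOmega s r) V (exteriorSections _ r V
      (_root_.exteriorPower.ιMulti Γ(Y, V) r fun i => dSec s V (a i)))) =
      _root_.exteriorPower.ιMulti (Y.presheaf.stalk (f x)) r fun i =>
        KaehlerDifferential.D k _ (Y.presheaf.germ V (f x) hV (a i)) := by
    refine (sheafification_germ_toSheafify ((kaehler s (f x) k hk').exterior r) V hV _).trans ?_
    refine (exterior_germ_ιMulti (kaehler s (f x) k hk') r V hV _).trans ?_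
    simp only [kaehler_germ_dSec]
  have h₂ : (omegaStalk (f ≫ s) x k hk r).germ (f ⁻¹ᵁ V) hV (app (toOmega (f ≫ s) r) (f ⁻¹ᵁ V)
      (exteriorSections _ r (f ⁻¹ᵁ V) (_root_.exteriorPower.ιMulti Γ(X, f ⁻¹ᵁ V) r fun i =>
        dSec (f ≫ s) (f ⁻¹ᵁ V) (f.app V (a i))))) =
      _root_.exteriorPower.ιMulti (X.presheaf.stalk x) r fun i =>
        KaehlerDifferential.D k _ (X.presheaf.germ (f ⁻¹ᵁ V) x hV (f.app V (a i))) := by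
    refine (sheafification_germ_toSheafify ((kaehler (f ≫ s) x k hk).exterior r) _ hV _).trans ?_
    refine (exterior_germ_ιMulti (kaehler (f ≫ s) x k hk) r _ hV _).trans ?_
    exact congrArg _ (funext fun i => kaehler_germ_dSec (f ≫ s) x k hk (f ⁻¹ᵁ V) hV _)
  rw [← h₁]
  refine (homPush_germ f x _ _ (pullForm f s r) V hV _).trans ?_
  rw [app_pullForm, pullFormSec_apply, pullWedgeSec_ιMulti, AddEquiv.symm_apply_apply]
  simp only [pullKaehlerSec_dSec]
  rw [h₂]
  congr 1
  ext i
  exact congrArg _ (Scheme.Hom.germ_stalkMap_apply f V x hV (a i)).symm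

lemma span_range_homPush_of_stalk {G : Y.Modules} {N M : Type u} [AddCommGroup N]
    [Module (Y.presheaf.stalk (f x)) N] [AddCommGroup M] [Module (X.presheaf.stalk x) M]
    (dG : StalkData (toP G) (f x) N)
    (dF : StalkData (toP ((Scheme.Modules.pullback f).obj G)) x M) :
    Submodule.span (X.presheaf.stalk x) (Set.range (homPush f x dG dF (pullbackUnit f G))) = ⊤ := by
  have hsurj (V : Y.Opens) (hV : f x ∈ V) (t : (toP G).obj (op V)) :
      hom (canonicalStalk _ x) dF (𝟙 _) (homPush f x (canonicalStalk _ _) (canonicalStalk _ x)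
        (pullbackUnit f G) ((canonicalStalk _ _).germ V hV t)) =
      homPush f x dG dF (pullbackUnit f G) (dG.germ V hV t) := by
    rw [homPush_germ, homPush_germ]
    exact hom_germ _ dF (𝟙 _) (f ⁻¹ᵁ V) hV _
  rw [eq_top_iff]
  intro m _
  obtain ⟨U, hx, t, rfl⟩ := dF.exists_germ m
  have h1 : hom (canonicalStalk _ x) dF (𝟙 _) ((canonicalStalk _ x).germ U hx t) =
      dF.germ U hx t := hom_germ _ dF (𝟙 _) U hx t
  rw [← h1]
  have h2 : (canonicalStalk _ x).germ U hx t ∈ Submodule.span (X.presheaf.stalk x) (Set.range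
      (homPush f x (canonicalStalk _ _) (canonicalStalk _ x) (pullbackUnit f G))) := by
    rw [span_range_homPush]; trivial
  generalize (canonicalStalk _ x).germ U hx t = z at h2
  induction h2 using Submodule.span_induction with
  | mem z hz =>
    obtain ⟨n, rfl⟩ := hz
    obtain ⟨V, hV, t, rfl⟩ := (canonicalStalk (toP G) (f x)).exists_germ n
    rw [hsurj]
    exact Submodule.subset_span ⟨_, rfl⟩
  | zero => rw [map_zero]; exact zero_mem _
  | add a b _ _ ha hb => rw [map_add]; exact add_mem ha hb
  | smul a b _ hb => rw [map_smul]; exact Submodule.smul_mem _ _ hb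

end Stalk

end PullbackForms
end TorsionFreeDiff

namespace TorsionFreeDiff

/-! ### Checking exactness on stalks -/

section Exactness
open Opposite ExteriorShuffle TensorProduct StalkData
variable {X : Scheme.{u}}

lemma eq_zero_of_res_eq_zero (F : X.Modules) {U : X.Opens} {s : (toP F).obj (op U)}
    (h : ∀ x ∈ U, ∃ (V : X.Opens) (i : V ⟶ U), x ∈ V ∧ res (toP F) i s = 0) : s = 0 := by
  choose V i hV hs using fun x : U => h x x.2
  refine TopCat.Sheaf.eq_of_locally_eq' (X := X.carrier) ⟨F.val.presheaf, F.isSheaf⟩ V U i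
    (fun x hx => Opens.mem_iSup.2 ⟨⟨x, hx⟩, hV ⟨x, hx⟩⟩) s 0 fun x => ?_
  exact (hs x).trans (map_zero _).symm

lemma eq_zero_of_germ {F : X.Modules} {M : X → Type u} [∀ x, AddCommGroup (M x)]
    [∀ x, Module (X.presheaf.stalk x) (M x)] (d : ∀ x, StalkData (toP F) x (M x)) {U : X.Opens}
    {s : (toP F).obj (op U)} (h : ∀ x (hx : x ∈ U), (d x).germ U hx s = 0) : s = 0 := by
  refine eq_zero_of_res_eq_zero F fun x hx => ?_
  obtain ⟨V, i, hV, h⟩ := (d x).exists_map_eq_zero U hx s (h x hx)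
  exact ⟨V, i, hV, h⟩

/-- The map induced by a morphism on the (canonical) stalks at `x`. -/
def stalkHom {F G : X.Modules} (φ : F ⟶ G) (x : X) :
    presheafStalk (toP F) x →ₗ[X.presheaf.stalk x] presheafStalk (toP G) x :=
  hom (canonicalStalk _ x) (canonicalStalk _ x) (toPHom φ)

lemma stalkHom_germ {F G : X.Modules} (φ : F ⟶ G) (x : X) (U : X.Opens) (hx : x ∈ U)
    (s : (toP F).obj (op U)) : stalkHom φ x ((canonicalStalk _ x).germ U hx s) =
      (canonicalStalk _ x).germ U hx (app (toPHom φ) U s) := hom_germ _ _ _ U hx s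

lemma stalkHom_comp {F G H : X.Modules} (φ : F ⟶ G) (ψ : G ⟶ H) (x : X) (m) :
    stalkHom (φ ≫ ψ) x m = stalkHom ψ x (stalkHom φ x m) :=
  StalkData.hom_comp _ _ _ (toPHom φ) (toPHom ψ) m

lemma stalkHom_zero {F G : X.Modules} (x : X) (m) : stalkHom (0 : F ⟶ G) x m = 0 := by
  obtain ⟨U, hx, s, rfl⟩ := (canonicalStalk _ x).exists_germ m
  rw [stalkHom_germ]
  exact map_zero _

lemma stalkHom_id {F : X.Modules} (x : X) (m) : stalkHom (𝟙 F) x m = m := by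
  obtain ⟨U, hx, s, rfl⟩ := (canonicalStalk _ x).exists_germ m
  rw [stalkHom_germ]
  rfl

lemma eq_zero_of_stalkHom {F G : X.Modules} {φ : F ⟶ G} (h : ∀ x m, stalkHom φ x m = 0) :
    φ = 0 := by
  refine hom_ext_app fun U s => ?_
  refine (eq_zero_of_germ (canonicalStalk (toP G)) fun x hx => ?_).trans rfl
  rw [← stalkHom_germ, h]

lemma mono_of_stalkHom {F G : X.Modules} {φ : F ⟶ G}
    (h : ∀ x, Function.Injective (stalkHom φ x)) : Mono φ := by
  refine Preadditive.mono_of_cancel_zero _ fun ψ hψ => eq_zero_of_stalkHom fun x m => ?_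
  refine h x ?_
  rw [← stalkHom_comp, hψ, stalkHom_zero, map_zero]

lemma epi_of_stalkHom {F G : X.Modules} {φ : F ⟶ G}
    (h : ∀ x, Function.Surjective (stalkHom φ x)) : Epi φ := by
  refine Preadditive.epi_of_cancel_zero _ fun ψ hψ => eq_zero_of_stalkHom fun x m => ?_
  obtain ⟨m, rfl⟩ := h x m
  rw [← stalkHom_comp, hψ, stalkHom_zero]

/-- The subpresheaf of sections that are killed by a morphism. -/
def kerSub {F G : X.Modules} (φ : F ⟶ G) : PresheafOfModules.Submodule (toP F) where
  obj U := (show Submodule Γ(X, U.unop) ((toP F).obj (op U.unop)) from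
    LinearMap.ker (app (toPHom φ) U.unop))
  map {U V} i s hs := by
    have hs : app (toPHom φ) U.unop s = 0 := hs
    change app (toPHom φ) V.unop (res (toP F) i.unop s) = 0
    rw [app_res, hs, map_zero]

/-- Taking stalks commutes with kernels: a germ that is killed by `φ` comes from `ker φ`. -/
lemma exists_stalkHom_kernel {F G : X.Modules} (φ : F ⟶ G) {x : X} {m}
    (hm : stalkHom φ x m = 0) : ∃ m', stalkHom (Limits.kernel.ι φ) x m' = m := by
  obtain ⟨U, hx, s, rfl⟩ := (canonicalStalk _ x).exists_germ m
  rw [stalkHom_germ] at hm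
  obtain ⟨V, i, hV, h⟩ := (canonicalStalk _ x).exists_map_eq_zero U hx _ hm
  rw [← app_res] at h
  let K := (kerSub φ).toPresheafOfModules
  let ι : K ⟶ toP F := (kerSub φ).ι
  have hι : sheafifyDesc ι ≫ φ = 0 := by
    refine ((PresheafOfModules.sheafificationAdjunction
      (𝟙 X.ringCatSheaf.obj)).homEquiv K G).injective ?_
    have e (ψ : sheafify.obj K ⟶ G) := (PresheafOfModules.sheafificationAdjunction
      (𝟙 X.ringCatSheaf.obj)).homEquiv_unit K G ψ
    refine (e _).trans (Eq.trans ?_ (e _).symm)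
    change toSheafify K ≫ toPHom (sheafifyDesc ι) ≫ toPHom φ = toSheafify K ≫ toPHom 0
    rw [← Category.assoc, toSheafify_sheafifyDesc]
    refine PresheafOfModules.Hom.ext (funext fun U => ?_)
    refine ModuleCat.hom_ext (LinearMap.ext fun s => ?_)
    exact s.2
  let s' : K.obj (op V) := ⟨res (toP F) i s, h⟩
  refine ⟨stalkHom (Limits.kernel.lift φ _ hι) x ((canonicalStalk _ x).germ V hV
    (app (toSheafify K) V s')), ?_⟩
  rw [← stalkHom_comp, Limits.kernel.lift_ι, stalkHom_germ, ← (canonicalStalk _ x).germ_map i hV]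
  congr 1
  exact DFunLike.congr_fun (congrArg (fun a => app a V) (toSheafify_sheafifyDesc ι)) s'

end Exactness

section Filtration

open Limits

variable {C : Type*} [Category* C] [Abelian C] {A : C} {T : ℕ → C} (c : ∀ r, A ⟶ T r)

/-- The filtration of `A` whose `r`-th step is the intersection of the kernels of `c 0`, …,
`c (r - 1)`. -/
def kerFiltration : ℕ → Subobject A
  | 0 => ⊤
  | r + 1 => Subobject.mk (kernel.ι ((kerFiltration r).arrow ≫ c r) ≫ (kerFiltration r).arrow)

lemma kerFiltration_succ_le (r : ℕ) : kerFiltration c (r + 1) ≤ kerFiltration c r :=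
  Subobject.mk_le_of_comm (kernel.ι _) rfl

/-- Each step of the filtration is the kernel of the restriction of `c r` to the previous one. -/
def kerFiltrationIso (r : ℕ) :
    (kerFiltration c (r + 1) : C) ≅ kernel ((kerFiltration c r).arrow ≫ c r) :=
  Subobject.underlyingIso _

lemma ofLE_kerFiltration (r : ℕ) : Subobject.ofLE _ _ (kerFiltration_succ_le c r) =
    (kerFiltrationIso c r).hom ≫ kernel.ι ((kerFiltration c r).arrow ≫ c r) := by
  rw [← cancel_mono (kerFiltration c r).arrow, Subobject.ofLE_arrow, Category.assoc]
  exact (Subobject.underlyingIso_hom_comp_eq_mk _).symm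

lemma kerFiltration_arrow_comp {r q : ℕ} (h : q < r) : (kerFiltration c r).arrow ≫ c q = 0 := by
  induction r with
  | zero => omega
  | succ r ih =>
    rw [← Subobject.ofLE_arrow (kerFiltration_succ_le c r), Category.assoc]
    rcases Nat.lt_succ_iff_lt_or_eq.1 h with h | rfl
    · rw [ih h, comp_zero]
    · rw [ofLE_kerFiltration, Category.assoc, kernel.condition, comp_zero]

/-- The quotient `kerFiltration c r / kerFiltration c (r + 1)` is the image of `c r`. -/
lemma shortExact_kerFiltration {r : ℕ} {P : C} (j : P ⟶ T r) [Mono j]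
    (g : (kerFiltration c r : C) ⟶ P) [Epi g] (h : g ≫ j = (kerFiltration c r).arrow ≫ c r) :
    ∃ w : Subobject.ofLE _ _ (kerFiltration_succ_le c r) ≫ g = 0,
      (ShortComplex.mk (Subobject.ofLE _ _ (kerFiltration_succ_le c r)) g w).ShortExact := by
  have w : Subobject.ofLE _ _ (kerFiltration_succ_le c r) ≫ g = 0 := by
    rw [← cancel_mono j, Category.assoc, h, ofLE_kerFiltration, Category.assoc, kernel.condition,
      comp_zero, zero_comp]
  refine ⟨w, ?_⟩
  have : Mono (Subobject.ofLE _ _ (kerFiltration_succ_le c r)) := inferInstance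
  have hl {B : C} (k : B ⟶ (kerFiltration c r : C)) (hk : k ≫ g = 0) :
      k ≫ (kerFiltration c r).arrow ≫ c r = 0 := by
    rw [← h, ← Category.assoc, hk, zero_comp]
  exact ⟨ShortComplex.exact_of_f_is_kernel _ (KernelFork.IsLimit.ofι' _ w fun k hk =>
    ⟨kernel.lift _ k (hl k hk) ≫ (kerFiltrationIso c r).inv, by
      rw [ofLE_kerFiltration, Category.assoc, Iso.inv_hom_id_assoc, kernel.lift_ι]⟩)⟩

end Filtration

section Graded
open Opposite ExteriorShuffle TensorProduct StalkData
variable {X : Scheme.{u}} {A : X.Modules} {T P : ℕ → X.Modules} (c : ∀ r, A ⟶ T r)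
  (j : ∀ r, P r ⟶ T r) (p : ℕ)

/-- The conditions on maps `c r : M ⟶ T r` and `j r : P r ⟶ T r` of modules that make the `P r`, for
`r ≤ p`, the successive quotients of the filtration of `M` by the intersections of kernels of the
maps `c r`. -/
structure GradedBy {B : Type*} [CommRing B] {M : Type*} {T P : ℕ → Type*} [AddCommGroup M]
    [Module B M] [∀ r, AddCommGroup (T r)] [∀ r, Module B (T r)] [∀ r, AddCommGroup (P r)]
    [∀ r, Module B (P r)] (c : ∀ r, M →ₗ[B] T r) (j : ∀ r, P r →ₗ[B] T r) (p : ℕ) : Prop where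
  injective : ∀ r ≤ p, Function.Injective (j r)
  mem_range : ∀ r ≤ p, ∀ m, (∀ q < r, c q m = 0) → ∃ t, j r t = c r m
  exists_eq : ∀ r ≤ p, ∀ t, ∃ m, (∀ q < r, c q m = 0) ∧ c r m = j r t
  eq_zero : ∀ m, (∀ q ≤ p, c q m = 0) → m = 0

/-- On stalks, `kerFiltration c r` contains the intersection of the kernels of the `c q` for
`q < r`. -/
lemma exists_stalkHom_kerFiltration {x : X} (r : ℕ) {m}
    (hm : ∀ q < r, stalkHom (c q) x m = 0) :
    ∃ m', stalkHom (kerFiltration c r).arrow x m' = m := by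
  induction r with
  | zero =>
    have : IsIso (kerFiltration c 0).arrow := inferInstanceAs (IsIso (⊤ : Subobject A).arrow)
    have h : inv (kerFiltration c 0).arrow ≫ (kerFiltration c 0).arrow = 𝟙 A := IsIso.inv_hom_id _
    exact ⟨stalkHom (inv (kerFiltration c 0).arrow) x m, by rw [← stalkHom_comp, h, stalkHom_id]⟩
  | succ r ih =>
    obtain ⟨m, rfl⟩ := ih fun q hq => hm q (by omega)
    have h := hm r (by omega)
    rw [← stalkHom_comp] at h
    obtain ⟨m, rfl⟩ := exists_stalkHom_kernel _ h
    refine ⟨stalkHom (kerFiltrationIso c r).inv x m, ?_⟩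
    rw [← stalkHom_comp, ← stalkHom_comp, ← Subobject.ofLE_arrow (kerFiltration_succ_le c r),
      ofLE_kerFiltration, Category.assoc, Iso.inv_hom_id_assoc]

/-- If the `P r` are the successive quotients of the filtration by kernels on all stalks, then they
are so on the level of sheaves. -/
lemma exists_filtration
    (h : ∀ x, GradedBy (fun r => stalkHom (c r) x) (fun r => stalkHom (j r) x) p) :
    ∃ (F : ℕ → Subobject A) (hF : ∀ r, F (r + 1) ≤ F r), F 0 = ⊤ ∧ F (p + 1) = ⊥ ∧ ∀ r ≤ p,
      ∃ (g : (F r : X.Modules) ⟶ P r) (w : Subobject.ofLE (F (r + 1)) (F r) (hF r) ≫ g = 0),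
        (ShortComplex.mk (Subobject.ofLE (F (r + 1)) (F r) (hF r)) g w).ShortExact := by
  have hkill (r q : ℕ) (hq : q < r) (x : X) (m) :
      stalkHom (c q) x (stalkHom (kerFiltration c r).arrow x m) = 0 := by
    rw [← stalkHom_comp, kerFiltration_arrow_comp c hq, stalkHom_zero]
  refine ⟨kerFiltration c, kerFiltration_succ_le c, rfl, ?_, fun r hr => ?_⟩
  · have h0 : (kerFiltration c (p + 1)).arrow = 0 := eq_zero_of_stalkHom fun x m =>
      (h x).eq_zero _ fun q hq => hkill _ q (by omega) x m
    rw [← Subobject.mk_arrow (kerFiltration c (p + 1))]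
    exact Subobject.mk_eq_bot_iff_zero.2 h0
  · have hmono : Mono (j r) := mono_of_stalkHom fun x => (h x).injective r hr
    have hlift : ((kerFiltration c r).arrow ≫ c r) ≫ Limits.cokernel.π (j r) = 0 := by
      refine eq_zero_of_stalkHom fun x m => ?_
      obtain ⟨t, ht⟩ := (h x).mem_range r hr (stalkHom (kerFiltration c r).arrow x m)
        fun q hq => hkill r q hq x m
      rw [stalkHom_comp, stalkHom_comp, ← ht, ← stalkHom_comp, Limits.cokernel.condition,
        stalkHom_zero]
    have hg := Abelian.monoLift_comp (j r) _ hlift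
    have hepi : Epi (Abelian.monoLift (j r) _ hlift) := by
      refine epi_of_stalkHom fun x t => ?_
      obtain ⟨m, hm, e⟩ := (h x).exists_eq r hr t
      obtain ⟨m, rfl⟩ := exists_stalkHom_kerFiltration c r hm
      refine ⟨m, (h x).injective r hr ?_⟩
      rw [← e, ← stalkHom_comp, ← stalkHom_comp, hg]
    exact ⟨_, shortExact_kerFiltration c (j r) _ hg⟩

end Graded

end TorsionFreeDiff

namespace TorsionFreeDiff

/-! ### The filtration of torsion-free differential forms -/

section Forms
open Opposite ExteriorShuffle TensorProduct StalkData
variable {X Y S : Scheme.{u}}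

namespace StalkData

variable {P P' : PMod X} {x : X} {M M' M₁ M₁' : Type u} [AddCommGroup M]
  [Module (X.presheaf.stalk x) M] [AddCommGroup M'] [Module (X.presheaf.stalk x) M']
  [AddCommGroup M₁] [Module (X.presheaf.stalk x) M₁] [AddCommGroup M₁']
  [Module (X.presheaf.stalk x) M₁']

lemma hom_id (d : StalkData P x M) (m : M) : hom d d (𝟙 P) m = m := by
  obtain ⟨U, hx, s, rfl⟩ := d.exists_germ m
  exact hom_germ d d (𝟙 P) U hx s

/-- Two models of the same stalk are isomorphic. -/
def equiv (d : StalkData P x M) (d₁ : StalkData P x M₁) : M ≃ₗ[X.presheaf.stalk x] M₁ :=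
  LinearEquiv.ofLinearMap (hom d d₁ (𝟙 P)) (hom d₁ d (𝟙 P))
    (LinearMap.ext fun m => by
      rw [LinearMap.comp_apply, ← StalkData.hom_comp, Category.comp_id, hom_id, LinearMap.id_apply])
    (LinearMap.ext fun m => by
      rw [LinearMap.comp_apply, ← StalkData.hom_comp, Category.comp_id, hom_id, LinearMap.id_apply])

lemma hom_equiv (d : StalkData P x M) (d' : StalkData P' x M') (d₁ : StalkData P x M₁)
    (d₁' : StalkData P' x M₁') (φ : P ⟶ P') (m : M) :
    hom d₁ d₁' φ (equiv d d₁ m) = equiv d' d₁' (hom d d' φ m) := by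
  change hom d₁ d₁' φ (hom d d₁ (𝟙 P) m) = hom d' d₁' (𝟙 P') (hom d d' φ m)
  rw [← StalkData.hom_comp, ← StalkData.hom_comp, Category.id_comp, Category.comp_id]

end StalkData

lemma GradedBy.of_equiv {B : Type*} [CommRing B] {M M' : Type*} {T T' P P' : ℕ → Type*}
    [AddCommGroup M] [Module B M] [∀ r, AddCommGroup (T r)] [∀ r, Module B (T r)]
    [∀ r, AddCommGroup (P r)] [∀ r, Module B (P r)] [AddCommGroup M'] [Module B M']
    [∀ r, AddCommGroup (T' r)] [∀ r, Module B (T' r)]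
    [∀ r, AddCommGroup (P' r)] [∀ r, Module B (P' r)] {c : ∀ r, M →ₗ[B] T r}
    {j : ∀ r, P r →ₗ[B] T r} {c' : ∀ r, M' →ₗ[B] T' r} {j' : ∀ r, P' r →ₗ[B] T' r} {p : ℕ}
    (h : GradedBy c j p) (eM : M ≃ₗ[B] M') (eT : ∀ r, T r ≃ₗ[B] T' r) (eP : ∀ r, P r ≃ₗ[B] P' r)
    (hc : ∀ r m, c' r (eM m) = eT r (c r m)) (hj : ∀ r m, j' r (eP r m) = eT r (j r m)) :
    GradedBy c' j' p := by
  have hc0 {q : ℕ} {m : M} : c' q (eM m) = 0 ↔ c q m = 0 := by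
    rw [hc, LinearEquiv.map_eq_zero_iff]
  refine ⟨fun r hr a b hab => ?_, fun r hr m hm => ?_, fun r hr t => ?_, fun m hm => ?_⟩
  · obtain ⟨a, rfl⟩ := (eP r).surjective a
    obtain ⟨b, rfl⟩ := (eP r).surjective b
    rw [hj, hj] at hab
    exact congrArg _ (h.injective r hr ((eT r).injective hab))
  · obtain ⟨m, rfl⟩ := eM.surjective m
    obtain ⟨t, ht⟩ := h.mem_range r hr m fun q hq => hc0.1 (hm q hq)
    exact ⟨eP r t, by rw [hj, hc, ht]⟩
  · obtain ⟨t, rfl⟩ := (eP r).surjective t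
    obtain ⟨m, hm, e⟩ := h.exists_eq r hr t
    exact ⟨eM m, fun q hq => hc0.2 (hm q hq), by rw [hj, hc, e]⟩
  · obtain ⟨m, rfl⟩ := eM.surjective m
    rw [h.eq_zero m fun q hq => hc0.1 (hm q hq), map_zero]

/-- The algebraic form of the theorem, for a splitting `M = im u ⊕ im v` of `q : M → Q`, and flat
modules `P r` that are models of `⋀ʳ (im u)`. -/
lemma gradedBy_tensorModTor {B : Type*} [CommRing B] {M Q : Type*} {P : ℕ → Type*}
    [AddCommGroup M] [Module B M] [AddCommGroup Q] [Module B Q] [∀ r, AddCommGroup (P r)]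
    [∀ r, Module B (P r)] [∀ r, Module.Flat B (P r)] {p : ℕ} {q : M →ₗ[B] Q}
    {c : ∀ r, ModTor B (⋀[B]^p M) →ₗ[B] ModTor B (⋀[B]^r M ⊗[B] ModTor B (⋀[B]^(p - r) Q))}
    (hc : ∀ r (hr : r ≤ p), c r = comultModTor q (Nat.add_sub_cancel' hr))
    {η : ∀ r, P r →ₗ[B] ⋀[B]^r M}
    {j : ∀ r, P r ⊗[B] ModTor B (⋀[B]^(p - r) Q) →ₗ[B]
      ModTor B (⋀[B]^r M ⊗[B] ModTor B (⋀[B]^(p - r) Q))} (hj : ∀ r, j r = tensorModTor (η r))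
    {u : M →ₗ[B] M} {v : Q →ₗ[B] M} (huv : ∀ x, u x + v (q x) = x) (hu : ∀ x, q (u x) = 0)
    (hv : ∀ y, q (v y) = y) {θ : ∀ r, ⋀[B]^r M →ₗ[B] P r}
    (hθη : ∀ r z, θ r (η r z) = z)
    (hηθ : ∀ r z, η r (θ r z) = _root_.exteriorPower.map r u z) :
    GradedBy c j p := by
  obtain rfl : j = fun r => tensorModTor (η r) := funext hj
  have hkill {r : ℕ} {m} (hr : r ≤ p + 1) (hm : ∀ q < r, c q m = 0)
      (r' s' : ℕ) (h' : r' + s' = p) (hr' : r' < r) : comultModTor q h' m = 0 := by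
    obtain rfl : s' = p - r' := by omega
    have h := hm r' hr'
    rwa [hc r' (by omega)] at h
  refine ⟨fun r _ => tensorModTor_injective (hθη r), fun r hr m hm => ?_, fun r hr t => ?_,
    fun m hm => ?_⟩
  · rw [hc r hr]
    exact comultModTor_mem_range _ huv hu hv (hηθ r) (hkill (by omega) hm)
  · rw [hc r hr]
    obtain ⟨z, hz, e⟩ := exists_comultModTor_eq (Nat.add_sub_cancel' hr) hu hv (η := η r)
      (fun z => by rw [← hηθ, hθη]) t
    exact ⟨z, fun q hq => by rw [hc q (by omega)]; exact hz _ _ _ hq, e⟩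
  · exact eq_zero_of_comultModTor huv fun r t h =>
      hkill le_rfl (fun q hq => hm q (by omega)) r t h (by omega)

variable (f : X ⟶ Y) (s : Y ⟶ S)

/-- The morphism `f^* Ωʳ_{Y/S} ⊗ (Ωᵗ_{X/Y} / tor) ⟶ Ωʳ_{X/S} ⊗ (Ωᵗ_{X/Y} / tor)`. -/
def pullbackFormTensor (r t : ℕ) :
    tensor ((Scheme.Modules.pullback f).obj (Omega s r)) (OmegaCheck f t) ⟶
      tensor (Omega (f ≫ s) r) (OmegaCheck f t) :=
  sheafify.map (tensorPresheafMap (toPHom (pullbackForm f s r)) (𝟙 (toP (OmegaCheck f t))))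

/-- The morphism `f^* Ωʳ_{Y/S} ⊗ (Ωᵗ_{X/Y} / tor) ⟶ (Ωʳ_{X/S} ⊗ (Ωᵗ_{X/Y} / tor)) / tor`. -/
def pullbackFormCheck (r t : ℕ) :
    tensor ((Scheme.Modules.pullback f).obj (Omega s r)) (OmegaCheck f t) ⟶
      modTorsion (tensor (Omega (f ≫ s) r) (OmegaCheck f t)) :=
  pullbackFormTensor f s r t ≫ modTorsionMk _

/-- The `r`-th component of the comultiplication, which is zero in degrees greater than `p`. -/
def comultFamily (p r : ℕ) : OmegaCheck (f ≫ s) p ⟶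
    modTorsion (tensor (Omega (f ≫ s) r) (OmegaCheck f (p - r))) :=
  if h : r ≤ p then comultCheck f s (Nat.add_sub_cancel' h) else 0

lemma comultFamily_eq {p r : ℕ} (h : r ≤ p) :
    comultFamily f s p r = comultCheck f s (Nat.add_sub_cancel' h) := dif_pos h

section Stalk

variable [IsLocallyNoetherian X] (x : X) (k : Type u) [CommRing k] [Algebra k (X.presheaf.stalk x)]
  [Algebra k (Y.presheaf.stalk (f x))] [Algebra (Y.presheaf.stalk (f x)) (X.presheaf.stalk x)]
  [IsScalarTower k (Y.presheaf.stalk (f x)) (X.presheaf.stalk x)]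
  (hR : algebraMap (Y.presheaf.stalk (f x)) (X.presheaf.stalk x) = (f.stalkMap x).hom)
  (hk : (algebraMap k (X.presheaf.stalk x)).range = ((f ≫ s).stalkMap x).hom.range)
  (hk' : (algebraMap k (Y.presheaf.stalk (f x))).range = (s.stalkMap (f x)).hom.range)

omit [IsLocallyNoetherian X] [IsScalarTower k (Y.presheaf.stalk (f x)) (X.presheaf.stalk x)] in
include hR in
lemma range_algebraMap_eq : (algebraMap (Y.presheaf.stalk (f x)) (X.presheaf.stalk x)).range =
    (f.stalkMap x).hom.range := by rw [hR]

omit [Algebra k (Y.presheaf.stalk (f x))]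
  [IsScalarTower k (Y.presheaf.stalk (f x)) (X.presheaf.stalk x)] in
/-- The stalk of `pullbackFormCheck` is the map on `P ⊗ (⋀ᵗ Ω / tor)` induced by the stalk of the
pull-back of forms, for any model `P` of the stalk of `f^* Ωʳ_{Y/S}`. -/
lemma hom_pullbackFormCheck (hR' : (algebraMap (Y.presheaf.stalk (f x)) (X.presheaf.stalk x)).range
      = (f.stalkMap x).hom.range) {P : Type u} [AddCommGroup P] [Module (X.presheaf.stalk x) P]
    (r t : ℕ) (d : StalkData (toP ((Scheme.Modules.pullback f).obj (Omega s r))) x P) :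
    hom (tensorStalk x d (omegaCheckStalk f x (Y.presheaf.stalk (f x)) hR' t))
      (tensorStalk x (omegaStalk (f ≫ s) x k hk r)
        (omegaCheckStalk f x (Y.presheaf.stalk (f x)) hR' t)).modTor
      (toPHom (pullbackFormCheck f s r t)) =
    tensorModTor (hom d (omegaStalk (f ≫ s) x k hk r) (toPHom (pullbackForm f s r))) := by
  refine LinearMap.ext fun m => ?_
  refine (StalkData.hom_comp (tensorStalk x d (omegaCheckStalk f x (Y.presheaf.stalk (f x)) hR' t))
    (tensorStalk x (omegaStalk (f ≫ s) x k hk r)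
      (omegaCheckStalk f x (Y.presheaf.stalk (f x)) hR' t)) _
    (toPHom (pullbackFormTensor f s r t)) (toModTorsion _) m).trans ?_
  refine (hom_toModTorsion (tensorStalk x (omegaStalk (f ≫ s) x k hk r)
      (omegaCheckStalk f x (Y.presheaf.stalk (f x)) hR' t)) _).trans ?_
  have e := hom_tensor d (omegaCheckStalk f x (Y.presheaf.stalk (f x)) hR' t)
    (omegaStalk (f ≫ s) x k hk r) (omegaCheckStalk f x (Y.presheaf.stalk (f x)) hR' t)
    (toPHom (pullbackForm f s r)) (𝟙 (toP (OmegaCheck f t)))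
  have e₁ : hom (omegaCheckStalk f x (Y.presheaf.stalk (f x)) hR' t)
      (omegaCheckStalk f x (Y.presheaf.stalk (f x)) hR' t) (𝟙 (toP (OmegaCheck f t))) =
      LinearMap.id := LinearMap.ext (hom_id _)
  rw [e₁] at e
  exact congrArg Submodule.Quotient.mk ((sheafification_hom _ _ m).trans (LinearMap.congr_fun e m))

lemma hom_comultFamily
    (hR' : (algebraMap (Y.presheaf.stalk (f x)) (X.presheaf.stalk x)).range
      = (f.stalkMap x).hom.range) {r p : ℕ} (hr : r ≤ p) :
    hom (omegaCheckStalk (f ≫ s) x k hk p)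
      (tensorStalk x (omegaStalk (f ≫ s) x k hk r)
        (omegaCheckStalk f x (Y.presheaf.stalk (f x)) hR' (p - r))).modTor
      (toPHom (comultFamily f s p r)) =
    comultModTor (KaehlerDifferential.map k (Y.presheaf.stalk (f x)) (X.presheaf.stalk x)
      (X.presheaf.stalk x)) (Nat.add_sub_cancel' hr) :=
  (congrArg (fun φ => hom (omegaCheckStalk (f ≫ s) x k hk p)
      (tensorStalk x (omegaStalk (f ≫ s) x k hk r)
        (omegaCheckStalk f x (Y.presheaf.stalk (f x)) hR' (p - r))).modTor
      (toPHom φ)) (comultFamily_eq f s hr)).trans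
    (hom_comultCheck f s x (Y.presheaf.stalk (f x)) k hk hR' (Nat.add_sub_cancel' hr))

include hR hk hk' in
/-- If the local ring at `x` has derivations dual to local coordinates on `Y`, then the filtration
by the kernels of comultiplications has the expected successive quotients at `x`. -/
lemma gradedBy_stalkHom
    (h : HasDualDerivations k (Y.presheaf.stalk (f x)) (X.presheaf.stalk x)) (p : ℕ) :
    GradedBy (fun r => stalkHom (comultFamily f s p r) x)
      (fun r => stalkHom (pullbackFormCheck f s r (p - r)) x) p := by
  have hR' := range_algebraMap_eq f x hR
  obtain ⟨m, y, δ, hδ, hy⟩ := h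
  let q := KaehlerDifferential.map k (Y.presheaf.stalk (f x)) (X.presheaf.stalk x)
    (X.presheaf.stalk x)
  let u := coordMap (k := k) (B := X.presheaf.stalk x) y ∘ₗ dualMap δ
  let v := relSplitting hδ hy
  have hu (z) : q (u z) = 0 := map_coordMap _
  have hv (z) : q (v z) = z := map_relSplitting hδ hy z
  have huv (z) : u z + v (q z) = z := coordMap_add_relSplitting hδ hy z
  let dΩ := fun r => omegaStalk (f ≫ s) x k hk r
  let dΩ' := fun t => omegaCheckStalk f x (Y.presheaf.stalk (f x)) hR' t
  let dP := fun r => canonicalStalk (toP ((Scheme.Modules.pullback f).obj (Omega s r))) x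
  let dA := omegaCheckStalk (f ≫ s) x k hk p
  let dT := fun r => (tensorStalk x (dΩ r) (dΩ' (p - r))).modTor
  let η := fun r => hom (dP r) (dΩ r) (toPHom (pullbackForm f s r))
  have hη (r : ℕ) : Module.Flat (X.presheaf.stalk x)
      (presheafStalk (toP ((Scheme.Modules.pullback f).obj (Omega s r))) x) ∧
      ∃ θ : ⋀[X.presheaf.stalk x]^r Ω[X.presheaf.stalk x⁄k] →ₗ[X.presheaf.stalk x]
        presheafStalk (toP ((Scheme.Modules.pullback f).obj (Omega s r))) x,
      (∀ z, θ (η r z) = z) ∧ ∀ z, η r (θ z) = _root_.exteriorPower.map r u z := by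
    let w₀ := homPush f x (omegaStalk s (f x) k hk' r) (dP r) (pullbackUnit f (Omega s r))
    let w : ⋀[Y.presheaf.stalk (f x)]^r Ω[Y.presheaf.stalk (f x)⁄k]
        →ₛₗ[algebraMap (Y.presheaf.stalk (f x)) (X.presheaf.stalk x)]
        presheafStalk (toP ((Scheme.Modules.pullback f).obj (Omega s r))) x :=
      { toFun := w₀
        map_add' := map_add w₀
        map_smul' := fun a z => by rw [hR]; exact w₀.map_smulₛₗ a z }
    refine exists_retraction (w := w) hδ hy
      (span_range_homPush_of_stalk f x (omegaStalk s (f x) k hk' r) (dP r)) (η := η r) fun a => ?_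
    refine (hom_homPush f x (omegaStalk s (f x) k hk' r) (dP r) (pullbackUnit f (Omega s r))
      (dΩ r) (pullbackForm f s r) _).trans ?_
    rw [pullbackUnit_pullbackForm, hR]
    exact homPush_pullForm f s x k hk hk' r a
  have hflat (r : ℕ) := (hη r).1
  choose θ hθη hηθ using fun r => (hη r).2
  have main : GradedBy (fun r => hom dA (dT r) (toPHom (comultFamily f s p r)))
      (fun r => hom (tensorStalk x (dP r) (dΩ' (p - r))) (dT r)
        (toPHom (pullbackFormCheck f s r (p - r)))) p := by
    have hc {r : ℕ} (hr : r ≤ p) : hom dA (dT r) (toPHom (comultFamily f s p r)) =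
        comultModTor q (Nat.add_sub_cancel' hr) := hom_comultFamily f s x k hk hR' hr
    have hj (r : ℕ) : hom (tensorStalk x (dP r) (dΩ' (p - r))) (dT r)
        (toPHom (pullbackFormCheck f s r (p - r))) = tensorModTor (η r) :=
      hom_pullbackFormCheck f s x k hk hR' r (p - r) (dP r)
    exact gradedBy_tensorModTor (B := X.presheaf.stalk x) (M := Ω[X.presheaf.stalk x⁄k])
      (Q := Ω[X.presheaf.stalk x⁄Y.presheaf.stalk (f x)])
      (P := fun r => presheafStalk (toP ((Scheme.Modules.pullback f).obj (Omega s r))) x)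
      (c := fun r => hom dA (dT r) (toPHom (comultFamily f s p r)))
      (j := fun r => hom (tensorStalk x (dP r) (dΩ' (p - r))) (dT r)
        (toPHom (pullbackFormCheck f s r (p - r))))
      (fun r hr => hc hr) hj huv hu hv hθη hηθ
  exact main.of_equiv (dA.equiv (canonicalStalk _ x)) (fun r => (dT r).equiv (canonicalStalk _ x))
    (fun r => (tensorStalk x (dP r) (dΩ' (p - r))).equiv (canonicalStalk _ x))
    (fun r m => hom_equiv _ _ _ _ _ m) (fun r m => hom_equiv _ _ _ _ _ m)

end Stalk

/-- If all local rings of `X` have derivations dual to local coordinates on `Y`, then the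
torsion-free forms of `X` over `S` are filtered, with the expected successive quotients. -/
theorem exists_filtration_of_dualDerivations [IsLocallyNoetherian X] (t : X ⟶ S) (ht : f ≫ s = t)
    (h : ∀ x,
      letI := (f.stalkMap x).hom.toAlgebra
      letI := (s.stalkMap (f x)).hom.toAlgebra
      letI := ((f.stalkMap x).hom.comp (s.stalkMap (f x)).hom).toAlgebra
      HasDualDerivations (S.presheaf.stalk (s (f x))) (Y.presheaf.stalk (f x))
        (X.presheaf.stalk x)) (p : ℕ) :
    ∃ (F : ℕ → Subobject (OmegaCheck t p)) (hF : ∀ r, F (r + 1) ≤ F r),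
      F 0 = ⊤ ∧ F (p + 1) = ⊥ ∧ ∀ r ≤ p,
      ∃ (g : (F r : X.Modules) ⟶
            tensor ((Scheme.Modules.pullback f).obj (Omega s r)) (OmegaCheck f (p - r)))
          (w : Subobject.ofLE (F (r + 1)) (F r) (hF r) ≫ g = 0),
          (ShortComplex.mk (Subobject.ofLE (F (r + 1)) (F r) (hF r)) g w).ShortExact := by
  subst ht
  refine exists_filtration (comultFamily f s p) (fun r => pullbackFormCheck f s r (p - r)) p
    fun x => ?_
  let := (f.stalkMap x).hom.toAlgebra
  let := (s.stalkMap (f x)).hom.toAlgebra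
  let := ((f.stalkMap x).hom.comp (s.stalkMap (f x)).hom).toAlgebra
  have : IsScalarTower (S.presheaf.stalk (s (f x))) (Y.presheaf.stalk (f x))
    (X.presheaf.stalk x) := IsScalarTower.of_algebraMap_eq fun _ => rfl
  refine gradedBy_stalkHom f s x (S.presheaf.stalk (s (f x))) rfl ?_ rfl (h x) p
  have e : (((f ≫ s).stalkMap x).hom : _ →+* _) =
      (f.stalkMap x).hom.comp (s.stalkMap (f x)).hom := by
    rw [Scheme.Hom.stalkMap_comp]; rfl
  rw [e]
  rfl

end Forms
end TorsionFreeDiff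

namespace ExteriorShuffle

/-! ### Derivations adapted to normal crossings -/

section NormalCrossings

open TensorProduct KaehlerDifferential

lemma exists_projection_ker {C N Q : Type*} [CommRing C] [AddCommGroup N] [Module C N]
    [AddCommGroup Q] [Module C Q] [Module.Projective C Q] {g : N →ₗ[C] Q}
    (hg : Function.Surjective g) :
    ∃ π : N →ₗ[C] LinearMap.ker g, ∀ w : LinearMap.ker g, π w = w := by
  obtain ⟨s, hs⟩ := Module.projective_lifting_property g LinearMap.id hg
  refine ⟨LinearMap.codRestrict _ (LinearMap.id - s ∘ₗ g) fun n => ?_, fun w => ?_⟩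
  · have h := LinearMap.congr_fun hs (g n)
    simp only [LinearMap.comp_apply, LinearMap.id_apply] at h
    simp [h]
  · ext
    simp

lemma finrank_ker_of_surjective {C N Q : Type*} [CommRing C] [IsLocalRing C] [AddCommGroup N]
    [Module C N] [AddCommGroup Q] [Module C Q] {n n' : ℕ} (bN : Module.Basis (Fin n) C N)
    (bQ : Module.Basis (Fin n') C Q) {g : N →ₗ[C] Q} (hg : Function.Surjective g) :
    Module.Free C (LinearMap.ker g) ∧ Module.Finite C (LinearMap.ker g) ∧
      Module.finrank C (LinearMap.ker g) + n' = n := by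
  have := Module.Free.of_basis bN
  have := Module.Finite.of_basis bN
  have := Module.Free.of_basis bQ
  have := Module.Finite.of_basis bQ
  obtain ⟨π, hπ⟩ := exists_projection_ker hg
  have hπs : Function.Surjective π := fun w => ⟨w, hπ w⟩
  have : Module.Finite C (LinearMap.ker g) := Module.Finite.of_surjective π hπs
  have : Module.Projective C (LinearMap.ker g) :=
    Module.Projective.of_split (LinearMap.ker g).subtype π (LinearMap.ext hπ)
  have : Module.Free C (LinearMap.ker g) := Module.free_of_flat_of_isLocalRing
  refine ⟨inferInstance, inferInstance, ?_⟩
  have hb : Function.Bijective (π.prod g) := by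
    constructor
    · rw [injective_iff_map_eq_zero]
      intro a ha
      have h1 : π a = 0 := congrArg Prod.fst ha
      have h2 : g a = 0 := congrArg Prod.snd ha
      have h3 := hπ ⟨a, h2⟩
      rw [h1] at h3
      exact (congrArg Subtype.val h3).symm
    · rintro ⟨w, z⟩
      obtain ⟨a, rfl⟩ := hg z
      refine ⟨a - π a + w, Prod.ext ?_ ?_⟩
      · change π (a - π a + w) = w
        rw [map_add, map_sub, hπ, hπ, sub_self, zero_add]
      · change g (a - π a + w) = g a
        rw [map_add, map_sub, (π a).2, w.2, sub_zero, add_zero]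
  have e := (LinearEquiv.ofBijective _ hb).finrank_eq
  rw [Module.finrank_prod, Module.finrank_eq_card_basis bN, Module.finrank_eq_card_basis bQ,
    Fintype.card_fin, Fintype.card_fin] at e
  exact e.symm

variable {R A C : Type u} [CommRing R] [CommRing A] [CommRing C] [Algebra R A]
  [Algebra A C] [Algebra R C] [IsScalarTower R A C]

omit [Algebra R C] [IsScalarTower R A C] in
lemma one_tmul_D_mul {a b : A} (hb : algebraMap A C b = 0) :
    (1 : C) ⊗ₜ[A] D R A (a * b) = algebraMap A C a • ((1 : C) ⊗ₜ[A] D R A b) := by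
  have h : (1 : C) ⊗ₜ[A] (b • D R A a) = 0 := by
    rw [← smul_tmul, Algebra.smul_def, hb, zero_mul, zero_tmul]
  rw [Derivation.leibniz, tmul_add, h, add_zero, tmul_smul, algebraMap_smul]

/-- The conormal module of a quotient `C` of `A`, as a submodule of the differentials. -/
lemma ker_mapBaseChange_eq_span (hC : Function.Surjective (algebraMap A C)) {ι : Type*} {x : ι → A}
    (hx : Ideal.span (Set.range x) = RingHom.ker (algebraMap A C)) :
    LinearMap.ker (mapBaseChange R A C) =
      Submodule.span C (Set.range fun i => (1 : C) ⊗ₜ[A] D R A (x i)) := by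
  have hker (i : ι) : algebraMap A C (x i) = 0 := by
    rw [← RingHom.mem_ker, ← hx]; exact Ideal.subset_span ⟨i, rfl⟩
  apply le_antisymm
  · intro z hz
    obtain ⟨w, rfl⟩ := (exact_kerCotangentToTensor_mapBaseChange R A C hC z).1 hz
    obtain ⟨⟨w, hw⟩, rfl⟩ := Ideal.toCotangent_surjective _ w
    rw [kerCotangentToTensor_toCotangent]
    clear hz
    change (1 : C) ⊗ₜ[A] D R A w ∈ _
    rw [← hx] at hw
    induction hw using Submodule.span_induction with
    | mem z hz =>
      obtain ⟨i, rfl⟩ := hz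
      exact Submodule.subset_span ⟨i, rfl⟩
    | zero => simp
    | add a b _ _ ha hb => rw [map_add, tmul_add]; exact add_mem ha hb
    | smul a b hb h =>
      have hb' : algebraMap A C b = 0 := by rw [← RingHom.mem_ker, ← hx]; exact hb
      rw [smul_eq_mul, one_tmul_D_mul hb']
      exact Submodule.smul_mem _ _ h
  · rw [Submodule.span_le]
    rintro _ ⟨i, rfl⟩
    simp [hker]

omit [Algebra R C] [IsScalarTower R A C] in
/-- A functional on the differentials restricted to `C` comes from a derivation of `A`. -/
lemma exists_derivation_of_functional [Module.Projective A Ω[A⁄R]]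
    (hC : Function.Surjective (algebraMap A C)) (φ : C ⊗[A] Ω[A⁄R] →ₗ[C] C) :
    ∃ δ : Derivation R A A, ∀ a, algebraMap A C (δ a) = φ (1 ⊗ₜ D R A a) := by
  obtain ⟨l, hl⟩ := Module.projective_lifting_property (Algebra.linearMap A C)
    ((φ.restrictScalars A) ∘ₗ TensorProduct.mk A C Ω[A⁄R] 1) hC
  exact ⟨l.compDer (D R A), fun a => LinearMap.congr_fun hl (D R A a)⟩

/-- The differentials of equations for `C`, as elements of the conormal module. -/
def conormal {ι : Type*} {x : ι → A} (hx : ∀ i, algebraMap A C (x i) = 0) (i : ι) :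
    LinearMap.ker (mapBaseChange R A C) :=
  ⟨(1 : C) ⊗ₜ[A] D R A (x i), by simp [hx]⟩

lemma span_range_conormal (hC : Function.Surjective (algebraMap A C)) {ι : Type*} {x : ι → A}
    (hx : Ideal.span (Set.range x) = RingHom.ker (algebraMap A C))
    (hx' : ∀ i, algebraMap A C (x i) = 0) :
    Submodule.span C (Set.range (conormal (R := R) hx')) = ⊤ := by
  apply Submodule.map_injective_of_injective
    (LinearMap.ker (mapBaseChange R A C)).injective_subtype
  rw [Submodule.map_span, ← Set.range_comp, Submodule.map_top, Submodule.range_subtype]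
  exact (ker_mapBaseChange_eq_span hC hx).symm

/-- A closed subscheme that is smooth of relative dimension one less is locally cut out by one
equation: as `C` is formally smooth, the conormal module `I/I²` embeds in `C ⊗ Ω[A⁄R]` as the
kernel of the map to `Ω[C⁄R]`, so it is free of rank one, and Nakayama's lemma lifts a
generator. -/
lemma exists_ker_eq_span_singleton [IsLocalRing A] [IsLocalRing C] [IsNoetherianRing A]
    [Algebra.FormallySmooth R A] [Algebra.FormallySmooth R C]
    (hC : Function.Surjective (algebraMap A C)) {n n' : ℕ} (hn : n = n' + 1)
    (bA : Module.Basis (Fin n) A Ω[A⁄R]) (bC : Module.Basis (Fin n') C Ω[C⁄R]) :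
    ∃ x : A, RingHom.ker (algebraMap A C) = Ideal.span {x} := by
  obtain ⟨hfree, hfin, hrank⟩ := finrank_ker_of_surjective (bA.baseChange C) bC
    (mapBaseChange_surjective R A C hC)
  have hx : Ideal.span (Set.range fun z : RingHom.ker (algebraMap A C) => z.1) =
      RingHom.ker (algebraMap A C) := by
    refine (congrArg Ideal.span Subtype.range_coe).trans ?_
    exact Submodule.span_eq (RingHom.ker (algebraMap A C))
  have := Module.finitePresentation_of_projective C (LinearMap.ker (mapBaseChange R A C))
  obtain ⟨κ, a, b, hb⟩ := Module.exists_basis_of_span_of_flat (R := C)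
    (M := LinearMap.ker (mapBaseChange R A C)) _ (span_range_conormal (R := R) hC hx fun z => z.2)
  have hcard : Nat.card κ = 1 := by
    rw [← Module.finrank_eq_nat_card_basis b]; omega
  obtain ⟨hsub, ⟨i⟩⟩ := Nat.card_eq_one_iff_unique.1 hcard
  refine ⟨a i, le_antisymm ?_ ((Ideal.span_singleton_le_iff_mem _).2 (a i).2)⟩
  have hjac : RingHom.ker (algebraMap A C) ≤ Ideal.jacobson ⊥ := by
    rw [IsLocalRing.jacobson_eq_maximalIdeal ⊥ bot_ne_top]
    exact IsLocalRing.le_maximalIdeal (RingHom.ker_ne_top _)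
  refine Submodule.le_of_le_smul_of_le_jacobson_bot (IsNoetherian.noetherian _) hjac fun z hz => ?_
  let w : LinearMap.ker (mapBaseChange R A C) := conormal (R := R)
    (x := fun z : RingHom.ker (algebraMap A C) => z.1) (fun z => z.2) ⟨z, hz⟩
  obtain ⟨c, hc⟩ := hC (b.repr w i)
  have hz' : w = algebraMap A C c • b i := by
    have := Fintype.ofSubsingleton i
    conv_lhs => rw [← b.sum_repr w]
    rw [hc, Fintype.sum_subsingleton _ i]
  rw [hb] at hz'
  have h1 : (1 : C) ⊗ₜ[A] D R A z = algebraMap A C c • ((1 : C) ⊗ₜ[A] D R A (a i)) :=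
    congrArg Subtype.val hz'
  have hmem : z - c * a i ∈ RingHom.ker (algebraMap A C) :=
    sub_mem hz (Ideal.mul_mem_left _ _ (a i).2)
  have h2 : Ideal.toCotangent (RingHom.ker (algebraMap A C)) ⟨z - c * a i, hmem⟩ = 0 := by
    have hinj := (Algebra.FormallySmooth.kerCotangentToTensor_injective_iff (R := R) hC).2
      inferInstance
    refine hinj ?_
    rw [kerCotangentToTensor_toCotangent, map_zero, map_sub, tmul_sub, h1,
      one_tmul_D_mul (a i).2, sub_self]
  rw [Ideal.toCotangent_eq_zero, pow_two] at h2
  rw [← sub_add_cancel z (c * a i), add_comm]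
  exact Submodule.add_mem_sup (Ideal.mul_mem_left _ _ (Ideal.mem_span_singleton_self _)) h2

lemma derivation_sum_apply {k A : Type*} [CommRing k] [CommRing A] [Algebra k A] {ι : Type*}
    [Fintype ι] (c : ι → A) (δ : ι → Derivation k A A) (a : A) :
    (∑ l, c l • δ l) a = ∑ l, c l * δ l a := by
  have h := map_sum (Derivation.coeFnAddMonoidHom (R := k) (A := A) (M := A))
    (fun l => c l • δ l) Finset.univ
  refine (congrFun h a).trans ?_
  rw [Finset.sum_apply]
  rfl

/-- If `x` is a minimal system of equations for `C`, there are dual derivations. -/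
lemma exists_derivation_dual {ι : Type*} [Fintype ι] [DecidableEq ι] [IsLocalRing A]
    [IsLocalRing C] [Module.Projective A Ω[A⁄R]] (hC : Function.Surjective (algebraMap A C))
    {n n' : ℕ} (hn : n = n' + Fintype.card ι) (bA : Module.Basis (Fin n) A Ω[A⁄R])
    (bC : Module.Basis (Fin n') C Ω[C⁄R]) {x : ι → A}
    (hx : Ideal.span (Set.range x) = RingHom.ker (algebraMap A C)) :
    ∃ δ : ι → Derivation R A A, ∀ i j, δ i (x j) = if i = j then 1 else 0 := by
  have hg := mapBaseChange_surjective R A C hC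
  obtain ⟨hfree, hfin, hrank⟩ := finrank_ker_of_surjective (bA.baseChange C) bC hg
  have := Module.Free.of_basis bC
  obtain ⟨π, hπ⟩ := exists_projection_ker hg
  have hx' (i : ι) : algebraMap A C (x i) = 0 := by
    rw [← RingHom.mem_ker, ← hx]; exact Ideal.subset_span ⟨i, rfl⟩
  have hspan := span_range_conormal (R := R) hC hx hx'
  let b := basisOfTopLeSpanOfCardEqFinrank _ hspan.ge (by omega)
  have hb (i : ι) : b i = conormal hx' i := by
    simp [b, basisOfTopLeSpanOfCardEqFinrank]
  choose δ hδ using fun i => exists_derivation_of_functional hC (b.coord i ∘ₗ π)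
  have hδx (i j : ι) : algebraMap A C (δ i (x j)) = if i = j then 1 else 0 := by
    have h := hπ (conormal hx' j)
    rw [hδ, LinearMap.comp_apply]
    change b.coord i (π (conormal hx' j).1) = _
    rw [h, ← hb, Module.Basis.coord_apply, Module.Basis.repr_self, Finsupp.single_apply]
    simp only [eq_comm]
  -- correct `δ` by the inverse of the matrix `δ i (x j)`, which is the identity modulo the kernel
  let N : Matrix ι ι A := Matrix.of fun i j => δ i (x j)
  have hN : (algebraMap A C).mapMatrix N = 1 := by
    ext i j
    simp [N, hδx, Matrix.one_apply]
  have hdet : IsUnit N.det := by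
    have := hC.isLocalHom
    refine isUnit_of_map_unit (algebraMap A C) _ ?_
    rw [RingHom.map_det, hN, Matrix.det_one]
    exact isUnit_one
  refine ⟨fun i => ∑ l, N⁻¹ i l • δ l, fun i j => ?_⟩
  have h := congrFun (congrFun (Matrix.nonsing_inv_mul N hdet) i) j
  rw [Matrix.mul_apply, Matrix.one_apply] at h
  rw [← h]
  exact derivation_sum_apply _ δ (x j)

/-- A derivation of the base extends to a formally smooth algebra. -/
lemma exists_derivation_extension {k R A : Type u} [CommRing k] [CommRing R] [CommRing A]
    [Algebra k R] [Algebra R A] [Algebra k A] [IsScalarTower k R A] [Algebra.FormallySmooth R A]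
    (φ : Ω[R⁄k] →ₗ[R] R) :
    ∃ δ : Derivation k A A, ∀ r, δ (algebraMap R A r) = algebraMap R A (φ (D k R r)) := by
  have hinj : Function.Injective (mapBaseChange k R A) := by
    rw [injective_iff_map_eq_zero]
    intro z hz
    obtain ⟨w, rfl⟩ := (Algebra.H1Cotangent.exact_δ_mapBaseChange k R A z).1 hz
    rw [Subsingleton.elim w 0, map_zero]
  have hsurj : Function.Surjective ((KaehlerDifferential.map k R A A).restrictScalars A) :=
    KaehlerDifferential.map_surjective k R A
  obtain ⟨π, hπ⟩ := exists_projection_ker (C := A)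
    (g := (KaehlerDifferential.map k R A A).restrictScalars A) hsurj
  have hmem (z) : mapBaseChange k R A z ∈
      LinearMap.ker ((KaehlerDifferential.map k R A A).restrictScalars A) :=
    (exact_mapBaseChange_map k R A _).2 ⟨z, rfl⟩
  let e := LinearEquiv.ofBijective ((mapBaseChange k R A).codRestrict _ hmem) ⟨fun a b hab =>
    hinj (congrArg Subtype.val hab), fun ⟨z, hz⟩ => by
      obtain ⟨w, rfl⟩ := (exact_mapBaseChange_map k R A z).1 hz
      exact ⟨w, rfl⟩⟩
  let ψ : A ⊗[R] Ω[R⁄k] →ₗ[A] A := (AlgebraTensorModule.rid R A A).toLinearMap ∘ₗ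
    AlgebraTensorModule.map LinearMap.id φ
  refine ⟨(ψ ∘ₗ e.symm.toLinearMap ∘ₗ π).compDer (D k A), fun r => ?_⟩
  have h1 : D k A (algebraMap R A r) = (e (1 ⊗ₜ D k R r)).1 := by
    refine Eq.trans ?_ (mapBaseChange_tmul k R A 1 (D k R r)).symm
    rw [KaehlerDifferential.map_D, one_smul]
  have h2 : π (D k A (algebraMap R A r)) = e (1 ⊗ₜ D k R r) := by rw [h1, hπ]
  change ψ (e.symm (π (D k A (algebraMap R A r)))) = _
  rw [h2, LinearEquiv.symm_apply_apply]
  simp [ψ, Algebra.algebraMap_eq_smul_one]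

/-- The derivation induced on a quotient by a derivation that preserves the kernel. -/
def quotDerivation {k A B : Type*} [CommRing k] [CommRing A] [CommRing B] [Algebra k A]
    [Algebra A B] [Algebra k B] [IsScalarTower k A B] (hB : Function.Surjective (algebraMap A B))
    (δ : Derivation k A A)
    (hδ : ∀ a, algebraMap A B a = 0 → algebraMap A B (δ a) = 0) : Derivation k B B :=
  have key (a : A) : algebraMap A B (δ (Function.surjInv hB (algebraMap A B a))) =
      algebraMap A B (δ a) := by
    rw [← sub_eq_zero, ← map_sub, ← map_sub]
    exact hδ _ (by rw [map_sub, Function.surjInv_eq hB, sub_self])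
  Derivation.mk'
    { toFun := fun b => algebraMap A B (δ (Function.surjInv hB b))
      map_add' := fun a b => by
        obtain ⟨a, rfl⟩ := hB a
        obtain ⟨b, rfl⟩ := hB b
        rw [← map_add, key, key, key, map_add, map_add]
      map_smul' := fun c b => by
        obtain ⟨b, rfl⟩ := hB b
        rw [RingHom.id_apply, key, Algebra.smul_def, IsScalarTower.algebraMap_apply k A B,
          ← map_mul, key, ← Algebra.smul_def, Derivation.map_smul, Algebra.smul_def, map_mul,
          ← IsScalarTower.algebraMap_apply, Algebra.smul_def] }
    fun a b => by
      obtain ⟨a, rfl⟩ := hB a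
      obtain ⟨b, rfl⟩ := hB b
      simp only [LinearMap.coe_mk, AddHom.coe_mk]
      rw [← map_mul, key, key, key, Derivation.leibniz, map_add, smul_eq_mul, smul_eq_mul, map_mul,
        map_mul, smul_eq_mul, smul_eq_mul]

lemma quotDerivation_algebraMap {k A B : Type*} [CommRing k] [CommRing A] [CommRing B]
    [Algebra k A] [Algebra A B] [Algebra k B] [IsScalarTower k A B]
    (hB : Function.Surjective (algebraMap A B)) (δ : Derivation k A A)
    (hδ : ∀ a, algebraMap A B a = 0 → algebraMap A B (δ a) = 0) (a : A) :
    quotDerivation hB δ hδ (algebraMap A B a) = algebraMap A B (δ a) := by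
  change algebraMap A B (δ (Function.surjInv hB (algebraMap A B a))) = _
  rw [← sub_eq_zero, ← map_sub, ← map_sub]
  exact hδ _ (by rw [map_sub, Function.surjInv_eq hB, sub_self])

/-- Derivations dual to coordinates of the base exist on a normal crossings divisor, if there are
derivations of the ambient space that are dual to the equations of the components. They are
obtained by correcting derivations of the ambient space so that they preserve these equations. -/
lemma hasDualDerivations_of_equations {k R A B : Type u} [CommRing k] [CommRing R] [CommRing A]
    [CommRing B] [Algebra k R] [Algebra R A] [Algebra k A] [IsScalarTower k R A] [Algebra A B]
    [Algebra k B] [Algebra R B] [IsScalarTower k A B] [IsScalarTower R A B]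
    [IsLocalRing R] [Module.Free R Ω[R⁄k]] [Module.Finite R Ω[R⁄k]] [Algebra.FormallySmooth R A]
    (hB : Function.Surjective (algebraMap A B)) {ι : Type*} [Fintype ι] [DecidableEq ι]
    {x : ι → A} (hx : RingHom.ker (algebraMap A B) = ⨅ i, Ideal.span {x i})
    {ε : ι → Derivation R A A} (hε : ∀ i j, ε i (x j) = if i = j then 1 else 0) :
    HasDualDerivations k R B := by
  have := Module.finitePresentation_of_projective R Ω[R⁄k]
  obtain ⟨κ, y, b, hb⟩ := Module.exists_basis_of_span_of_flat (R := R) (M := Ω[R⁄k]) (D k R)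
    (by rw [span_range_derivation])
  have := Module.Finite.finite_basis b
  have := Fintype.ofFinite κ
  choose δ hδ using fun j => exists_derivation_extension (A := A) (b.coord j)
  let δ' (j : κ) : Derivation k A A := δ j - ∑ i, δ j (x i) • (ε i).restrictScalars k
  have hδ' (j : κ) (a : A) : δ' j a = δ j a - ∑ i, δ j (x i) * ε i a := by
    have h := derivation_sum_apply (fun i => δ j (x i)) (fun i => (ε i).restrictScalars k) a
    rw [Derivation.sub_apply, h]
    rfl
  have hδ'x (j : κ) (i : ι) : δ' j (x i) = 0 := by
    rw [hδ']
    simp [hε]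
  have hpres (j : κ) (a : A) (ha : algebraMap A B a = 0) : algebraMap A B (δ' j a) = 0 := by
    rw [← RingHom.mem_ker, hx, Ideal.mem_iInf] at ha ⊢
    intro i
    obtain ⟨c, rfl⟩ := Ideal.mem_span_singleton'.1 (ha i)
    rw [Derivation.leibniz, hδ'x, smul_zero, zero_add, smul_eq_mul]
    exact Ideal.mul_mem_right _ _ (Ideal.mem_span_singleton_self _)
  let e := Fintype.equivFin κ
  refine ⟨Fintype.card κ, fun i => y (e.symm i), fun i => quotDerivation hB (δ' (e.symm i))
    (hpres _), fun i j => ?_, ?_⟩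
  · rw [IsScalarTower.algebraMap_apply R A B, quotDerivation_algebraMap, hδ', hδ, ← hb]
    by_cases h : i = j
    · subst h
      simp
    · have h' : e.symm j ≠ e.symm i := fun h₁ => h (e.symm.injective h₁).symm
      simp [h, Finsupp.single_eq_of_ne' h']
  · have h : (fun i => D k R (y (e.symm i))) = b ∘ e.symm := funext fun i => (hb _).symm
    rw [h, Set.range_comp, e.symm.surjective.range_eq, Set.image_univ, b.span_eq]

end NormalCrossings

end ExteriorShuffle

namespace TorsionFreeDiff

/-! ### Stalks of smooth morphisms -/

section SmoothStalk

open KaehlerDifferential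

lemma map_bijective_of_formallyUnramified {R S B : Type*} [CommRing R] [CommRing S] [CommRing B]
    [Algebra R S] [Algebra S B] [Algebra R B] [IsScalarTower R S B]
    [Algebra.FormallyUnramified R S] :
    Function.Bijective (KaehlerDifferential.map R S B B) := by
  refine ⟨?_, KaehlerDifferential.map_surjective R S B⟩
  rw [injective_iff_map_eq_zero]
  intro x hx
  obtain ⟨y, rfl⟩ := (exact_mapBaseChange_map R S B x).mp hx
  rw [Subsingleton.elim y 0, map_zero]

/-- Relative differentials remain free, with a basis of the same size, under localization of both
rings. -/
lemma nonempty_basis_kaehler_of_isLocalization {R₀ A₀ R A ι : Type*} [CommRing R₀] [CommRing A₀]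
    [CommRing R] [CommRing A] [Algebra R₀ A₀] [Algebra R₀ R] [Algebra R₀ A] [Algebra A₀ A]
    [Algebra R A] [IsScalarTower R₀ A₀ A] [IsScalarTower R₀ R A] (M : Submonoid R₀)
    (N : Submonoid A₀) [IsLocalization M R] [IsLocalization N A]
    (b : Module.Basis ι A₀ Ω[A₀⁄R₀]) : Nonempty (Module.Basis ι A Ω[A⁄R]) := by
  have := Algebra.FormallyUnramified.of_isLocalization (Rₘ := R) M
  let b' : Module.Basis ι A Ω[A⁄R₀] :=
    b.ofIsLocalizedModule A N (KaehlerDifferential.map R₀ R₀ A₀ A)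
  exact ⟨b'.map (LinearEquiv.ofBijective (KaehlerDifferential.map R₀ R A A)
    map_bijective_of_formallyUnramified)⟩

lemma nonempty_basis_kaehler_stalk {X Y : Scheme.{u}} (f : X ⟶ Y) {U : Y.Opens}
    (hU : IsAffineOpen U) {V : X.Opens} (hV : IsAffineOpen V) (e : V ≤ f ⁻¹ᵁ U) {x : X}
    (hx : x ∈ V) {ι : Type*}
    (h : letI := (f.appLE U V e).hom.toAlgebra
      Nonempty (Module.Basis ι Γ(X, V) Ω[Γ(X, V)⁄Γ(Y, U)])) :
    letI := (f.stalkMap x).hom.toAlgebra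
    Nonempty (Module.Basis ι (X.presheaf.stalk x)
      Ω[X.presheaf.stalk x⁄Y.presheaf.stalk (f x)]) := by
  let := (f.appLE U V e).hom.toAlgebra
  let := (f.stalkMap x).hom.toAlgebra
  let := Y.presheaf.algebra_section_stalk ⟨f x, e hx⟩
  let := X.presheaf.algebra_section_stalk ⟨x, hx⟩
  have := hU.isLocalization_stalk ⟨f x, e hx⟩
  have := hV.isLocalization_stalk ⟨x, hx⟩
  let : Algebra Γ(Y, U) (X.presheaf.stalk x) :=
    ((X.presheaf.germ V x hx).hom.comp (f.appLE U V e).hom).toAlgebra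
  have : IsScalarTower Γ(Y, U) Γ(X, V) (X.presheaf.stalk x) := .of_algebraMap_eq' rfl
  have : IsScalarTower Γ(Y, U) (Y.presheaf.stalk (f x)) (X.presheaf.stalk x) := by
    refine .of_algebraMap_eq fun a => ?_
    refine Eq.trans ?_ (f.germ_stalkMap_apply U x (e hx) a).symm
    change X.presheaf.germ V x hx (f.appLE U V e a) = _
    simp only [Scheme.Hom.appLE, CommRingCat.comp_apply]
    exact X.presheaf.germ_res_apply (homOfLE e) x hx _
  obtain ⟨b⟩ := h
  exact nonempty_basis_kaehler_of_isLocalization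
    (hU.primeIdealOf ⟨f x, e hx⟩).asIdeal.primeCompl (hV.primeIdealOf ⟨x, hx⟩).asIdeal.primeCompl b

lemma nonempty_basis_kaehler_stalk_of_smoothOfRelativeDimension {X Y : Scheme.{u}} (f : X ⟶ Y)
    (n : ℕ) [SmoothOfRelativeDimension n f] (x : X) :
    letI := (f.stalkMap x).hom.toAlgebra
    Nonempty (Module.Basis (Fin n) (X.presheaf.stalk x)
      Ω[X.presheaf.stalk x⁄Y.presheaf.stalk (f x)]) := by
  obtain ⟨U, hU, V, hV, hx, e, h⟩ :=
    SmoothOfRelativeDimension.exists_isStandardSmoothOfRelativeDimension (n := n) (f := f) x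
  refine nonempty_basis_kaehler_stalk f hU hV e hx ?_
  algebraize [(f.appLE U V e).hom]
  have : Nonempty V := ⟨⟨x, hx⟩⟩
  have : Algebra.IsStandardSmooth Γ(Y, U) Γ(X, V) :=
    Algebra.IsStandardSmoothOfRelativeDimension.isStandardSmooth n
  have hr : Module.rank Γ(X, V) Ω[Γ(X, V)⁄Γ(Y, U)] = n :=
    Algebra.IsStandardSmoothOfRelativeDimension.rank_kaehlerDifferential n
  exact ⟨Module.finBasisOfFinrankEq _ _ (Module.finrank_eq_of_rank_eq hr)⟩

lemma exists_basis_kaehler_stalk_of_smooth {X Y : Scheme.{u}} (f : X ⟶ Y) [Smooth f] (x : X) :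
    letI := (f.stalkMap x).hom.toAlgebra
    ∃ n : ℕ, Nonempty (Module.Basis (Fin n) (X.presheaf.stalk x)
      Ω[X.presheaf.stalk x⁄Y.presheaf.stalk (f x)]) := by
  obtain ⟨U, hU, V, hV, hx, e, h⟩ := Smooth.exists_isStandardSmooth f x
  algebraize [(f.appLE U V e).hom]
  have : Nonempty V := ⟨⟨x, hx⟩⟩
  exact ⟨_, nonempty_basis_kaehler_stalk f hU hV e hx
    ⟨Module.finBasis Γ(X, V) Ω[Γ(X, V)⁄Γ(Y, U)]⟩⟩

lemma formallySmooth_stalkMap {X Y : Scheme.{u}} (f : X ⟶ Y) [Smooth f] (x : X) :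
    (f.stalkMap x).hom.FormallySmooth := by
  rw [← Scheme.Hom.mem_smoothLocus, Scheme.Hom.smoothLocus_eq_top]
  trivial

end SmoothStalk

end TorsionFreeDiff

namespace TorsionFreeDiff

/-! ### Stalks of ideal sheaves -/

section StalkIdeal

open Scheme

variable {X : Scheme.{u}}

/-- The stalk at `x` of a quasi-coherent ideal sheaf, as an ideal of the local ring `𝒪_{X,x}`: the
ideal generated by the germs of all sections over affine neighbourhoods of `x`. -/
def stalkIdeal (I : X.IdealSheafData) (x : X) : Ideal (X.presheaf.stalk x) :=
  ⨆ (V : X.affineOpens) (hV : x ∈ V.1), (I.ideal V).map (X.presheaf.germ V.1 x hV).hom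

lemma exists_affineOpen_le {U : X.Opens} {x : X} (hx : x ∈ U) :
    ∃ V : X.affineOpens, x ∈ V.1 ∧ V.1 ≤ U := by
  obtain ⟨_, ⟨V, hV, rfl⟩, hxV, hVU⟩ := X.isBasis_affineOpens.exists_subset_of_mem_open hx U.2
  exact ⟨⟨V, hV⟩, hxV, hVU⟩

lemma map_germ_ideal_of_le (I : X.IdealSheafData) {V W : X.affineOpens} (h : W ≤ V) {x : X}
    (hx : x ∈ W.1) :
    (I.ideal V).map (X.presheaf.germ V.1 x (h hx)).hom =
      (I.ideal W).map (X.presheaf.germ W.1 x hx).hom := by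
  rw [← I.map_ideal h, Ideal.map_map, ← CommRingCat.hom_comp]
  exact congrArg (fun g => Ideal.map (CommRingCat.Hom.hom g) (I.ideal V))
    (X.presheaf.germ_res (homOfLE h) x hx).symm

/-- The stalk of an ideal sheaf can be computed on any affine neighbourhood. -/
lemma stalkIdeal_eq_map_germ (I : X.IdealSheafData) {V : X.affineOpens} {x : X} (hx : x ∈ V.1) :
    stalkIdeal I x = (I.ideal V).map (X.presheaf.germ V.1 x hx).hom := by
  refine le_antisymm (iSup₂_le fun W hW => ?_)
    (le_iSup₂ (f := fun (V : X.affineOpens) (hV : x ∈ V.1) =>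
      (I.ideal V).map (X.presheaf.germ V.1 x hV).hom) V hx)
  obtain ⟨T, hT, hTVW⟩ := exists_affineOpen_le (U := V.1 ⊓ W.1) (x := x) ⟨hx, hW⟩
  rw [map_germ_ideal_of_le I (W := T) (hTVW.trans inf_le_right) hT,
    map_germ_ideal_of_le I (W := T) (hTVW.trans inf_le_left) hT]

lemma stalkIdeal_top (x : X) : stalkIdeal (⊤ : X.IdealSheafData) x = ⊤ := by
  obtain ⟨V, hV, -⟩ := exists_affineOpen_le (U := ⊤) (x := x) trivial
  rw [stalkIdeal_eq_map_germ _ hV, IdealSheafData.ideal_top]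
  exact Ideal.map_top _

lemma stalkIdeal_iSup {ι : Sort*} (I : ι → X.IdealSheafData) (x : X) :
    stalkIdeal (⨆ i, I i) x = ⨆ i, stalkIdeal (I i) x := by
  obtain ⟨V, hV, -⟩ := exists_affineOpen_le (U := ⊤) (x := x) trivial
  simp_rw [stalkIdeal_eq_map_germ _ hV]
  change Ideal.map _ ((sSup (Set.range I)).ideal V) = _
  rw [IdealSheafData.ideal_sSup, ← Set.range_comp, sSup_range, iSup_apply, Ideal.map_iSup]
  rfl

lemma stalkIdeal_inf (I J : X.IdealSheafData) (x : X) :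
    stalkIdeal (I ⊓ J) x = stalkIdeal I x ⊓ stalkIdeal J x := by
  obtain ⟨V, hV, -⟩ := exists_affineOpen_le (U := ⊤) (x := x) trivial
  simp_rw [stalkIdeal_eq_map_germ _ hV, IdealSheafData.ideal_inf]
  let := X.presheaf.algebra_section_stalk ⟨x, hV⟩
  have := V.2.isLocalization_stalk ⟨x, hV⟩
  exact IsLocalization.map_inf (V.2.primeIdealOf ⟨x, hV⟩).asIdeal.primeCompl
    (X.presheaf.stalk x) _ _

lemma stalkIdeal_eq_top_of_notMem_support {I : X.IdealSheafData} {x : X} (hx : x ∉ I.support) :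
    stalkIdeal I x = ⊤ := by
  obtain ⟨V, hV, -⟩ := exists_affineOpen_le (U := ⊤) (x := x) trivial
  rw [IdealSheafData.mem_support_iff_of_mem hV, Scheme.mem_zeroLocus_iff] at hx
  push Not at hx
  obtain ⟨s, hs, hxs⟩ := hx
  rw [stalkIdeal_eq_map_germ _ hV]
  exact Ideal.eq_top_of_isUnit_mem _ (Ideal.mem_map_of_mem _ hs)
    ((X.mem_basicOpen s x hV).mp hxs)

lemma stalkIdeal_vanishingIdeal_finsetSup {κ : Type*} (E : Finset κ) (Z : κ → Closeds X) (x : X) :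
    stalkIdeal (IdealSheafData.vanishingIdeal (E.sup Z)) x =
      E.inf fun e => stalkIdeal (IdealSheafData.vanishingIdeal (Z e)) x := by
  classical
  induction E using Finset.induction_on with
  | empty => simp [stalkIdeal_top]
  | insert e E he ih =>
    rw [Finset.sup_insert, Finset.inf_insert, IdealSheafData.vanishingIdeal_sup, stalkIdeal_inf, ih]

/-- The kernel of `𝒪_{X,x} → 𝒪_{Z,x}`, for a closed subscheme `Z`, is the stalk of the ideal sheaf
of `Z`. -/
lemma ker_stalkMap_subschemeι (I : X.IdealSheafData) (z : I.subscheme) :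
    RingHom.ker (I.subschemeι.stalkMap z).hom = stalkIdeal I (I.subschemeι z) := by
  refine le_antisymm (fun b hb => ?_) (iSup₂_le fun V hV => ?_)
  · obtain ⟨U, hxU, a, rfl⟩ := TopCat.Presheaf.exists_germ_eq X.presheaf b
    have h0 : I.subscheme.presheaf.germ (I.subschemeι ⁻¹ᵁ U) z hxU (I.subschemeι.app U a) =
        I.subscheme.presheaf.germ (I.subschemeι ⁻¹ᵁ U) z hxU 0 :=
      ((I.subschemeι.germ_stalkMap_apply U z hxU a).symm.trans hb).trans (map_zero _).symm
    obtain ⟨W, hzW, i, _, hW⟩ := TopCat.Presheaf.germ_eq _ z hxU hxU _ _ h0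
    obtain ⟨W', hW', hWW'⟩ := I.subschemeι.isEmbedding.isInducing.isOpen_iff.mp W.2
    obtain ⟨V, hxV, hV⟩ := exists_affineOpen_le (U := U ⊓ ⟨W', hW'⟩) (x := I.subschemeι z)
      ⟨hxU, (Set.ext_iff.mp hWW' z).mpr hzW⟩
    have hVU : V.1 ≤ U := hV.trans inf_le_left
    have hVW : I.subschemeι ⁻¹ᵁ V.1 ≤ W := fun y hy => (Set.ext_iff.mp hWW' y).mp (hV hy).2
    rw [stalkIdeal_eq_map_germ I hxV, ← X.presheaf.germ_res_apply (homOfLE hVU) _ hxV]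
    refine Ideal.mem_map_of_mem _ ?_
    rw [← I.ker_subschemeι_app V, RingHom.mem_ker]
    have h1 := congrArg (I.subscheme.presheaf.map (homOfLE hVW).op) hW
    rw [map_zero, map_zero, ← CommRingCat.comp_apply, ← I.subscheme.presheaf.map_comp] at h1
    refine Eq.trans ?_ h1
    exact ConcreteCategory.congr_hom (I.subschemeι.naturality (homOfLE hVU).op) a
  · rw [Ideal.map_le_iff_le_comap]
    intro a ha
    rw [← I.ker_subschemeι_app V] at ha
    rw [Ideal.mem_comap, RingHom.mem_ker]
    refine (I.subschemeι.germ_stalkMap_apply V.1 z hV a).trans ?_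
    rw [show I.subschemeι.app V.1 a = 0 from ha, map_zero]

end StalkIdeal

end TorsionFreeDiff

namespace TorsionFreeDiff

/-! ### Local equations of a relatively snc divisor -/

section SmoothQuotient

open KaehlerDifferential ExteriorShuffle

/-- The quotient of the `R`-algebra `A` by the ideal `J` is local and formally smooth over `R`, and
its module of differentials over `R` has a basis with `k` elements. The quotient is represented by
any surjection `A → C` with kernel `J`, so that `C` can be the local ring of a closed subscheme. -/
def HasSmoothQuotient {R A : Type u} [CommRing R] [CommRing A] [Algebra R A] (J : Ideal A)
    (k : ℕ) : Prop :=
  ∃ (C : Type u) (_ : CommRing C) (_ : Algebra A C) (_ : Algebra R C),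
    IsScalarTower R A C ∧ IsLocalRing C ∧ Algebra.FormallySmooth R C ∧
    Function.Surjective (algebraMap A C) ∧ RingHom.ker (algebraMap A C) = J ∧
    Nonempty (Module.Basis (Fin k) C Ω[C⁄R])

/-- If the ideals `J i` and their sum all define formally smooth quotients of `A`, of the
codimensions expected of a divisor with normal crossings, then the `R`-derivations of `A` dual to
generators of the `J i` exist, and provide dual derivations on `B = A / ⋂ J i`. -/
lemma hasDualDerivations_of_hasSmoothQuotient {k R A B : Type u} [CommRing k] [CommRing R]
    [CommRing A] [CommRing B] [Algebra k R] [Algebra R A] [Algebra k A] [IsScalarTower k R A]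
    [Algebra A B] [Algebra k B] [Algebra R B] [IsScalarTower k A B] [IsScalarTower R A B]
    [IsLocalRing R] [IsLocalRing A] [IsNoetherianRing A] {d : ℕ}
    (bR : Module.Basis (Fin d) R Ω[R⁄k]) [Algebra.FormallySmooth R A] {n : ℕ}
    (bA : Module.Basis (Fin n) A Ω[A⁄R]) (hB : Function.Surjective (algebraMap A B)) {ι : Type*}
    [Fintype ι] {J : ι → Ideal A} (hJ : ∀ i, ∃ n', n = n' + 1 ∧ HasSmoothQuotient (R := R) (J i) n')
    (hsum : ∃ n', n = n' + Fintype.card ι ∧ HasSmoothQuotient (R := R) (⨆ i, J i) n')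
    (hker : RingHom.ker (algebraMap A B) = ⨅ i, J i) :
    HasDualDerivations k R B := by
  classical
  have := Module.Free.of_basis bR
  have := Module.Finite.of_basis bR
  have hx : ∀ i, ∃ x, J i = Ideal.span {x} := by
    intro i
    obtain ⟨n', hn, C, _, _, _, _, _, _, hC, hk, ⟨bC⟩⟩ := hJ i
    obtain ⟨x, hx⟩ := exists_ker_eq_span_singleton hC hn bA bC
    exact ⟨x, hk.symm.trans hx⟩
  choose x hx using hx
  obtain ⟨n', hn, C, _, _, _, _, _, _, hC, hk, ⟨bC⟩⟩ := hsum
  have hs : Ideal.span (Set.range x) = RingHom.ker (algebraMap A C) := by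
    rw [hk, ← Set.iUnion_singleton_eq_range, Ideal.span_iUnion]
    simp_rw [hx]
  obtain ⟨ε, hε⟩ := exists_derivation_dual hC hn bA bC hs
  refine hasDualDerivations_of_equations hB (x := x) ?_ hε
  rw [hker]
  simp_rw [hx]

variable {X Y S : Scheme.{u}}

/-- At a point of a closed subscheme that is smooth over `Y`, the stalk of the ideal sheaf defines a
smooth quotient of the local ring. -/
lemma hasSmoothQuotient_stalkIdeal (φ : X ⟶ Y) (I : X.IdealSheafData) (k : ℕ)
    [SmoothOfRelativeDimension k (I.subschemeι ≫ φ)] {x : X} (hx : x ∈ I.support) :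
    letI := (φ.stalkMap x).hom.toAlgebra
    HasSmoothQuotient (R := Y.presheaf.stalk (φ x)) (stalkIdeal I x) k := by
  rw [← SetLike.mem_coe, ← I.range_subschemeι] at hx
  obtain ⟨z, rfl⟩ := hx
  let := (φ.stalkMap (I.subschemeι z)).hom.toAlgebra
  let := (I.subschemeι.stalkMap z).hom.toAlgebra
  let : Algebra (Y.presheaf.stalk (φ (I.subschemeι z))) (I.subscheme.presheaf.stalk z) :=
    ((I.subschemeι ≫ φ).stalkMap z).hom.toAlgebra
  have := SmoothOfRelativeDimension.smooth k (I.subschemeι ≫ φ)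
  refine ⟨I.subscheme.presheaf.stalk z, inferInstance, inferInstance, inferInstance, ?_,
    inferInstance, formallySmooth_stalkMap (I.subschemeι ≫ φ) z,
    I.subschemeι.stalkMap_surjective z, ker_stalkMap_subschemeι I z,
    nonempty_basis_kaehler_stalk_of_smoothOfRelativeDimension (I.subschemeι ≫ φ) k z⟩
  refine .of_algebraMap_eq' ?_
  refine congrArg CommRingCat.Hom.hom (Scheme.Hom.stalkMap_comp I.subschemeι φ z)

lemma mem_support_stratumIdeal {I : Finset X} {x : X} :
    x ∈ (stratumIdeal I).support ↔ ∀ e ∈ I, x ∈ Closeds.closure {e} := by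
  simp [stratumIdeal]

lemma stalkIdeal_stratumIdeal (I : Finset X) (x : X) :
    stalkIdeal (stratumIdeal I) x = ⨆ e : I,
      stalkIdeal (Scheme.IdealSheafData.vanishingIdeal (Closeds.closure {e.1})) x := by
  rw [stratumIdeal, iSup_subtype', stalkIdeal_iSup]

end SmoothQuotient

end TorsionFreeDiff

namespace TorsionFreeDiff

/-! ### Dual derivations along a relatively snc divisor -/

section RelativelySNC

open KaehlerDifferential ExteriorShuffle

variable {X Y S : Scheme.{u}}

/-- The stratum belonging to the empty set of components is `X` itself. -/
lemma smoothOfRelativeDimension_of_stratum_empty {φ : X ⟶ Y} {k : ℕ}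
    (h : SmoothOfRelativeDimension k (stratumι (∅ : Finset X) ≫ φ)) :
    SmoothOfRelativeDimension k φ := by
  have hbot : stratumIdeal (∅ : Finset X) = ⊥ := by simp [stratumIdeal]
  have : IsIso (stratumι (∅ : Finset X)) :=
    (Scheme.isIso_subschemeι_iff_eq_bot _).mpr hbot
  have h' : SmoothOfRelativeDimension (0 + k)
      (inv (stratumι (∅ : Finset X)) ≫ stratumι (∅ : Finset X) ≫ φ) := inferInstance
  rwa [IsIso.inv_hom_id_assoc, zero_add] at h'

/-- The components of `D` through a given point define a smooth quotient of the local ring, of the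
expected dimension. -/
lemma IsRelativelySNC.exists_hasSmoothQuotient {φ : X ⟶ Y} {D : Finset X}
    (h : IsRelativelySNC φ D) {n m : ℕ} (hn : topologicalKrullDim X = n)
    (hm : topologicalKrullDim Y = m) {I : Finset X} (hI : I ⊆ D) {x : X}
    (hx : ∀ e ∈ I, x ∈ Closeds.closure {e}) :
    letI := (φ.stalkMap x).hom.toAlgebra
    ∃ k, n = m + (I.card + k) ∧
      HasSmoothQuotient (R := Y.presheaf.stalk (φ x)) (⨆ e : I,
        stalkIdeal (Scheme.IdealSheafData.vanishingIdeal (Closeds.closure {e.1})) x) k := by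
  have hx' : x ∈ (stratumIdeal I).support := mem_support_stratumIdeal.mpr hx
  obtain ⟨z, -⟩ : ∃ z, (stratumIdeal I).subschemeι z = x := by
    rwa [← SetLike.mem_coe, ← (stratumIdeal I).range_subschemeι] at hx'
  obtain ⟨k, hk, hs⟩ := h.smooth_stratum I hI ⟨z⟩
  refine ⟨k, ?_, ?_⟩
  · rw [hn, hm] at hk
    exact_mod_cast hk
  · have : SmoothOfRelativeDimension k ((stratumIdeal I).subschemeι ≫ φ) := hs
    rw [← stalkIdeal_stratumIdeal]
    exact hasSmoothQuotient_stalkIdeal φ _ k hx'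

/-- The local rings of a relatively snc divisor `D` carry derivations dual to differentials of
functions on `Y`. -/
lemma IsRelativelySNC.hasDualDerivations [IsLocallyNoetherian X] {φ : X ⟶ Y} {D : Finset X}
    (h : IsRelativelySNC φ D) (s : Y ⟶ S) [Smooth s] {n m : ℕ} (hn : topologicalKrullDim X = n)
    (hm : topologicalKrullDim Y = m) (z : divisorScheme D) :
    letI := ((divisorι D ≫ φ).stalkMap z).hom.toAlgebra
    letI := (s.stalkMap ((divisorι D ≫ φ) z)).hom.toAlgebra
    letI := (((divisorι D ≫ φ).stalkMap z).hom.comp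
      (s.stalkMap ((divisorι D ≫ φ) z)).hom).toAlgebra
    HasDualDerivations (S.presheaf.stalk (s ((divisorι D ≫ φ) z)))
      (Y.presheaf.stalk ((divisorι D ≫ φ) z)) ((divisorScheme D).presheaf.stalk z) := by
  classical
  set x : X := divisorι D z with hxz
  let : Algebra (Y.presheaf.stalk ((divisorι D ≫ φ) z)) ((divisorScheme D).presheaf.stalk z) :=
    ((divisorι D ≫ φ).stalkMap z).hom.toAlgebra
  let : Algebra (S.presheaf.stalk (s ((divisorι D ≫ φ) z)))
    (Y.presheaf.stalk ((divisorι D ≫ φ) z)) := (s.stalkMap ((divisorι D ≫ φ) z)).hom.toAlgebra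
  let : Algebra (S.presheaf.stalk (s ((divisorι D ≫ φ) z)))
      ((divisorScheme D).presheaf.stalk z) := (((divisorι D ≫ φ).stalkMap z).hom.comp
      (s.stalkMap ((divisorι D ≫ φ) z)).hom).toAlgebra
  let : Algebra (Y.presheaf.stalk ((divisorι D ≫ φ) z)) (X.presheaf.stalk x) :=
    (φ.stalkMap x).hom.toAlgebra
  let : Algebra (X.presheaf.stalk x) ((divisorScheme D).presheaf.stalk z) :=
    ((divisorι D).stalkMap z).hom.toAlgebra
  let : Algebra (S.presheaf.stalk (s ((divisorι D ≫ φ) z))) (X.presheaf.stalk x) :=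
    ((φ.stalkMap x).hom.comp (s.stalkMap ((divisorι D ≫ φ) z)).hom).toAlgebra
  have t1 : IsScalarTower (S.presheaf.stalk (s ((divisorι D ≫ φ) z)))
    (Y.presheaf.stalk ((divisorι D ≫ φ) z)) (X.presheaf.stalk x) := .of_algebraMap_eq' rfl
  have hc : ((divisorι D ≫ φ).stalkMap z).hom =
      ((divisorι D).stalkMap z).hom.comp (φ.stalkMap x).hom :=
    congrArg CommRingCat.Hom.hom (Scheme.Hom.stalkMap_comp (divisorι D) φ z)
  have t2 : IsScalarTower (Y.presheaf.stalk ((divisorι D ≫ φ) z)) (X.presheaf.stalk x)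
    ((divisorScheme D).presheaf.stalk z) := .of_algebraMap_eq' hc
  have t3 : IsScalarTower (S.presheaf.stalk (s ((divisorι D ≫ φ) z))) (X.presheaf.stalk x)
      ((divisorScheme D).presheaf.stalk z) :=
    .of_algebraMap_eq' (congrArg (fun g : Y.presheaf.stalk ((divisorι D ≫ φ) z) →+*
      (divisorScheme D).presheaf.stalk z => g.comp (s.stalkMap ((divisorι D ≫ φ) z)).hom) hc)
  have : Nonempty (stratum (∅ : Finset X)) := by
    have hx' : x ∈ (stratumIdeal (∅ : Finset X)).support :=
      mem_support_stratumIdeal.mpr (by simp)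
    rw [← SetLike.mem_coe, ← (stratumIdeal (∅ : Finset X)).range_subschemeι] at hx'
    exact ⟨hx'.choose⟩
  obtain ⟨k₀, hk₀, hs⟩ := h.smooth_stratum ∅ (Finset.empty_subset D) this
  have hk₀' : n = m + k₀ := by
    rw [hn, hm, Finset.card_empty, zero_add] at hk₀
    exact_mod_cast hk₀
  have := smoothOfRelativeDimension_of_stratum_empty hs
  have := SmoothOfRelativeDimension.smooth k₀ φ
  obtain ⟨d, ⟨bR⟩⟩ := exists_basis_kaehler_stalk_of_smooth s ((divisorι D ≫ φ) z)
  obtain ⟨bA⟩ := nonempty_basis_kaehler_stalk_of_smoothOfRelativeDimension φ k₀ x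
  have : Algebra.FormallySmooth (Y.presheaf.stalk ((divisorι D ≫ φ) z)) (X.presheaf.stalk x) :=
    formallySmooth_stalkMap φ x
  let I : Finset X := D.filter fun e => x ∈ Closeds.closure {e}
  refine hasDualDerivations_of_hasSmoothQuotient (A := X.presheaf.stalk x) bR bA
    ((Scheme.IdealSheafData.subschemeι _).stalkMap_surjective z) (ι := I)
    (J := fun e => stalkIdeal (Scheme.IdealSheafData.vanishingIdeal (Closeds.closure {e.1})) x)
    ?_ ?_ ?_
  · rintro ⟨e, he⟩
    obtain ⟨k, hk, hq⟩ := h.exists_hasSmoothQuotient hn hm (I := {e}) (x := x)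
      (by simpa using (Finset.mem_filter.mp he).1) (by simpa using (Finset.mem_filter.mp he).2)
    refine ⟨k, by rw [Finset.card_singleton] at hk; omega, ?_⟩
    simp only [iSup_subtype, Finset.mem_singleton, iSup_iSup_eq_left] at hq
    exact hq
  · obtain ⟨k, hk, hq⟩ := h.exists_hasSmoothQuotient hn hm (I := I) (x := x)
      (Finset.filter_subset _ _) (fun e he => (Finset.mem_filter.mp he).2)
    exact ⟨k, by rw [Fintype.card_coe]; omega, hq⟩
  · refine (ker_stalkMap_subschemeι _ z).trans ?_
    refine (stalkIdeal_vanishingIdeal_finsetSup D _ x).trans ?_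
    rw [Finset.inf_eq_iInf, iInf_subtype]
    refine iInf_congr fun e => ?_
    by_cases he : e ∈ D
    · by_cases hx : x ∈ Closeds.closure {e}
      · have : e ∈ I := Finset.mem_filter.mpr ⟨he, hx⟩
        simp [he, this]
      · -- a component that does not contain `x` does not contribute to the intersection
        have : e ∉ I := fun h' => hx (Finset.mem_filter.mp h').2
        simp only [he, this, iInf_true, iInf_false]
        exact stalkIdeal_eq_top_of_notMem_support hx
    · have : e ∉ I := fun h' => he (Finset.mem_filter.mp h').1
      simp [he, this]

end RelativelySNC

end TorsionFreeDiff

end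

theorem proposition3p11 {X Y : Scheme.{0}}
    (sX : X ⟶ Spec (.of ℂ)) (sY : Y ⟶ Spec (.of ℂ))
    (hX : TorsionFreeDiff.IsVariety sX) (hY : TorsionFreeDiff.IsVariety sY) (hYs : Smooth sY)
    (φ : X ⟶ Y) (hφ : φ ≫ sY = sX)
    (E : Finset X) (hE : TorsionFreeDiff.IsReducedDivisor E)
    (hsnc : TorsionFreeDiff.IsSNCPair sX E)
    (hrel : TorsionFreeDiff.IsRelativelySNC φ E)
    (n m : ℕ) (hn : topologicalKrullDim X = n) (hm : topologicalKrullDim Y = m)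
    (p : ℕ) (hp : p + 1 ≤ n) :
    ∃ (F : ℕ → Subobject (TorsionFreeDiff.OmegaCheck (TorsionFreeDiff.divisorι E ≫ sX) p))
      (hF : ∀ r, F (r + 1) ≤ F r),
      F 0 = ⊤ ∧ F (p + 1) = ⊥ ∧
      ∀ r ≤ p,
        ∃ (g : (F r : (TorsionFreeDiff.divisorScheme E).Modules) ⟶
            TorsionFreeDiff.tensor
              ((Scheme.Modules.pullback (TorsionFreeDiff.divisorι E ≫ φ)).obj
                (TorsionFreeDiff.Omega sY r))
              (TorsionFreeDiff.OmegaCheck (TorsionFreeDiff.divisorι E ≫ φ) (p - r)))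
          (w : Subobject.ofLE (F (r + 1)) (F r) (hF r) ≫ g = 0),
          (ShortComplex.mk (Subobject.ofLE (F (r + 1)) (F r) (hF r)) g w).ShortExact := by
  subst hφ
  have := hX.locallyOfFiniteType
  have : IsLocallyNoetherian X := LocallyOfFiniteType.isLocallyNoetherian (φ ≫ sY)
  have : LocallyOfFiniteType (TorsionFreeDiff.divisorι E) :=
    inferInstanceAs (LocallyOfFiniteType (Scheme.IdealSheafData.subschemeι _))
  have : IsLocallyNoetherian (TorsionFreeDiff.divisorScheme E) :=
    LocallyOfFiniteType.isLocallyNoetherian (TorsionFreeDiff.divisorι E)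
  exact TorsionFreeDiff.exists_filtration_of_dualDerivations (TorsionFreeDiff.divisorι E ≫ φ) sY
    (TorsionFreeDiff.divisorι E ≫ φ ≫ sY) (Category.assoc _ _ _)
    (hrel.hasDualDerivations sY hn hm) p
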